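/- **Lemma 5.1.** Let $2A_n$ ($n=8,10,11$) be the nonsplit double cover of the alternating group $A_n$, i.e. the preimage of $A_n\subset SO(n)$ (permutation matrices) under $\mathrm{Spin}(n)\to SO(n)$. Let $2S_8\subset 2A_{10}$ be the preimage of the copy of the symmetric group $S_8$ in $A_{10}$ generated by $(1,2)(9,10),(2,3)(9,10),\dots,(7,8)(9,10)$, and let $Ly$ be the Lyons group, i.e. the finite simple group having an involution whose centralizer is isomorphic to $2A_{11}$. Let $UT_3(4)$ be the group of matrices $(\alpha,\beta,\gamma)=\begin{pmatrix}1&\alpha&\beta\\0&1&\gamma\\0&0&1\end{pmatrix}$ with $\alpha,\beta,\gamma\in\mathbb F_4$, and let $S=UT_3(4){:}\langle g,A\rangle$ be the split extension by the automorphisms $g\colon(\alpha,\beta,\gamma)\mapsto(\alpha^2,\beta^2,\gamma^2)$ and $A\colon(\alpha,\beta,\gamma)\mapsto(\gamma,\beta+\alpha\gamma,\alpha)$. Put $2^4=\{(\alpha,\beta,0):\alpha,\beta\in\mathbb F_4\}$, $T=(0,\zeta_3,0)$ and $Z=(0,1,0)$, where $\zeta_3\in\mathbb F_4$ is a primitive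 cube root of unity, and let $2^3=\langle A,T,Z\rangle\subset S$. For subgroups $K\le H\le G$, $K$ is called *weakly closed in $H\subset G$* if every subgroup of $H$ that is conjugate to $K$ in $G$ is conjugate to $K$ in $H$. The Weyl group of a subgroup $V\le G$ is $N_G(V)/V$. A maximal elementary abelian 2-subgroup is an elementary abelian 2-subgroup that is maximal with respect to inclusion. The group $S$ is isomorphic to a Sylow 2-subgroup of $2S_8$, of $2A_{10}$ and of $Ly$. Identify $S$ with a Sylow 2-subgroup of $2S_8$ by any isomorphism; it is then also a Sylow 2-subgroup of $2A_{10}$, and the following hold. 1. The subgroups $2^4$ and $2^3=\langle A,T,Z\rangle$ have orders $16$ and $8$. In each of the groups $2S_8$ and $2A_{10}$ there are exactly two conjugacy classes of maximal elementary abelian 2-subgroups, represented by $2^4$ and by $2^3=\langle A,T,Z\rangle$. 2. $2^4$ is weakly closed in $S\subset 2S_8$, and $\langle A,T,Z\rangle$ is weakly closed in $2S_8\subset 2A_{10}$. 3. In both $2S_8$ and $2A_{10}$ the subgroup $\langle A,T,Z\rangle$ is equal to its own centralizer (so its Weyl group $N(V)/V$ is also $N(V)/C(V)$); its Weyl group is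 isomorphic to $D_8$ (the dihedral group of order $8$) in $2S_8$ and to $S_4$ in $2A_{10}$. Moreover, for any identification of $S$ with a Sylow 2-subgroup of $Ly$, every maximal elementary abelian 2-subgroup of $Ly$ is conjugate in $Ly$ to $2^4$ or to $\langle A,T,Z\rangle$; in particular $Ly$ has at most two conjugacy classes of such subgroups. -/

import Mathlib

noncomputable section

/-! ### Elementary abelian 2-subgroups, conjugacy, weak closure, Weyl groups -/

section General

variable {G : Type*} [Group G]

/-- An elementary abelian 2-subgroup: a commutative subgroup in which every element squares
to the identity. -/
def IsElemAbTwo (E : Subgroup G) : Prop :=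
  (∀ x ∈ E, ∀ y ∈ E, x * y = y * x) ∧ ∀ x ∈ E, x ^ 2 = 1

/-- A maximal elementary abelian 2-subgroup: maximal with respect to inclusion among all
elementary abelian 2-subgroups of `G`. -/
def IsMaxElemAbTwo (E : Subgroup G) : Prop :=
  Maximal IsElemAbTwo E

/-- The conjugate `g K g⁻¹` of a subgroup. -/
def conjSubgroup (g : G) (K : Subgroup G) : Subgroup G :=
  K.map (MulAut.conj g).toMonoidHom

/-- Two subgroups are conjugate in `G`. -/
def AreConj (K L : Subgroup G) : Prop :=
  ∃ g : G, conjSubgroup g K = L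

/-- `K` is weakly closed in `H ⊆ G`: `K ≤ H`, and every subgroup of `H` which is conjugate to `K`
in `G` is already conjugate to `K` by an element of `H`. -/
def IsWeaklyClosed (K H : Subgroup G) : Prop :=
  K ≤ H ∧ ∀ L : Subgroup G, L ≤ H → AreConj K L → ∃ h ∈ H, conjSubgroup h K = L

/-- The Weyl group `N_G(V) / V` of a subgroup `V` of `G`. -/
abbrev WeylGroup (V : Subgroup G) : Type _ :=
  Subgroup.normalizer (V : Set G) ⧸ V.subgroupOf (Subgroup.normalizer (V : Set G))

/-- A homomorphism identifying `S` with a Sylow 2-subgroup of `G`: it is injective and its image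
is a Sylow 2-subgroup. -/
def IsSylowTwoEmbedding {S : Type*} [Group S] (f : S →* G) : Prop :=
  Function.Injective f ∧ ∃ P : Sylow 2 G, (P : Subgroup G) = f.range

end General

/-! ### The double covers `2A_n` and `2S_8` -/

/-- The standard positive definite form `∑ x_i ^ 2` on `ℝ^n`. -/
def euclForm (n : ℕ) : QuadraticForm ℝ (Fin n → ℝ) :=
  QuadraticMap.weightedSumSquares ℝ (fun _ : Fin n => (1 : ℝ))

/-- The group `Spin(n)`. -/
abbrev Spin (n : ℕ) : Type := spinGroup (euclForm n)

/-- The image in the Clifford algebra of the `i`-th standard basis vector of `ℝ^n`. -/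
def cliffE {n : ℕ} (i : Fin n) : CliffordAlgebra (euclForm n) :=
  CliffordAlgebra.ι (euclForm n) (Pi.single i 1)

/-- The element `x` of `Spin(n)` lies over the permutation `σ`: the rotation `v ↦ x v x⁻¹` of
`ℝ^n` is the permutation matrix `e_i ↦ e_{σ i}`. -/
def LiesOver {n : ℕ} (x : Spin n) (σ : Equiv.Perm (Fin n)) : Prop :=
  ∀ i : Fin n, (x : CliffordAlgebra (euclForm n)) * cliffE i = cliffE (σ i) * x

theorem LiesOver.one {n : ℕ} : LiesOver (1 : Spin n) 1 := by
  intro i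
  simp

theorem LiesOver.mul {n : ℕ} {x y : Spin n} {σ τ : Equiv.Perm (Fin n)}
    (hx : LiesOver x σ) (hy : LiesOver y τ) : LiesOver (x * y) (σ * τ) := by
  intro i
  have h1 := hy i
  have h2 := hx (τ i)
  simp only [Submonoid.coe_mul, Equiv.Perm.coe_mul, Function.comp_apply]
  rw [mul_assoc, h1, ← mul_assoc, h2, mul_assoc]

theorem LiesOver.inv {n : ℕ} {x : Spin n} {σ : Equiv.Perm (Fin n)}
    (hx : LiesOver x σ) : LiesOver x⁻¹ σ⁻¹ := by
  intro i
  have h := hx (σ⁻¹ i)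
  rw [show σ (σ⁻¹ i) = i from σ.apply_symm_apply i] at h
  have h1 : ((x⁻¹ : Spin n) : CliffordAlgebra (euclForm n)) * x = 1 := by
    rw [← Submonoid.coe_mul, inv_mul_cancel, Submonoid.coe_one]
  have h2 : (x : CliffordAlgebra (euclForm n)) * ((x⁻¹ : Spin n) : CliffordAlgebra (euclForm n))
      = 1 := by
    rw [← Submonoid.coe_mul, mul_inv_cancel, Submonoid.coe_one]
  calc ((x⁻¹ : Spin n) : CliffordAlgebra (euclForm n)) * cliffE i
      = (x⁻¹ : Spin n) * (cliffE i * x) * (x⁻¹ : Spin n) := by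
        rw [mul_assoc, mul_assoc, h2, mul_one]
    _ = cliffE (σ⁻¹ i) * (x⁻¹ : Spin n) := by
        rw [← h, ← mul_assoc, h1, one_mul]

/-- For a group `Γ` of permutations of the `n` coordinates, the group of all elements of `Spin(n)`
lying over an element of `Γ`. -/
def spinPreimage {n : ℕ} (Γ : Subgroup (Equiv.Perm (Fin n))) : Subgroup (Spin n) where
  carrier := {x | ∃ σ ∈ Γ, LiesOver x σ}
  mul_mem' := by
    rintro x y ⟨σ, hσ, hx⟩ ⟨τ, hτ, hy⟩
    exact ⟨σ * τ, Γ.mul_mem hσ hτ, hx.mul hy⟩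
  one_mem' := ⟨1, Γ.one_mem, LiesOver.one⟩
  inv_mem' := by
    rintro x ⟨σ, hσ, hx⟩
    exact ⟨σ⁻¹, Γ.inv_mem hσ, hx.inv⟩

/-- The double cover `2A_n` of the alternating group: the preimage of `A_n ⊆ SO(n)`
(permutation matrices) under the two-fold covering `Spin(n) → SO(n)`. For `n = 8, 10, 11` this is
the unique nonsplit extension of `A_n` by a group of order two. -/
abbrev TwoAlt (n : ℕ) : Type := spinPreimage (alternatingGroup (Fin n))

/-- The copy of `S_8` in `A_10` generated by `(1,2)(9,10), (2,3)(9,10), …, (7,8)(9,10)`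
(with the ten letters numbered `0, …, 9` here). -/
def symEight : Subgroup (Equiv.Perm (Fin 10)) :=
  Subgroup.closure
    {σ | ∃ i : Fin 10, i.val < 7 ∧ σ = Equiv.swap i (i + 1) * Equiv.swap 8 9}

/-- The double cover `2S_8`, as the preimage in `2A_10` of `S_8 ⊆ A_10`. -/
def twoSymEight : Subgroup (TwoAlt 10) :=
  (spinPreimage symEight).subgroupOf (spinPreimage (alternatingGroup (Fin 10)))

/-! ### The Lyons group -/

/-- `G` is (isomorphic to) the Lyons sporadic group `Ly`: the finite simple group having an
involution whose centralizer is isomorphic to the double cover `2A_11`. By theorems of Lyons and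
Sims such a group exists and is unique up to isomorphism. -/
structure IsLyonsGroup (G : Type*) [Group G] : Prop where
  finite : Finite G
  simple : IsSimpleGroup G
  exists_involution : ∃ z : G, orderOf z = 2 ∧
    Nonempty (Subgroup.centralizer ({z} : Set G) ≃* TwoAlt 11)

/-! ### The group `UT_3(4) : ⟨g, A⟩` of order 256 -/

/-- The field with four elements. -/
abbrev F4 : Type := GaloisField 2 2

/-- `UT_3(F)`: the upper unitriangular matrix with rows `(1, α, β)`, `(0, 1, γ)`, `(0, 0, 1)`. -/
@[ext]
structure UT3 (F : Type*) where
  α : F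
  β : F
  γ : F

namespace UT3

variable {F : Type*} [Field F]

/-- The matrix itself. -/
def toMatrix (m : UT3 F) : Matrix (Fin 3) (Fin 3) F :=
  !![1, m.α, m.β; 0, 1, m.γ; 0, 0, 1]

instance : Mul (UT3 F) := ⟨fun m n => ⟨m.α + n.α, m.β + n.β + m.α * n.γ, m.γ + n.γ⟩⟩
instance : One (UT3 F) := ⟨⟨0, 0, 0⟩⟩
instance : Inv (UT3 F) := ⟨fun m => ⟨-m.α, m.α * m.γ - m.β, -m.γ⟩⟩

@[simp] theorem mul_α (m n : UT3 F) : (m * n).α = m.α + n.α := rfl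
@[simp] theorem mul_β (m n : UT3 F) : (m * n).β = m.β + n.β + m.α * n.γ := rfl
@[simp] theorem mul_γ (m n : UT3 F) : (m * n).γ = m.γ + n.γ := rfl
@[simp] theorem one_α : (1 : UT3 F).α = 0 := rfl
@[simp] theorem one_β : (1 : UT3 F).β = 0 := rfl
@[simp] theorem one_γ : (1 : UT3 F).γ = 0 := rfl
@[simp] theorem inv_α (m : UT3 F) : (m⁻¹).α = -m.α := rfl
@[simp] theorem inv_β (m : UT3 F) : (m⁻¹).β = m.α * m.γ - m.β := rfl
@[simp] theorem inv_γ (m : UT3 F) : (m⁻¹).γ = -m.γ := rfl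

instance : Group (UT3 F) :=
  Group.ofLeftAxioms
    (by intro a b c; ext <;> simp <;> ring)
    (by intro a; ext <;> simp)
    (by intro a; ext <;> simp)

/-- The group law of `UT3 F` is matrix multiplication. -/
theorem toMatrix_mul (m n : UT3 F) : (m * n).toMatrix = m.toMatrix * n.toMatrix := by
  ext i j
  fin_cases i <;> fin_cases j <;>
    simp [toMatrix, Matrix.mul_apply, Fin.sum_univ_three, add_comm, add_assoc]

/-- Galois conjugation `g` on `UT_3(4)`: every entry is squared. -/
def galois : MulAut (UT3 F4) where
  toFun m := ⟨m.α ^ 2, m.β ^ 2, m.γ ^ 2⟩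
  invFun m := ⟨m.α ^ 2, m.β ^ 2, m.γ ^ 2⟩
  left_inv m := by
    have h : ∀ x : F4, (x ^ 2) ^ 2 = x := fun x => by
      let _ : Fintype F4 := Fintype.ofFinite _
      have hc : Fintype.card F4 = 4 := by
        rw [← Nat.card_eq_fintype_card, GaloisField.card 2 2 (by norm_num)]; norm_num
      rw [← pow_mul]
      simpa [hc] using FiniteField.pow_card x
    ext <;> simp [h]
  right_inv m := by
    have h : ∀ x : F4, (x ^ 2) ^ 2 = x := fun x => by
      let _ : Fintype F4 := Fintype.ofFinite _
      have hc : Fintype.card F4 = 4 := by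
        rw [← Nat.card_eq_fintype_card, GaloisField.card 2 2 (by norm_num)]; norm_num
      rw [← pow_mul]
      simpa [hc] using FiniteField.pow_card x
    ext <;> simp [h]
  map_mul' m n := by
    ext <;> simp [CharTwo.add_sq, mul_pow]

/-- The automorphism `A` of `UT_3(4)`: `(α, β, γ) ↦ (γ, β + α γ, α)`. -/
def polarity : MulAut (UT3 F4) where
  toFun m := ⟨m.γ, m.β + m.α * m.γ, m.α⟩
  invFun m := ⟨m.γ, m.β + m.α * m.γ, m.α⟩
  left_inv m := by
    ext
    · rfl
    · change m.β + m.α * m.γ + m.γ * m.α = m.β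
      rw [mul_comm m.γ, add_assoc, CharTwo.add_self_eq_zero, add_zero]
    · rfl
  right_inv m := by
    ext
    · rfl
    · change m.β + m.α * m.γ + m.γ * m.α = m.β
      rw [mul_comm m.γ, add_assoc, CharTwo.add_self_eq_zero, add_zero]
    · rfl
  map_mul' m n := by
    ext
    · rfl
    · change m.β + n.β + m.α * n.γ + (m.α + n.α) * (m.γ + n.γ)
        = (m.β + m.α * m.γ) + (n.β + n.α * n.γ) + m.γ * n.α
      have h := CharTwo.add_self_eq_zero (m.α * n.γ)
      linear_combination h
    · rfl

end UT3

/-- The group `⟨g, A⟩` of automorphisms of `UT_3(4)` (a Klein four-group). -/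
def outerFour : Subgroup (MulAut (UT3 F4)) :=
  Subgroup.closure {UT3.galois, UT3.polarity}

/-- The split extension `UT_3(4) : ⟨g, A⟩`, of order 256. -/
abbrev SylLy : Type := UT3 F4 ⋊[outerFour.subtype] outerFour

namespace SylLy

/-- The element `A`. -/
def elemA : SylLy :=
  SemidirectProduct.inr ⟨UT3.polarity, Subgroup.subset_closure (by simp)⟩

/-- The element `T`, with upper right entry `ζ`, a primitive cube root of unity. -/
def elemT (ζ : F4) : SylLy := SemidirectProduct.inl ⟨0, ζ, 0⟩

/-- The element `Z`, with upper right entry `1`. -/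
def elemZ : SylLy := SemidirectProduct.inl ⟨0, 1, 0⟩

/-- The subgroup `2^4_I` of all `(α, β, 0)` in `UT_3(4)`. -/
def fourI : Subgroup SylLy :=
  Subgroup.closure {x | ∃ α β : F4, x = SemidirectProduct.inl ⟨α, β, 0⟩}

/-- The subgroup `⟨A, T, Z⟩`. -/
def threeATZ (ζ : F4) : Subgroup SylLy :=
  Subgroup.closure {elemA, elemT ζ, elemZ}

end SylLy

/-- The conjugacy classes of maximal elementary abelian 2-subgroups of `G` are exactly two, and
they are represented by `E` and `V`. -/
def TwoClassesOfMaxElemAbTwo {G : Type*} [Group G] (E V : Subgroup G) : Prop :=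
  IsMaxElemAbTwo E ∧ IsMaxElemAbTwo V ∧ ¬ AreConj E V ∧
    ∀ M : Subgroup G, IsMaxElemAbTwo M → AreConj E M ∨ AreConj V M

end

/-! Write S for the split extension of order 256, X for (1, 0, 0) and V for `⟨A, T, Z⟩`. The proof
separates a finite computation inside S from a small amount of fusion outside it.

Inside S: every involution in the cosets of A, g, gA modulo UT_3(4) is conjugate to A, g, gA itself,
and an involution (α, β, γ) of UT_3(4) has αγ = 0. Hence each elementary abelian 2-subgroup is
conjugate in S into 2^4, V, ⟨A, g, Z⟩ or ⟨X, g, Z⟩ (`exists_conj_le`). Only the first has order 16,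
which gives the weak closure of 2^4. Two identifications of S with a Sylow subgroup differ by a
conjugation and an automorphism of S, so the classes of 2^4 and V must be stable under
automorphisms: 2^4 by its order, V because it contains the normal core ⟨T, Z⟩ of 2^4, which the
other two groups of order 8 do not (`areConj_map_threeATZ`).

Outside S: S is realized in Spin(10) by words in the unit vectors (e_i - e_j)/√2, compared through a
signed normal form. An element of 2S_8 over (1 3)(8 9) takes g to T modulo Z while fixing A and X
modulo Z, so it fuses ⟨A, g, Z⟩ with V and moves ⟨X, g, Z⟩ into 2^4. Two candidate classes remain in
every finite group receiving 2S_8 so that S becomes a Sylow subgroup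
(`areConj_or_of_isMaxElemAbTwo`). In 2S_8 and 2A_10 the group V is its own centralizer, hence
maximal. The Lyons group contains 2S_8 through 2A_10 ⊂ 2A_11 = C(z); S is Sylow there since it is
Sylow in C(z) and its centre is ⟨z⟩.

Weyl groups: N(V)/V acts faithfully on V and fixes Z, so it embeds in the stabilizer of a nonzero
vector in GL_3(2), which is S_4 acting on the four characters of V nontrivial on Z. The normalizer
in S already contributes a factor 8. In 2A_10 an element over a product of three 3-cycles permutes
A, T, AT modulo Z, whereas in 2S_8 the invariance of {8, 9} excludes order 3. -/

noncomputable section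

/-! ### Central even elements of the Clifford algebra -/

section CliffordCenter

open CliffordAlgebra

variable {n : ℕ}

theorem polar_euclForm_single (i j : Fin n) :
    QuadraticMap.polar (euclForm n) (Pi.single i 1) (Pi.single j 1) = if i = j then 2 else 0 := by
  have key : ∀ v : Fin n → ℝ, euclForm n v = ∑ k, v k * v k := by
    intro v; simp [euclForm, QuadraticMap.weightedSumSquares_apply]
  rw [QuadraticMap.polar, key, key, key, ← Finset.sum_sub_distrib, ← Finset.sum_sub_distrib]
  have : ∀ k : Fin n, ((Pi.single i 1 + Pi.single j 1 : Fin n → ℝ) k *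
      (Pi.single i 1 + Pi.single j 1 : Fin n → ℝ) k -
      (Pi.single i 1 : Fin n → ℝ) k * (Pi.single i 1 : Fin n → ℝ) k) -
      (Pi.single j 1 : Fin n → ℝ) k * (Pi.single j 1 : Fin n → ℝ) k =
      if k = i then (if i = j then 2 else 0) else 0 := by
    intro k
    by_cases hki : k = i
    · subst hki
      by_cases hkj : k = j
      · subst hkj; simp; norm_num
      · simp [hkj]
    · by_cases hkj : k = j
      · subst hkj; simp [hki]
      · simp [hki, hkj]
  rw [Finset.sum_congr rfl (fun k _ => this k)]
  simp

theorem euclForm_single (i : Fin n) : euclForm n (Pi.single i 1) = 1 := by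
  have h := polar_euclForm_single i i
  rw [QuadraticMap.polar_self] at h
  simpa using h

theorem cliffE_sq (i : Fin n) : (cliffE i : CliffordAlgebra (euclForm n)) * cliffE i = 1 := by
  rw [cliffE, ι_sq_scalar, euclForm_single, map_one]

theorem cliffE_anticomm {i j : Fin n} (h : i ≠ j) :
    (cliffE i : CliffordAlgebra (euclForm n)) * cliffE j = -(cliffE j * cliffE i) := by
  rw [eq_neg_iff_add_eq_zero, cliffE, cliffE, ι_mul_ι_add_swap, polar_euclForm_single, if_neg h,
    map_zero]

theorem ι_eq_sum_cliffE (v : Fin n → ℝ) :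
    ι (euclForm n) v = ∑ i, v i • cliffE i := by
  conv_lhs => rw [pi_eq_sum_univ' v]
  rw [map_sum]
  refine Finset.sum_congr rfl fun i _ => ?_
  rw [map_smul, cliffE]

/-- The product of the basis vectors with indices in a list. -/
def cliffMonomial (l : List (Fin n)) : CliffordAlgebra (euclForm n) := (l.map cliffE).prod

theorem cliffMonomial_cons (i : Fin n) (l : List (Fin n)) :
    cliffMonomial (i :: l) = cliffE i * cliffMonomial l := by simp [cliffMonomial]

theorem cliffMonomial_append (l l' : List (Fin n)) :
    cliffMonomial (l ++ l') = cliffMonomial l * cliffMonomial l' := by simp [cliffMonomial]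

/-- A sign arises from each letter different from `i`; their number is length minus count, which has
the parity of length plus count. -/
theorem cliffE_mul_cliffMonomial (i : Fin n) (l : List (Fin n)) :
    cliffE i * cliffMonomial l = (-1) ^ (l.length + l.count i) * (cliffMonomial l * cliffE i) := by
  induction l with
  | nil => simp [cliffMonomial]
  | cons j l ih =>
    have hc : ∀ k, (-1 : CliffordAlgebra (euclForm n)) ^ k * cliffE j = cliffE j * (-1) ^ k :=
      fun k => ((Commute.neg_one_left (cliffE j)).pow_left k).eq
    rw [cliffMonomial_cons]
    by_cases h : j = i
    · subst h
      rw [List.count_cons_self, List.length_cons,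
        show l.length + 1 + (l.count j + 1) = (l.length + l.count j) + 2 by ring, pow_add,
        neg_one_sq, mul_one, mul_assoc (cliffE j) _ (cliffE j), ← mul_assoc ((-1) ^ _) (cliffE j), hc,
        mul_assoc, ← ih]
    · rw [List.count_cons_of_ne h, List.length_cons, ← mul_assoc, cliffE_anticomm (Ne.symm h),
        neg_mul, mul_assoc, ih, add_right_comm, pow_succ, mul_neg_one, neg_mul, mul_assoc (cliffE j),
        ← mul_assoc _ (cliffE j), hc, mul_assoc]

theorem cliffE_mul_cliffMonomial_mul_cliffE (i : Fin n) (l : List (Fin n)) :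
    cliffE i * cliffMonomial l * cliffE i = (-1) ^ (l.length + l.count i) * cliffMonomial l := by
  rw [cliffE_mul_cliffMonomial, mul_assoc, mul_assoc, cliffE_sq, mul_one]

/-- The first letter occurs again; moving it there costs a sign and the two copies square to 1, so
induction on the length applies. -/
theorem cliffMonomial_scalar (l : List (Fin n)) (h : ∀ i, Even (l.count i)) :
    ∃ r : ℝ, cliffMonomial l = algebraMap ℝ _ r := by
  induction hk : l.length using Nat.strong_induction_on generalizing l with
  | _ k ih =>
    cases l with
    | nil => exact ⟨1, by simp [cliffMonomial]⟩
    | cons i l =>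
      have hi : i ∈ l := by
        have := h i
        rw [List.count_cons_self] at this
        by_contra hn
        rw [List.count_eq_zero_of_not_mem hn] at this
        simp at this
      obtain ⟨l₁, l₂, rfl⟩ := List.append_of_mem hi
      obtain ⟨r, hr⟩ := ih (l₁ ++ l₂).length (by simp at hk ⊢; omega) (l₁ ++ l₂) (by
        intro j
        have := h j
        simp only [List.count_cons, List.count_append] at this ⊢
        split_ifs at this
        · rw [show l₁.count j + (l₂.count j + 1) + 1 = l₁.count j + l₂.count j + 2 by ring] at this
          simpa [Nat.even_add] using this
        · simpa using this) rfl
      refine ⟨(-1) ^ (l₁.length + l₁.count i) * r, ?_⟩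
      rw [cliffMonomial_cons, cliffMonomial_append, cliffMonomial_cons, ← mul_assoc, ← mul_assoc,
        cliffE_mul_cliffMonomial_mul_cliffE, mul_assoc, ← cliffMonomial_append, hr]
      simp

/-- The projection to the part of the Clifford algebra commuting with a basis vector. -/
def cliffAverage (i : Fin n) : CliffordAlgebra (euclForm n) →ₗ[ℝ] CliffordAlgebra (euclForm n) :=
  (2⁻¹ : ℝ) • (LinearMap.id + LinearMap.mulLeftRight ℝ (cliffE i, cliffE i))

theorem cliffAverage_apply (i : Fin n) (x : CliffordAlgebra (euclForm n)) :
    cliffAverage i x = (2⁻¹ : ℝ) • (x + cliffE i * x * cliffE i) := by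
  simp [cliffAverage, LinearMap.mulLeftRight_apply]

theorem cliffAverage_of_commute {i : Fin n} {x : CliffordAlgebra (euclForm n)}
    (h : x * cliffE i = cliffE i * x) : cliffAverage i x = x := by
  rw [cliffAverage_apply, ← h, mul_assoc, cliffE_sq, mul_one, ← two_smul ℝ, smul_smul]
  norm_num

/-- A monomial of even length commutes or anticommutes with `cliffE i` according to the parity of
the count of `i`, so averaging keeps it or kills it. -/
theorem cliffAverage_monomial (i : Fin n) (l : List (Fin n)) (hl : Even l.length) :
    cliffAverage i (cliffMonomial l) = if Even (l.count i) then cliffMonomial l else 0 := by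
  rw [cliffAverage_apply, cliffE_mul_cliffMonomial_mul_cliffE]
  split_ifs with h
  · rw [(hl.add h).neg_one_pow, one_mul, ← two_smul ℝ, smul_smul]
    norm_num
  · rw [(hl.add_odd (Nat.not_even_iff_odd.1 h)).neg_one_pow]
    simp

/-- The composite of the projections `cliffAverage i` over a list of indices. -/
def cliffAverages (s : List (Fin n)) :
    CliffordAlgebra (euclForm n) →ₗ[ℝ] CliffordAlgebra (euclForm n) :=
  s.foldr (fun i T => cliffAverage i ∘ₗ T) LinearMap.id

theorem cliffAverages_of_commute (s : List (Fin n)) {x : CliffordAlgebra (euclForm n)}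
    (h : ∀ i, x * cliffE i = cliffE i * x) : cliffAverages s x = x := by
  induction s with
  | nil => rfl
  | cons i s ih =>
    change cliffAverage i (cliffAverages s x) = x
    rw [ih, cliffAverage_of_commute (h i)]

theorem cliffAverages_monomial (s : List (Fin n)) (l : List (Fin n)) (hl : Even l.length) :
    cliffAverages s (cliffMonomial l) =
      if ∀ i ∈ s, Even (l.count i) then cliffMonomial l else 0 := by
  induction s with
  | nil => simp [cliffAverages]
  | cons i s ih =>
    change cliffAverage i (cliffAverages s _) = _
    rw [ih]
    by_cases h : ∀ j ∈ s, Even (l.count j)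
    · rw [if_pos h, cliffAverage_monomial i l hl]
      exact if_congr ⟨fun hi => List.forall_mem_cons.2 ⟨hi, h⟩,
        fun hi => hi i List.mem_cons_self⟩ rfl rfl
    · rw [if_neg h, map_zero, if_neg]
      exact fun h' => h fun j hj => h' j (List.mem_cons_of_mem _ hj)

theorem mem_span_cliffMonomial {x : CliffordAlgebra (euclForm n)} (hx : x ∈ even (euclForm n)) :
    x ∈ Submodule.span ℝ (cliffMonomial '' {l : List (Fin n) | Even l.length}) := by
  induction x, hx using even_induction with
  | algebraMap r =>
    rw [Algebra.algebraMap_eq_smul_one]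
    exact Submodule.smul_mem _ _ (Submodule.subset_span ⟨[], by simp, by simp [cliffMonomial]⟩)
  | add x y _ _ hx hy => exact Submodule.add_mem _ hx hy
  | ι_mul_ι_mul v w x _ hx =>
    rw [ι_eq_sum_cliffE v, ι_eq_sum_cliffE w, Finset.sum_mul_sum, Finset.sum_mul]
    refine Submodule.sum_mem _ fun i _ => ?_
    rw [Finset.sum_mul]
    refine Submodule.sum_mem _ fun j _ => ?_
    rw [smul_mul_smul_comm, smul_mul_assoc]
    refine Submodule.smul_mem _ _ ?_
    clear * - hx
    induction hx using Submodule.span_induction with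
    | mem y hy =>
      obtain ⟨l, hl, rfl⟩ := hy
      refine Submodule.subset_span ⟨i :: j :: l, ?_, ?_⟩
      · simpa [Nat.even_add_one] using hl
      · rw [cliffMonomial_cons, cliffMonomial_cons, mul_assoc]
    | zero => simp
    | add y z _ _ hy hz => rw [mul_add]; exact Submodule.add_mem _ hy hz
    | smul r y _ hy => rw [mul_smul_comm]; exact Submodule.smul_mem _ _ hy

/-- An even element commuting with all vectors is a scalar. -/
theorem even_central_scalar {x : CliffordAlgebra (euclForm n)} (hx : x ∈ even (euclForm n))
    (h : ∀ i, x * cliffE i = cliffE i * x) : ∃ r : ℝ, x = algebraMap ℝ _ r := by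
  -- The composite of all averages fixes the given central element, while on even monomials only
  -- those with every count even survive, and these are scalars. Evenness matters: for odd `n` the
  -- product of all basis vectors is central.
  have key : ∀ y ∈ Submodule.span ℝ (cliffMonomial '' {l : List (Fin n) | Even l.length}),
      ∃ r : ℝ, cliffAverages (List.finRange n) y = algebraMap ℝ _ r := by
    intro y hy
    induction hy using Submodule.span_induction with
    | mem y hy =>
      obtain ⟨l, hl, rfl⟩ := hy
      rw [cliffAverages_monomial _ _ hl]
      split_ifs with hc
      · exact cliffMonomial_scalar l fun i => hc i (List.mem_finRange i)
      · exact ⟨0, by simp⟩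
    | zero => exact ⟨0, by simp⟩
    | add y z _ _ hy hz =>
      obtain ⟨r, hr⟩ := hy
      obtain ⟨s, hs⟩ := hz
      exact ⟨r + s, by rw [map_add, hr, hs, map_add]⟩
    | smul c y _ hy =>
      obtain ⟨r, hr⟩ := hy
      exact ⟨c * r, by rw [map_smul, hr, map_mul, Algebra.smul_def]⟩
  obtain ⟨r, hr⟩ := key x (mem_span_cliffMonomial hx)
  exact ⟨r, by rw [← hr, cliffAverages_of_commute _ h]⟩

end CliffordCenter

/-! ### The kernel of `Spin(n) → SO(n)` on elements lying over permutations -/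

section SpinKernel

open CliffordAlgebra

variable {n : ℕ}

instance : Nontrivial (CliffordAlgebra (euclForm n)) :=
  letI : Invertible (2 : ℝ) := invertibleOfNonzero two_ne_zero
  inferInstance

theorem cliff_one_ne_neg_one : (1 : CliffordAlgebra (euclForm n)) ≠ -1 := by
  intro h
  have h2 : (algebraMap ℝ (CliffordAlgebra (euclForm n))) 1 = algebraMap ℝ _ (-1) := by
    rw [map_neg, map_one]; exact h
  have := (algebraMap ℝ (CliffordAlgebra (euclForm n))).injective h2
  norm_num at this

theorem cliffE_injective : Function.Injective (cliffE : Fin n → CliffordAlgebra (euclForm n)) := by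
  intro i j h
  by_contra hij
  have h1 := cliffE_anticomm hij
  rw [h, cliffE_sq] at h1
  exact cliff_one_ne_neg_one h1

/-- Vectors of norm one are their own inverses; `star` negates vectors, and the two signs cancel in
a product of two. -/
theorem ι_mul_ι_mem_spinGroup {v w : Fin n → ℝ} (hv : euclForm n v = 1) (hw : euclForm n w = 1) :
    ι (euclForm n) v * ι (euclForm n) w ∈ spinGroup (euclForm n) := by
  have sq : ∀ u, euclForm n u = 1 → ι (euclForm n) u * ι (euclForm n) u = 1 := by
    intro u hu; rw [ι_sq_scalar, hu, map_one]
  refine ⟨⟨⟨⟨ι _ v, ι _ v, sq v hv, sq v hv⟩ * ⟨ι _ w, ι _ w, sq w hw, sq w hw⟩, ?_, rfl⟩, ?_⟩, ?_⟩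
  · exact Subgroup.mul_mem _ (Subgroup.subset_closure ⟨v, rfl⟩) (Subgroup.subset_closure ⟨w, rfl⟩)
  · have hs : star (ι (euclForm n) v * ι (euclForm n) w) = ι (euclForm n) w * ι (euclForm n) v := by
      rw [star_mul, star_ι, star_ι, neg_mul_neg]
    refine Unitary.mem_iff.2 ⟨?_, ?_⟩ <;> rw [hs]
    · rw [mul_assoc, ← mul_assoc (ι _ v), sq v hv, one_mul, sq w hw]
    · rw [mul_assoc, ← mul_assoc (ι _ w), sq w hw, one_mul, sq v hv]
  · exact ι_mul_ι_mem_evenOdd_zero _ v w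

/-- The element `-1` of `Spin(n)`. -/
def spinNegOne (n : ℕ) [NeZero n] : Spin n :=
  ⟨-1, by
    have h : (-1 : CliffordAlgebra (euclForm n)) =
        ι (euclForm n) (Pi.single 0 1) * ι (euclForm n) (-Pi.single 0 1) := by
      rw [map_neg, mul_neg, ι_sq_scalar, euclForm_single, map_one]
    rw [h]
    exact ι_mul_ι_mem_spinGroup (euclForm_single 0) (by rw [QuadraticMap.map_neg, euclForm_single])⟩

@[simp] theorem coe_spinNegOne [NeZero n] :
    (spinNegOne n : CliffordAlgebra (euclForm n)) = -1 := rfl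

theorem spinNegOne_ne_one [NeZero n] : spinNegOne n ≠ 1 := by
  intro h
  exact cliff_one_ne_neg_one (congrArg Subtype.val h).symm

theorem liesOver_spinNegOne [NeZero n] : LiesOver (spinNegOne n) 1 := by
  intro i
  simp

theorem LiesOver.unique {x : Spin n} {σ τ : Equiv.Perm (Fin n)} (h : LiesOver x σ)
    (h' : LiesOver x τ) : σ = τ := by
  ext i
  have h1 : cliffE (σ i) * (x : CliffordAlgebra (euclForm n)) = cliffE (τ i) * x := by
    rw [← h i, ← h' i]
  have h2 : (x : CliffordAlgebra (euclForm n)) * ((x⁻¹ : Spin n) : CliffordAlgebra (euclForm n))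
      = 1 := by
    rw [← Submonoid.coe_mul, mul_inv_cancel, Submonoid.coe_one]
  have h3 := congrArg (· * ((x⁻¹ : Spin n) : CliffordAlgebra (euclForm n))) h1
  simp only [mul_assoc, h2, mul_one] at h3
  rw [cliffE_injective h3]

/-- Such an element is even and commutes with all vectors, so it is a real scalar `r`; unitarity
gives `r * r = 1`. -/
theorem LiesOver.eq_one_or [NeZero n] {x : Spin n} (h : LiesOver x 1) :
    x = 1 ∨ x = spinNegOne n := by
  obtain ⟨r, hr⟩ := even_central_scalar x.2.2 h
  have h1 := x.2.1.2.1
  rw [hr, star_algebraMap, ← map_mul, ← map_one (algebraMap ℝ _)] at h1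
  have h2 := (algebraMap ℝ (CliffordAlgebra (euclForm n))).injective h1
  rcases mul_self_eq_one_iff.1 h2 with h3 | h3
  · left; exact Subtype.ext (by rw [hr, h3, map_one]; rfl)
  · right; exact Subtype.ext (by rw [hr, h3, map_neg, map_one]; rfl)

/-! ### Words in the reflections in the roots `e_i - e_j` -/

/-- The unit vector `(e_i - e_j) / √2` of the Clifford algebra. -/
def letterVal (x : Fin n × Fin n) : CliffordAlgebra (euclForm n) :=
  (√2)⁻¹ • (cliffE x.1 - cliffE x.2)

theorem inv_sqrt_two_mul_self : (√2)⁻¹ * (√2)⁻¹ = (2⁻¹ : ℝ) := by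
  rw [← mul_inv, Real.mul_self_sqrt zero_le_two]

theorem letterVal_eq_ι {x : Fin n × Fin n} (h : x.1 ≠ x.2) :
    ∃ v, letterVal x = ι (euclForm n) v ∧ euclForm n v = 1 := by
  refine ⟨(√2)⁻¹ • (Pi.single x.1 1 - Pi.single x.2 1), ?_, ?_⟩
  · rw [map_smul, map_sub]; rfl
  · have hp := polar_euclForm_single x.1 x.2
    rw [if_neg h] at hp
    have h2 : euclForm n (Pi.single x.1 1 - Pi.single x.2 1) = 2 := by
      have h3 := QuadraticMap.polar_neg_right (euclForm n) (Pi.single x.1 1) (Pi.single x.2 1)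
      rw [hp, QuadraticMap.polar, ← sub_eq_add_neg, QuadraticMap.map_neg, euclForm_single,
        euclForm_single] at h3
      linarith
    rw [QuadraticMap.map_smul, h2, inv_sqrt_two_mul_self]
    norm_num

theorem letterVal_sq {x : Fin n × Fin n} (h : x.1 ≠ x.2) : letterVal x * letterVal x = 1 := by
  obtain ⟨v, hv, h1⟩ := letterVal_eq_ι h
  rw [hv, ι_sq_scalar, h1, map_one]

theorem letterVal_swap (i j : Fin n) : letterVal (j, i) = -letterVal (i, j) := by
  simp only [letterVal, ← smul_neg, neg_sub]

/-- Conjugation by a unit vector is minus the reflection in it. Because of this sign only words of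
even length lie over their permutation. -/
theorem letterVal_mul_cliffE {x : Fin n × Fin n} (h : x.1 ≠ x.2) (k : Fin n) :
    letterVal x * cliffE k = -(cliffE (Equiv.swap x.1 x.2 k) * letterVal x) := by
  obtain ⟨i, j⟩ := x
  change i ≠ j at h
  simp only [letterVal]
  rw [smul_mul_assoc, mul_smul_comm, ← smul_neg]
  congr 1
  by_cases hi : k = i
  · subst hi
    rw [Equiv.swap_apply_left, sub_mul, mul_sub, cliffE_sq, cliffE_sq]
    abel
  · by_cases hj : k = j
    · subst hj
      rw [Equiv.swap_apply_right, sub_mul, mul_sub, cliffE_sq, cliffE_sq]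
      abel
    · rw [Equiv.swap_apply_of_ne_of_ne hi hj, sub_mul, mul_sub, cliffE_anticomm (Ne.symm hi),
        cliffE_anticomm (Ne.symm hj)]
      abel

theorem letterVal_mul_letterVal {x : Fin n × Fin n} (h : x.1 ≠ x.2) (y : Fin n × Fin n) :
    letterVal x * letterVal y =
      -(letterVal (Equiv.swap x.1 x.2 y.1, Equiv.swap x.1 x.2 y.2) * letterVal x) := by
  conv_lhs => rw [letterVal.eq_1 y]
  conv_rhs => rw [letterVal.eq_1 (_, _)]
  rw [mul_smul_comm, mul_sub, letterVal_mul_cliffE h, letterVal_mul_cliffE h, smul_mul_assoc,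
    sub_mul, ← smul_neg]
  congr 1
  abel

/-- The product of the letters of a word. -/
def wordVal (w : List (Fin n × Fin n)) : CliffordAlgebra (euclForm n) := (w.map letterVal).prod

/-- The permutation underlying a word. -/
def wordPerm (w : List (Fin n × Fin n)) : Equiv.Perm (Fin n) :=
  (w.map fun x => Equiv.swap x.1 x.2).prod

theorem wordVal_cons (x : Fin n × Fin n) (w : List (Fin n × Fin n)) :
    wordVal (x :: w) = letterVal x * wordVal w := by simp [wordVal]

theorem wordVal_nil : wordVal ([] : List (Fin n × Fin n)) = 1 := rfl

theorem wordVal_append (w w' : List (Fin n × Fin n)) :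
    wordVal (w ++ w') = wordVal w * wordVal w' := by simp [wordVal]

theorem wordVal_mul_cliffE {w : List (Fin n × Fin n)} (h : ∀ x ∈ w, x.1 ≠ x.2) (k : Fin n) :
    wordVal w * cliffE k = (-1) ^ w.length * (cliffE (wordPerm w k) * wordVal w) := by
  induction w generalizing k with
  | nil => simp [wordVal, wordPerm]
  | cons x w ih =>
    rw [wordVal_cons, mul_assoc, ih fun y hy => h y (List.mem_cons_of_mem _ hy), ← mul_assoc,
      ((Commute.neg_one_right _).pow_right _).eq, mul_assoc, ← mul_assoc (letterVal x),
      letterVal_mul_cliffE (h x List.mem_cons_self), List.length_cons, pow_succ, mul_assoc,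
      neg_one_mul, neg_mul, mul_assoc]
    rfl

theorem wordVal_mem_spinGroup : ∀ {w : List (Fin n × Fin n)}, (∀ x ∈ w, x.1 ≠ x.2) →
    Even w.length → wordVal w ∈ spinGroup (euclForm n)
  | [], _, _ => Submonoid.one_mem _
  | [_], _, h => by simp at h
  | x :: y :: w, h, hl => by
    rw [wordVal_cons, wordVal_cons, ← mul_assoc]
    refine Submonoid.mul_mem _ ?_ (wordVal_mem_spinGroup
      (fun z hz => h z (List.mem_cons_of_mem _ (List.mem_cons_of_mem _ hz)))
      (by simpa [Nat.even_add_one] using hl))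
    obtain ⟨v, hv, h1⟩ := letterVal_eq_ι (h x List.mem_cons_self)
    obtain ⟨v', hv', h1'⟩ := letterVal_eq_ι (h y (List.mem_cons_of_mem _ List.mem_cons_self))
    rw [hv, hv']
    exact ι_mul_ι_mem_spinGroup h1 h1'

theorem liesOver_wordPerm {x : Spin n} {w : List (Fin n × Fin n)} (hx : x.1 = wordVal w)
    (h : ∀ x ∈ w, x.1 ≠ x.2) (hl : Even w.length) : LiesOver x (wordPerm w) := by
  intro k
  rw [hx, wordVal_mul_cliffE h, hl.neg_one_pow, one_mul]

/-! ### Signed normal forms for words in the roots -/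

/-- Left multiplication of a word in normal form by a letter: the result is again in normal form,
and the boolean records a change of sign. -/
def insertLetter : Fin n × Fin n → List (Fin n × Fin n) → Bool × List (Fin n × Fin n)
  | x, [] => (false, [x])
  | x, y :: w =>
    if y.2 < x.2 then (false, x :: y :: w)
    else if x.2 = y.2 then
      if x = y then (false, w)
      else if x.1 < y.1 then
        (!(insertLetter (x.1, y.1) w).1, y :: (insertLetter (x.1, y.1) w).2)
      else ((insertLetter (y.1, x.1) w).1, y :: (insertLetter (y.1, x.1) w).2)
    else (!(insertLetter x w).1, (Equiv.swap x.1 x.2 y.1, y.2) :: (insertLetter x w).2)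

/-- The normal form of a word, with a sign. -/
def normalForm : List (Fin n × Fin n) → Bool × List (Fin n × Fin n)
  | [] => (false, [])
  | x :: w =>
    (xor (normalForm w).1 (insertLetter x (normalForm w).2).1,
      (insertLetter x (normalForm w).2).2)

/-- The value of a signed word. -/
def signedVal (p : Bool × List (Fin n × Fin n)) : CliffordAlgebra (euclForm n) :=
  (if p.1 then -1 else 1) * wordVal p.2

theorem signedVal_not (b : Bool) (w : List (Fin n × Fin n)) :
    signedVal (!b, w) = -signedVal (b, w) := by
  cases b <;> simp [signedVal]

theorem signedVal_cons (b : Bool) (y : Fin n × Fin n) (w : List (Fin n × Fin n)) :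
    signedVal (b, y :: w) = letterVal y * signedVal (b, w) := by
  cases b <;> simp [signedVal, wordVal_cons]

/-- In a normal form the larger indices of the letters strictly decrease. The rewriting uses `x y =
-(s_x y) x` to carry a letter with smaller top index to the right and to merge two letters with
equal top index. Only preservation of the value is proved: uniqueness of normal forms plays no role
in deducing equalities. -/
theorem insertLetter_spec (w : List (Fin n × Fin n)) (hw : ∀ y ∈ w, y.1 < y.2)
    (x : Fin n × Fin n) (hx : x.1 < x.2) :
    signedVal (insertLetter x w) = letterVal x * wordVal w ∧
      ∀ y ∈ (insertLetter x w).2, y.1 < y.2 := by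
  induction w generalizing x with
  | nil => simp [insertLetter, signedVal, wordVal, hx]
  | cons y w ih =>
    have hy : y.1 < y.2 := hw y List.mem_cons_self
    have hw' : ∀ y ∈ w, y.1 < y.2 := fun z hz => hw z (List.mem_cons_of_mem _ hz)
    rw [insertLetter]
    split_ifs with h1 h2 h3 h4
    · refine ⟨by simp [signedVal, wordVal_cons], ?_⟩
      simpa [hx, hy] using hw'
    · subst h3
      refine ⟨?_, hw'⟩
      rw [wordVal_cons, ← mul_assoc, letterVal_sq hx.ne, one_mul]
      simp [signedVal]
    · obtain ⟨i, k⟩ := x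
      obtain ⟨j, l⟩ := y
      simp only at h2 h4 hx hy ⊢
      subst h2
      obtain ⟨ih1, ih2⟩ := ih hw' (i, j) h4
      refine ⟨?_, by simpa [hy] using ih2⟩
      have hs : letterVal (i, k) * letterVal (j, k) = -(letterVal (j, k) * letterVal (i, j)) := by
        rw [letterVal_mul_letterVal (x := (j, k)) hy.ne (i, j),
          Equiv.swap_apply_of_ne_of_ne h4.ne hx.ne, Equiv.swap_apply_left, neg_neg]
      rw [signedVal_not, signedVal_cons, ih1, wordVal_cons, ← mul_assoc, ← mul_assoc, hs, neg_mul]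
    · obtain ⟨i, k⟩ := x
      obtain ⟨j, l⟩ := y
      simp only at h2 h4 hx hy ⊢
      subst h2
      have hji : j < i := lt_of_le_of_ne (not_lt.1 h4) (by rintro rfl; exact h3 rfl)
      obtain ⟨ih1, ih2⟩ := ih hw' (j, i) hji
      refine ⟨?_, by simpa [hy] using ih2⟩
      have hs : letterVal (i, k) * letterVal (j, k) = letterVal (j, k) * letterVal (j, i) := by
        rw [letterVal_mul_letterVal (x := (j, k)) hy.ne (j, i),
          Equiv.swap_apply_left, Equiv.swap_apply_of_ne_of_ne hji.ne' hx.ne, letterVal_swap i k,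
          neg_mul, neg_neg]
      rw [signedVal_cons, ih1, wordVal_cons, ← mul_assoc, ← mul_assoc, hs]
    · have h5 : x.2 < y.2 := lt_of_le_of_ne (not_lt.1 h1) h2
      obtain ⟨ih1, ih2⟩ := ih hw' x hx
      refine ⟨?_, ?_⟩
      · rw [signedVal_not, signedVal_cons, ih1, wordVal_cons, ← mul_assoc, ← mul_assoc,
          letterVal_mul_letterVal hx.ne y,
          Equiv.swap_apply_of_ne_of_ne (hx.trans h5).ne' h5.ne', neg_mul]
      · intro z hz
        rcases List.mem_cons.1 hz with rfl | hz
        · simp only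
          rw [Equiv.swap_apply_def]
          split_ifs
          · exact h5
          · exact hx.trans h5
          · exact hy
        · exact ih2 z hz

theorem normalForm_spec (w : List (Fin n × Fin n)) (hw : ∀ y ∈ w, y.1 < y.2) :
    signedVal (normalForm w) = wordVal w ∧ ∀ y ∈ (normalForm w).2, y.1 < y.2 := by
  induction w with
  | nil => simp [normalForm, signedVal, wordVal]
  | cons x w ih =>
    obtain ⟨ih1, ih2⟩ := ih fun z hz => hw z (List.mem_cons_of_mem _ hz)
    obtain ⟨h1, h2⟩ := insertLetter_spec _ ih2 x (hw x List.mem_cons_self)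
    refine ⟨?_, h2⟩
    rw [wordVal_cons, ← ih1, normalForm]
    cases hb : (normalForm w).1
    · rw [Bool.false_xor, Prod.mk.eta, h1]
      simp [signedVal, hb]
    · rw [Bool.true_xor, signedVal_not, Prod.mk.eta, h1]
      simp [signedVal, hb]

/-- This turns identities in the Clifford algebra, signs included, into decidable identities of
lists. -/
theorem wordVal_eq_of_normalForm {w w' : List (Fin n × Fin n)}
    (h : (∀ y ∈ w, y.1 < y.2) ∧ (∀ y ∈ w', y.1 < y.2) ∧ normalForm w = normalForm w') :
    wordVal w = wordVal w' := by
  rw [← (normalForm_spec w h.1).1, ← (normalForm_spec w' h.2.1).1, h.2.2]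

end SpinKernel

/-! ### Coordinates on `UT_3(4) : ⟨g, A⟩` -/

section Coordinates

/-- Coordinates for the field with four elements with respect to the basis `1, ζ`. -/
abbrev FourCoord : Type := Bool × Bool

namespace FourCoord

/-- Addition in coordinates. -/
def add (p q : FourCoord) : FourCoord := (xor p.1 q.1, xor p.2 q.2)

/-- Multiplication in coordinates. -/
def mul (p q : FourCoord) : FourCoord :=
  (xor (p.1 && q.1) (p.2 && q.2), xor (xor (p.1 && q.2) (p.2 && q.1)) (p.2 && q.2))

/-- The element of `F4` with the given coordinates. -/
def val (ζ : F4) (p : FourCoord) : F4 := (if p.1 then 1 else 0) + if p.2 then ζ else 0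

variable {ζ : F4}

theorem _root_.IsPrimitiveRoot.sq_eq_add_one (hζ : IsPrimitiveRoot ζ 3) : ζ ^ 2 = ζ + 1 := by
  have h1 := hζ.pow_eq_one
  have h2 : ζ - 1 ≠ 0 := sub_ne_zero.2 (hζ.ne_one (by norm_num))
  have h3 : (ζ - 1) * (ζ ^ 2 + ζ + 1) = 0 := by linear_combination h1
  have h4 := (mul_eq_zero.1 h3).resolve_left h2
  have h5 := CharTwo.add_self_eq_zero (ζ + 1)
  linear_combination h4 - h5

theorem val_add (p q : FourCoord) : val ζ (add p q) = val ζ p + val ζ q := by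
  have h1 := CharTwo.add_self_eq_zero (1 : F4)
  have h2 := CharTwo.add_self_eq_zero ζ
  obtain ⟨a, b⟩ := p
  obtain ⟨c, d⟩ := q
  cases a <;> cases b <;> cases c <;> cases d <;> simp [val, add] <;> first
    | linear_combination -h1
    | linear_combination -h2
    | linear_combination -h1 - h2
    | ring

theorem val_mul (hζ : IsPrimitiveRoot ζ 3) (p q : FourCoord) :
    val ζ (mul p q) = val ζ p * val ζ q := by
  have h1 := CharTwo.add_self_eq_zero (1 : F4)
  have h2 := CharTwo.add_self_eq_zero ζ
  have h3 := hζ.sq_eq_add_one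
  obtain ⟨a, b⟩ := p
  obtain ⟨c, d⟩ := q
  cases a <;> cases b <;> cases c <;> cases d <;> simp [val, mul] <;> first
    | linear_combination -h3
    | linear_combination -h3 - h2
    | linear_combination -h3 - h1
    | linear_combination -h3 - h1 - h2

/-- The elements `1` and `ζ` are independent over the prime field because `ζ`, `1` and `ζ + 1 = ζ ^
2` are nonzero; surjectivity follows by counting. -/
theorem val_bijective (hζ : IsPrimitiveRoot ζ 3) : Function.Bijective (val ζ) := by
  have h0 : ζ ≠ 0 := hζ.ne_zero (by norm_num)
  have h1 : ζ ≠ 1 := hζ.ne_one (by norm_num)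
  have h2 : ζ + 1 ≠ 0 := by rw [← hζ.sq_eq_add_one]; exact pow_ne_zero 2 h0
  have key : ∀ p, val ζ p = 0 → p = (false, false) := by
    rintro ⟨a, b⟩
    cases a <;> cases b <;> simp [val, h0, add_comm _ ζ, h2]
  have hinj : Function.Injective (val ζ) := by
    intro p q h
    have h3 : val ζ (add p q) = 0 := by
      rw [val_add, h, CharTwo.add_self_eq_zero]
    have h5 : ∀ p q : FourCoord, add p q = (false, false) → p = q := by decide
    exact h5 p q (key _ h3)
  refine (Nat.bijective_iff_injective_and_card _).2 ⟨hinj, ?_⟩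
  rw [GaloisField.card 2 2 (by norm_num), Nat.card_eq_fintype_card]
  rfl

end FourCoord

namespace UT3

theorem galois_apply (m : UT3 F4) : galois m = ⟨m.α ^ 2, m.β ^ 2, m.γ ^ 2⟩ := rfl

theorem polarity_apply (m : UT3 F4) : polarity m = ⟨m.γ, m.β + m.α * m.γ, m.α⟩ := rfl

theorem galois_mul_self : galois * galois = 1 := MulEquiv.ext fun m => galois.left_inv m

theorem polarity_mul_self : polarity * polarity = 1 := MulEquiv.ext fun m => polarity.left_inv m

theorem galois_mul_polarity : galois * polarity = polarity * galois := by
  refine MulEquiv.ext fun m => ?_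
  simp only [MulAut.mul_apply, galois_apply, polarity_apply]
  rw [CharTwo.add_sq, mul_pow]

end UT3

/-- The automorphism `g ^ i * A ^ j`. -/
def outerAut (i j : Bool) : MulAut (UT3 F4) :=
  (if i then UT3.galois else 1) * if j then UT3.polarity else 1

theorem outerAut_mul (i j i' j' : Bool) :
    outerAut i j * outerAut i' j' = outerAut (xor i i') (xor j j') := by
  have h1 := UT3.galois_mul_self
  have h2 := UT3.polarity_mul_self
  have h3 := UT3.galois_mul_polarity
  have h4 : UT3.polarity * (UT3.galois * UT3.polarity) = UT3.galois := by
    rw [h3, ← mul_assoc, h2, one_mul]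
  have h5 : UT3.galois * (UT3.galois * UT3.polarity) = UT3.polarity := by
    rw [← mul_assoc, h1, one_mul]
  cases i <;> cases j <;> cases i' <;> cases j' <;>
    simp [outerAut, h1, h2, h4, h5, mul_assoc, ← h3]

theorem outerAut_mem (i j : Bool) : outerAut i j ∈ outerFour := by
  refine mul_mem ?_ ?_
  · split_ifs
    · exact Subgroup.subset_closure (by simp)
    · exact one_mem _
  · split_ifs
    · exact Subgroup.subset_closure (by simp)
    · exact one_mem _

theorem exists_outerAut {o : MulAut (UT3 F4)} (ho : o ∈ outerFour) :
    ∃ i j, outerAut i j = o := by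
  induction ho using Subgroup.closure_induction with
  | mem x hx =>
    rcases hx with rfl | hx
    · exact ⟨true, false, by simp [outerAut]⟩
    · rw [Set.mem_singleton_iff] at hx
      exact ⟨false, true, by simp [outerAut, hx]⟩
  | one => exact ⟨false, false, by simp [outerAut]⟩
  | mul x y _ _ hx hy =>
    obtain ⟨i, j, rfl⟩ := hx
    obtain ⟨i', j', rfl⟩ := hy
    exact ⟨_, _, (outerAut_mul i j i' j').symm⟩
  | inv x _ hx =>
    obtain ⟨i, j, rfl⟩ := hx
    refine ⟨i, j, eq_inv_of_mul_eq_one_left ?_⟩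
    rw [outerAut_mul]
    simp [outerAut]

/-- Coordinates `(α, β, γ, i, j)` for the element `(α, β, γ) g ^ i A ^ j`. -/
abbrev SylCoord : Type := FourCoord × FourCoord × FourCoord × Bool × Bool

namespace SylCoord

/-- The action of `g ^ i A ^ j` on `UT_3(4)` in coordinates. -/
def act (i j : Bool) (u : FourCoord × FourCoord × FourCoord) :
    FourCoord × FourCoord × FourCoord :=
  let v := if j then (u.2.2, FourCoord.add u.2.1 (FourCoord.mul u.1 u.2.2), u.1) else u
  if i then (FourCoord.mul v.1 v.1, FourCoord.mul v.2.1 v.2.1, FourCoord.mul v.2.2 v.2.2) else v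

/-- Multiplication in coordinates. -/
def mul (x y : SylCoord) : SylCoord :=
  let v := act x.2.2.2.1 x.2.2.2.2 (y.1, y.2.1, y.2.2.1)
  (FourCoord.add x.1 v.1, FourCoord.add (FourCoord.add x.2.1 v.2.1) (FourCoord.mul x.1 v.2.2),
    FourCoord.add x.2.2.1 v.2.2, xor x.2.2.2.1 y.2.2.2.1, xor x.2.2.2.2 y.2.2.2.2)

/-- The matrix with given coordinates. -/
def unip (ζ : F4) (u : FourCoord × FourCoord × FourCoord) : UT3 F4 :=
  ⟨u.1.val ζ, u.2.1.val ζ, u.2.2.val ζ⟩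

/-- The element with given coordinates. -/
def el (ζ : F4) (x : SylCoord) : SylLy :=
  ⟨unip ζ (x.1, x.2.1, x.2.2.1), ⟨outerAut x.2.2.2.1 x.2.2.2.2, outerAut_mem _ _⟩⟩

variable {ζ : F4}

theorem unip_act (hζ : IsPrimitiveRoot ζ 3) (i j : Bool) (u : FourCoord × FourCoord × FourCoord) :
    unip ζ (act i j u) = outerAut i j (unip ζ u) := by
  cases i <;> cases j <;>
    simp [act, outerAut, unip, UT3.galois_apply, UT3.polarity_apply, FourCoord.val_mul hζ,
      FourCoord.val_add, pow_two]

/-- With `el_bijective` this transfers every question about the group to eight bits, where `decide`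
applies. -/
theorem el_mul (hζ : IsPrimitiveRoot ζ 3) (x y : SylCoord) :
    el ζ (mul x y) = el ζ x * el ζ y := by
  refine SemidirectProduct.ext ?_ ?_
  · rw [SemidirectProduct.mul_left]
    change _ = unip ζ _ * outerAut x.2.2.2.1 x.2.2.2.2 (unip ζ _)
    rw [← unip_act hζ]
    ext <;> simp [el, mul, unip, FourCoord.val_mul hζ, FourCoord.val_add]
  · rw [SemidirectProduct.mul_right]
    exact Subtype.ext (outerAut_mul _ _ _ _).symm

theorem unip_injective (hζ : IsPrimitiveRoot ζ 3) : Function.Injective (unip ζ) := by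
  rintro ⟨a, b, c⟩ ⟨a', b', c'⟩ h
  simp only [unip, UT3.mk.injEq, (FourCoord.val_bijective hζ).1.eq_iff] at h
  obtain ⟨rfl, rfl, rfl⟩ := h
  rfl

theorem outerAut_injective {ζ : F4} (hζ : IsPrimitiveRoot ζ 3) {i j i' j' : Bool}
    (h : outerAut i j = outerAut i' j') : i = i' ∧ j = j' := by
  have h1 : act i j ((false, true), (false, false), (false, false)) =
      act i' j' ((false, true), (false, false), (false, false)) :=
    unip_injective hζ (by rw [unip_act hζ, unip_act hζ, h])
  revert h1
  clear h
  revert i j i' j'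
  decide

theorem el_bijective (hζ : IsPrimitiveRoot ζ 3) : Function.Bijective (el ζ) := by
  constructor
  · rintro ⟨a, b, c, i, j⟩ ⟨a', b', c', i', j'⟩ h
    have h1 := congrArg SemidirectProduct.left h
    have h2 := congrArg SemidirectProduct.right h
    simp only [el, unip, UT3.mk.injEq, (FourCoord.val_bijective hζ).1.eq_iff,
      Subtype.mk.injEq] at h1 h2
    obtain ⟨rfl, rfl⟩ := outerAut_injective hζ h2
    obtain ⟨rfl, rfl, rfl⟩ := h1
    rfl
  · rintro ⟨⟨a, b, c⟩, ⟨o, ho⟩⟩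
    obtain ⟨i, j, rfl⟩ := exists_outerAut ho
    obtain ⟨a, rfl⟩ := (FourCoord.val_bijective hζ).2 a
    obtain ⟨b, rfl⟩ := (FourCoord.val_bijective hζ).2 b
    obtain ⟨c, rfl⟩ := (FourCoord.val_bijective hζ).2 c
    exact ⟨(a, b, c, i, j), rfl⟩

theorem card_sylLy {ζ : F4} (hζ : IsPrimitiveRoot ζ 3) : Nat.card SylLy = 2 ^ 8 := by
  rw [← Nat.card_congr (Equiv.ofBijective _ (el_bijective hζ)), Nat.card_eq_fintype_card]
  simp

theorem forall_iff {p : SylCoord → Prop} : (∀ x, p x) ↔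
    ∀ a a' b b' c c' i j, p ((a, a'), (b, b'), (c, c'), i, j) := by
  simp only [Prod.forall]

instance {p : SylCoord → Prop} [DecidablePred p] : Decidable (∀ x, p x) :=
  decidable_of_iff _ forall_iff.symm

/-- The neutral element. -/
def one : SylCoord := ((false, false), (false, false), (false, false), false, false)
/-- The element `A`. -/
def cA : SylCoord := ((false, false), (false, false), (false, false), false, true)
/-- The element `g`. -/
def cG : SylCoord := ((false, false), (false, false), (false, false), true, false)
/-- The element `T`. -/
def cT : SylCoord := ((false, false), (false, true), (false, false), false, false)
/-- The element `Z`. -/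
def cZ : SylCoord := ((false, false), (true, false), (false, false), false, false)
/-- The element `(1, 0, 0)`. -/
def cX : SylCoord := ((true, false), (false, false), (false, false), false, false)

theorem el_one : el ζ one = 1 := by
  refine SemidirectProduct.ext ?_ (Subtype.ext ?_)
  · simp [el, one, unip, FourCoord.val]; rfl
  · simp [el, one, outerAut]

theorem el_cA : el ζ cA = SylLy.elemA := by
  refine SemidirectProduct.ext ?_ (Subtype.ext ?_)
  · simp [el, cA, unip, FourCoord.val, SylLy.elemA]; rfl
  · simp [el, cA, outerAut, SylLy.elemA]

theorem el_cT : el ζ cT = SylLy.elemT ζ := by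
  refine SemidirectProduct.ext ?_ (Subtype.ext ?_)
  · simp [el, cT, unip, FourCoord.val, SylLy.elemT]
  · simp [el, cT, outerAut, SylLy.elemT]

theorem el_cZ : el ζ cZ = SylLy.elemZ := by
  refine SemidirectProduct.ext ?_ (Subtype.ext ?_)
  · simp [el, cZ, unip, FourCoord.val, SylLy.elemZ]
  · simp [el, cZ, outerAut, SylLy.elemZ]

end SylCoord

end Coordinates

/-! ### Conjugacy and elementary abelian 2-subgroups -/

section GroupLemmas

variable {G H : Type*} [Group G] [Group H]

theorem mem_conjSubgroup {g x : G} {K : Subgroup G} :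
    x ∈ conjSubgroup g K ↔ g⁻¹ * x * g ∈ K := by
  constructor
  · rintro ⟨y, hy, rfl⟩
    simpa [mul_assoc] using hy
  · intro h
    exact ⟨_, h, by simp [mul_assoc]⟩

theorem conjSubgroup_one (K : Subgroup G) : conjSubgroup 1 K = K := by
  ext x
  simp [mem_conjSubgroup]

theorem conjSubgroup_conjSubgroup (g h : G) (K : Subgroup G) :
    conjSubgroup g (conjSubgroup h K) = conjSubgroup (g * h) K := by
  ext x
  simp [mem_conjSubgroup, mul_assoc]

theorem conjSubgroup_mono (g : G) {K L : Subgroup G} (h : K ≤ L) :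
    conjSubgroup g K ≤ conjSubgroup g L := Subgroup.map_mono h

theorem conjSubgroup_le_iff {g : G} {K L : Subgroup G} :
    conjSubgroup g K ≤ L ↔ K ≤ conjSubgroup g⁻¹ L := by
  constructor
  · intro h
    have := conjSubgroup_mono g⁻¹ h
    rwa [conjSubgroup_conjSubgroup, inv_mul_cancel, conjSubgroup_one] at this
  · intro h
    have := conjSubgroup_mono g h
    rwa [conjSubgroup_conjSubgroup, mul_inv_cancel, conjSubgroup_one] at this

theorem card_conjSubgroup (g : G) (K : Subgroup G) : Nat.card (conjSubgroup g K) = Nat.card K :=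
  Nat.card_congr (K.equivMapOfInjective _ (MulAut.conj g).injective).symm.toEquiv

theorem map_conjSubgroup (f : G →* H) (g : G) (K : Subgroup G) :
    (conjSubgroup g K).map f = conjSubgroup (f g) (K.map f) := by
  ext x
  constructor
  · rintro ⟨_, ⟨y, hy, rfl⟩, rfl⟩
    exact ⟨f y, ⟨y, hy, rfl⟩, by simp⟩
  · rintro ⟨_, ⟨y, hy, rfl⟩, rfl⟩
    exact ⟨_, ⟨y, hy, rfl⟩, by simp⟩

namespace AreConj

variable {K L M : Subgroup G}

theorem symm (h : AreConj K L) : AreConj L K := by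
  obtain ⟨g, rfl⟩ := h
  exact ⟨g⁻¹, by rw [conjSubgroup_conjSubgroup, inv_mul_cancel, conjSubgroup_one]⟩

theorem trans (h : AreConj K L) (h' : AreConj L M) : AreConj K M := by
  obtain ⟨g, rfl⟩ := h
  obtain ⟨g', rfl⟩ := h'
  exact ⟨g' * g, (conjSubgroup_conjSubgroup _ _ _).symm⟩

theorem card_eq (h : AreConj K L) : Nat.card K = Nat.card L := by
  obtain ⟨g, rfl⟩ := h
  exact (card_conjSubgroup g K).symm

theorem map (f : G →* H) (h : AreConj K L) : AreConj (K.map f) (L.map f) := by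
  obtain ⟨g, rfl⟩ := h
  exact ⟨f g, (map_conjSubgroup f g K).symm⟩

end AreConj

theorem isElemAbTwo_iff {E : Subgroup G} : IsElemAbTwo E ↔ ∀ x ∈ E, x * x = 1 := by
  constructor
  · intro h x hx
    rw [← pow_two, h.2 x hx]
  · intro h
    refine ⟨fun x hx y hy => ?_, fun x hx => by rw [pow_two, h x hx]⟩
    have h1 := h _ (E.mul_mem hx hy)
    rw [mul_eq_one_iff_eq_inv, mul_inv_rev, ← eq_inv_of_mul_eq_one_left (h x hx),
      ← eq_inv_of_mul_eq_one_left (h y hy)] at h1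
    exact h1

namespace IsElemAbTwo

variable {E E' : Subgroup G}

theorem mono (h : IsElemAbTwo E) (h' : E' ≤ E) : IsElemAbTwo E' :=
  isElemAbTwo_iff.2 fun x hx => isElemAbTwo_iff.1 h x (h' hx)

theorem map (f : G →* H) (h : IsElemAbTwo E) : IsElemAbTwo (E.map f) := by
  rw [isElemAbTwo_iff] at h ⊢
  rintro _ ⟨x, hx, rfl⟩
  rw [← map_mul, h x hx, map_one]

theorem comap {f : G →* H} (hf : Function.Injective f) {E : Subgroup H} (h : IsElemAbTwo E) :
    IsElemAbTwo (E.comap f) := by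
  rw [isElemAbTwo_iff] at h ⊢
  intro x hx
  apply hf
  rw [map_mul, h _ hx, map_one]

theorem of_map {f : G →* H} (hf : Function.Injective f) (h : IsElemAbTwo (E.map f)) :
    IsElemAbTwo E :=
  (h.comap hf).mono (Subgroup.le_comap_map f E)

theorem conj (h : IsElemAbTwo E) (g : G) : IsElemAbTwo (conjSubgroup g E) := h.map _

theorem isPGroup (h : IsElemAbTwo E) : IsPGroup 2 E := fun x =>
  ⟨1, Subtype.ext (by simpa using h.2 x x.2)⟩

end IsElemAbTwo

theorem IsMaxElemAbTwo.eq_of_le {E E' : Subgroup G} (h : IsMaxElemAbTwo E) (h' : IsElemAbTwo E')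
    (hle : E ≤ E') : E = E' := le_antisymm hle (h.2 h' hle)

theorem IsMaxElemAbTwo.of_areConj {E E' : Subgroup G} (h : IsMaxElemAbTwo E) (hc : AreConj E E') :
    IsMaxElemAbTwo E' := by
  obtain ⟨g, rfl⟩ := hc
  refine ⟨h.1.conj g, fun L hL hle => ?_⟩
  have h1 := conjSubgroup_le_iff.1 hle
  have h2 := h.2 (hL.conj g⁻¹) h1
  have h3 := conjSubgroup_mono g h2
  rwa [conjSubgroup_conjSubgroup, mul_inv_cancel, conjSubgroup_one] at h3

theorem IsMaxElemAbTwo.of_map {f : G →* H} (hf : Function.Injective f) {E : Subgroup G}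
    (h : IsMaxElemAbTwo (E.map f)) : IsMaxElemAbTwo E := by
  refine ⟨IsElemAbTwo.of_map hf h.1, fun L hL hle => ?_⟩
  exact (Subgroup.map_le_map_iff_of_injective hf).1 (h.2 (hL.map f) (Subgroup.map_mono hle))

/-- A self-centralizing elementary abelian 2-subgroup is maximal. -/
theorem isMaxElemAbTwo_of_centralizer {E : Subgroup G} (h : IsElemAbTwo E)
    (hc : Subgroup.centralizer (E : Set G) = E) : IsMaxElemAbTwo E := by
  refine ⟨h, fun L hL hle x hx => ?_⟩
  rw [← hc, Subgroup.mem_centralizer_iff]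
  exact fun y hy => hL.1 y (hle hy) x hx

/-- A 2-subgroup is conjugate into any given Sylow 2-subgroup. -/
theorem exists_conjSubgroup_le [Finite G] {E : Subgroup G} (hE : IsPGroup 2 E) (P : Sylow 2 G) :
    ∃ g, conjSubgroup g E ≤ P := by
  obtain ⟨Q, hQ⟩ := hE.exists_le_sylow
  obtain ⟨g, rfl⟩ := MulAction.exists_smul_eq G Q P
  exact ⟨g, conjSubgroup_mono g hQ⟩

/-- Two identifications of a group with a Sylow 2-subgroup differ by conjugation and an
automorphism. -/
theorem IsSylowTwoEmbedding.exists_conj {S : Type*} [Group S] [Finite G] {f₀ f : S →* G}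
    (h₀ : IsSylowTwoEmbedding f₀) (h : IsSylowTwoEmbedding f) :
    ∃ (g : G) (φ : S ≃* S), ∀ s, f s = g * f₀ (φ s) * g⁻¹ := by
  obtain ⟨hi₀, P₀, hP₀⟩ := h₀
  obtain ⟨hi, P, hP⟩ := h
  have : Finite S := Finite.of_injective f hi
  obtain ⟨g, hg⟩ := MulAction.exists_smul_eq G P₀ P
  have hg' : conjSubgroup g f₀.range = f.range := by
    rw [← hP, ← hP₀, ← hg]; rfl
  have hmem : ∀ s, g⁻¹ * f s * g ∈ f₀.range := by
    intro s
    rw [← mem_conjSubgroup, hg']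
    exact ⟨s, rfl⟩
  choose ψ hψ using hmem
  -- The automorphism is `f₀⁻¹` composed with conjugation by `g⁻¹` and `f`; finiteness makes the
  -- injective endomorphism bijective.
  let φ : S →* S := MonoidHom.mk' ψ (fun a b => hi₀ (by
    rw [map_mul, hψ, hψ, hψ, map_mul]; group))
  have hφ : Function.Injective φ := by
    intro a b hab
    have h1 : f₀ (ψ a) = f₀ (ψ b) := congrArg f₀ hab
    rw [hψ, hψ] at h1
    exact hi (mul_left_cancel (mul_right_cancel h1))
  refine ⟨g, MulEquiv.ofBijective φ (Finite.injective_iff_bijective.1 hφ), fun s => ?_⟩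
  change f s = g * f₀ (ψ s) * g⁻¹
  rw [hψ]
  group

theorem map_eq_conjSubgroup_map {S : Type*} [Group S] {f₀ f : S →* G} {g : G} {φ : S ≃* S}
    (h : ∀ s, f s = g * f₀ (φ s) * g⁻¹) (K : Subgroup S) :
    K.map f = conjSubgroup g ((K.map φ.toMonoidHom).map f₀) := by
  ext x
  constructor
  · rintro ⟨y, hy, rfl⟩
    exact ⟨_, ⟨_, ⟨y, hy, rfl⟩, rfl⟩, by simp [h]⟩
  · rintro ⟨_, ⟨_, ⟨y, hy, rfl⟩, rfl⟩, rfl⟩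
    exact ⟨y, hy, by simp [h]⟩

/-- An injective homomorphism from a 2-group whose order is the 2-part of `|G|` is a Sylow
embedding. -/
theorem isSylowTwoEmbedding_of_card {S : Type*} [Group S] [Finite G] {f : S →* G}
    (hf : Function.Injective f) {k m : ℕ} (hS : Nat.card S = 2 ^ k) (hG : Nat.card G = 2 ^ k * m)
    (hm : ¬ 2 ∣ m) : IsSylowTwoEmbedding f := by
  have hr : Nat.card f.range = 2 ^ k := by
    rw [← hS]
    exact (Nat.card_congr (MonoidHom.ofInjective hf).toEquiv).symm
  refine ⟨hf, Sylow.ofCard f.range ?_, rfl⟩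
  rw [hr, hG]
  have hm0 : m ≠ 0 := by rintro rfl; simp at hm
  rw [Nat.factorization_mul (by positivity) hm0, Finsupp.add_apply,
    Nat.factorization_eq_zero_of_not_dvd hm, Nat.Prime.factorization_pow Nat.prime_two]
  simp

end GroupLemmas

/-! ### Elementary abelian subgroups of `UT_3(4) : ⟨g, A⟩` -/

section SylSubgroups

namespace SylCoord

variable {ζ : F4}

instance : DecidableEq SylCoord := inferInstanceAs (DecidableEq (_ × _))

/-- A predicate on coordinates that defines an elementary abelian 2-subgroup. -/
def IsElemPred (P : SylCoord → Bool) : Prop :=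
  P one ∧ (∀ x, P x → ∀ y, P y → P (mul x y)) ∧ ∀ x, P x → mul x x = one

/-- The elementary abelian 2-subgroup defined by a predicate on coordinates. -/
def subgroup (hζ : IsPrimitiveRoot ζ 3) (P : SylCoord → Bool) (h : IsElemPred P) :
    Subgroup SylLy where
  carrier := {s | ∃ x, P x ∧ el ζ x = s}
  mul_mem' := by
    rintro _ _ ⟨x, hx, rfl⟩ ⟨y, hy, rfl⟩
    exact ⟨_, h.2.1 x hx y hy, el_mul hζ x y⟩
  one_mem' := ⟨_, h.1, el_one⟩
  inv_mem' := by
    rintro _ ⟨x, hx, rfl⟩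
    refine ⟨x, hx, eq_inv_of_mul_eq_one_left ?_⟩
    rw [← el_mul hζ, h.2.2 x hx, el_one]

theorem el_mem_subgroup (hζ : IsPrimitiveRoot ζ 3) {P : SylCoord → Bool} {h : IsElemPred P}
    {x : SylCoord} : el ζ x ∈ subgroup hζ P h ↔ P x := by
  constructor
  · rintro ⟨y, hy, hxy⟩
    rwa [← (el_bijective hζ).1 hxy]
  · exact fun hx => ⟨x, hx, rfl⟩

theorem isElemAbTwo_subgroup (hζ : IsPrimitiveRoot ζ 3) {P : SylCoord → Bool}
    (h : IsElemPred P) : IsElemAbTwo (subgroup hζ P h) := by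
  rw [isElemAbTwo_iff]
  rintro _ ⟨x, hx, rfl⟩
  rw [← el_mul hζ, h.2.2 x hx, el_one]

theorem card_subgroup (hζ : IsPrimitiveRoot ζ 3) {P : SylCoord → Bool} (h : IsElemPred P) {k : ℕ}
    (e : Fin k → SylCoord) (he : Function.Injective e) (hP : ∀ x, P x ↔ ∃ i, e i = x) :
    Nat.card (subgroup hζ P h) = k := by
  have hb : Function.Bijective
      (fun i : Fin k => (⟨el ζ (e i), (el_mem_subgroup hζ).2 ((hP _).2 ⟨i, rfl⟩)⟩ :
        subgroup hζ P h)) := by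
    constructor
    · intro i j hij
      exact he ((el_bijective hζ).1 (congrArg Subtype.val hij))
    · rintro ⟨_, x, hx, rfl⟩
      obtain ⟨i, rfl⟩ := (hP x).1 hx
      exact ⟨i, rfl⟩
  rw [← Nat.card_congr (Equiv.ofBijective _ hb), Nat.card_eq_fintype_card, Fintype.card_fin]

/-- Coordinates of the elements of `2^4`. -/
def inFour : SylCoord → Bool
  | (_, _, (false, false), false, false) => true
  | _ => false

/-- Coordinates of the elements of `⟨A, T, Z⟩`. -/
def inATZ : SylCoord → Bool
  | ((false, false), _, (false, false), false, _) => true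
  | _ => false

/-- Coordinates of the elements of `⟨A, g, Z⟩`. -/
def inAGZ : SylCoord → Bool
  | ((false, false), (_, false), (false, false), _, _) => true
  | _ => false

/-- Coordinates of the elements of `⟨(1, 0, 0), g, Z⟩`. -/
def inXGZ : SylCoord → Bool
  | ((_, false), (_, false), (false, false), _, false) => true
  | _ => false

theorem isElemPred_inFour : IsElemPred inFour := by
  refine ⟨?_, ?_, ?_⟩ <;> decide +kernel
theorem isElemPred_inATZ : IsElemPred inATZ := by
  refine ⟨?_, ?_, ?_⟩ <;> decide +kernel
theorem isElemPred_inAGZ : IsElemPred inAGZ := by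
  refine ⟨?_, ?_, ?_⟩ <;> decide +kernel
theorem isElemPred_inXGZ : IsElemPred inXGZ := by
  refine ⟨?_, ?_, ?_⟩ <;> decide +kernel

/-- The subgroup `⟨A, g, Z⟩`. -/
def agz (hζ : IsPrimitiveRoot ζ 3) : Subgroup SylLy := subgroup hζ inAGZ isElemPred_inAGZ

/-- The subgroup `⟨(1, 0, 0), g, Z⟩`. -/
def xgz (hζ : IsPrimitiveRoot ζ 3) : Subgroup SylLy := subgroup hζ inXGZ isElemPred_inXGZ

theorem fourI_eq (hζ : IsPrimitiveRoot ζ 3) :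
    SylLy.fourI = subgroup hζ inFour isElemPred_inFour := by
  have hel : ∀ a b, el ζ (a, b, (false, false), false, false) =
      SemidirectProduct.inl ⟨a.val ζ, b.val ζ, 0⟩ := by
    intro a b
    refine SemidirectProduct.ext ?_ (Subtype.ext ?_)
    · simp [el, unip, FourCoord.val]
    · simp [el, outerAut]
  apply le_antisymm
  · rw [SylLy.fourI, Subgroup.closure_le]
    rintro _ ⟨α, β, rfl⟩
    obtain ⟨a, rfl⟩ := (FourCoord.val_bijective hζ).2 α
    obtain ⟨b, rfl⟩ := (FourCoord.val_bijective hζ).2 β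
    exact ⟨_, rfl, hel a b⟩
  · rintro _ ⟨⟨a, b, ⟨c, c'⟩, i, j⟩, hx, rfl⟩
    cases c <;> cases c' <;> cases i <;> cases j <;> simp [inFour] at hx
    exact Subgroup.subset_closure ⟨_, _, hel a b⟩

theorem threeATZ_eq (hζ : IsPrimitiveRoot ζ 3) :
    SylLy.threeATZ ζ = subgroup hζ inATZ isElemPred_inATZ := by
  apply le_antisymm
  · rw [SylLy.threeATZ, Subgroup.closure_le, ← el_cA (ζ := ζ), ← el_cT, ← el_cZ (ζ := ζ)]
    rintro _ (rfl | rfl | rfl)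
    · exact ⟨_, rfl, rfl⟩
    · exact ⟨_, rfl, rfl⟩
    · exact ⟨_, rfl, rfl⟩
  · rintro _ ⟨x, hx, rfl⟩
    have hd : ∀ x, inATZ x → x = mul (if x.2.1.1 then cZ else one)
        (mul (if x.2.1.2 then cT else one) (if x.2.2.2.2 then cA else one)) := by decide +kernel
    rw [hd x hx, el_mul hζ, el_mul hζ]
    refine mul_mem ?_ (mul_mem ?_ ?_) <;> split_ifs
    · rw [el_cZ]; exact Subgroup.subset_closure (by simp)
    · rw [el_one]; exact one_mem _
    · rw [el_cT]; exact Subgroup.subset_closure (by simp)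
    · rw [el_one]; exact one_mem _
    · rw [el_cA]; exact Subgroup.subset_closure (by simp)
    · rw [el_one]; exact one_mem _

theorem card_fourI (hζ : IsPrimitiveRoot ζ 3) : Nat.card SylLy.fourI = 2 ^ 4 := by
  rw [fourI_eq hζ]
  refine card_subgroup hζ _ (k := 16) (fun i => ((i.val.testBit 0, i.val.testBit 1),
    (i.val.testBit 2, i.val.testBit 3), (false, false), false, false)) ?_ ?_
  · unfold Function.Injective; decide +kernel
  · decide +kernel

theorem card_threeATZ (hζ : IsPrimitiveRoot ζ 3) : Nat.card (SylLy.threeATZ ζ) = 2 ^ 3 := by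
  rw [threeATZ_eq hζ]
  refine card_subgroup hζ _ (k := 8) (fun i => ((false, false),
    (i.val.testBit 0, i.val.testBit 1), (false, false), false, i.val.testBit 2)) ?_ ?_
  · unfold Function.Injective; decide +kernel
  · decide +kernel

theorem card_agz (hζ : IsPrimitiveRoot ζ 3) : Nat.card (agz hζ) = 2 ^ 3 := by
  refine card_subgroup hζ _ (k := 8) (fun i => ((false, false),
    (i.val.testBit 0, false), (false, false), i.val.testBit 1, i.val.testBit 2)) ?_ ?_
  · unfold Function.Injective; decide +kernel
  · decide +kernel

theorem card_xgz (hζ : IsPrimitiveRoot ζ 3) : Nat.card (xgz hζ) = 2 ^ 3 := by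
  refine card_subgroup hζ _ (k := 8) (fun i => ((i.val.testBit 2, false),
    (i.val.testBit 0, false), (false, false), i.val.testBit 1, false)) ?_ ?_
  · unfold Function.Injective; decide +kernel
  · decide +kernel

/-! ### Centralizers and conjugates of Z, A and T in S -/

theorem comm_iff (hζ : IsPrimitiveRoot ζ 3) {x y : SylCoord} :
    el ζ x * el ζ y = el ζ y * el ζ x ↔ mul x y = mul y x := by
  rw [← el_mul hζ, ← el_mul hζ, (el_bijective hζ).1.eq_iff]

theorem sq_iff (hζ : IsPrimitiveRoot ζ 3) {x : SylCoord} :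
    el ζ x * el ζ x = 1 ↔ mul x x = one := by
  rw [← el_mul hζ, ← el_one (ζ := ζ), (el_bijective hζ).1.eq_iff]

/-- The centre of `UT_3(4) : ⟨g, A⟩` is `⟨Z⟩`. -/
theorem eq_one_or_of_central (hζ : IsPrimitiveRoot ζ 3) {s : SylLy} (hs : ∀ t, s * t = t * s) :
    s = 1 ∨ s = SylLy.elemZ := by
  obtain ⟨x, rfl⟩ := (el_bijective hζ).2 s
  have hd : ∀ x, mul x cA = mul cA x → mul x cG = mul cG x → mul x cT = mul cT x →
      mul x cX = mul cX x →
      x = one ∨ x = cZ := by decide +kernel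
  rw [← el_one (ζ := ζ), ← el_cZ (ζ := ζ), (el_bijective hζ).1.eq_iff, (el_bijective hζ).1.eq_iff]
  exact hd x ((comm_iff hζ).1 (hs _)) ((comm_iff hζ).1 (hs _)) ((comm_iff hζ).1 (hs _))
    ((comm_iff hζ).1 (hs _))

theorem elemZ_central (hζ : IsPrimitiveRoot ζ 3) (s : SylLy) :
    SylLy.elemZ * s = s * SylLy.elemZ := by
  obtain ⟨x, rfl⟩ := (el_bijective hζ).2 s
  rw [← el_cZ (ζ := ζ), comm_iff hζ]
  revert x
  decide +kernel

theorem centralizer_threeATZ (hζ : IsPrimitiveRoot ζ 3) {s : SylLy}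
    (hA : s * SylLy.elemA = SylLy.elemA * s) (hT : s * SylLy.elemT ζ = SylLy.elemT ζ * s) :
    s ∈ SylLy.threeATZ ζ := by
  obtain ⟨x, rfl⟩ := (el_bijective hζ).2 s
  rw [threeATZ_eq hζ, el_mem_subgroup]
  rw [← el_cA (ζ := ζ), comm_iff hζ] at hA
  rw [← el_cT, comm_iff hζ] at hT
  revert hA hT
  revert x
  decide +kernel

/-- Every conjugate of `T` is `T` or `T * Z`. -/
theorem conj_elemT (hζ : IsPrimitiveRoot ζ 3) (s : SylLy) :
    s * SylLy.elemT ζ * s⁻¹ = SylLy.elemT ζ ∨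
      s * SylLy.elemT ζ * s⁻¹ = SylLy.elemT ζ * SylLy.elemZ := by
  obtain ⟨x, rfl⟩ := (el_bijective hζ).2 s
  have hd : ∀ x, mul x cT = mul cT x ∨ mul x cT = mul (mul cT cZ) x := by decide +kernel
  rw [mul_inv_eq_iff_eq_mul, mul_inv_eq_iff_eq_mul, ← el_cT, ← el_cZ (ζ := ζ), ← el_mul hζ,
    ← el_mul hζ, ← el_mul hζ, ← el_mul hζ, (el_bijective hζ).1.eq_iff, (el_bijective hζ).1.eq_iff]
  exact hd x

theorem elemT_mem_normalCore_fourI (hζ : IsPrimitiveRoot ζ 3) :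
    SylLy.elemT ζ ∈ SylLy.fourI.normalCore := by
  intro s
  have h : ∀ x, inFour x → el ζ x ∈ SylLy.fourI := fun x hx => by
    rw [fourI_eq hζ]; exact (el_mem_subgroup hζ).2 hx
  rcases conj_elemT hζ s with h1 | h1 <;> rw [h1]
  · rw [← el_cT]; exact h _ rfl
  · rw [← el_cT, ← el_cZ (ζ := ζ), ← el_mul hζ]; exact h _ rfl

/-- The polarity `A` exchanges the (α, β, 0) with the (0, β, γ), and these two subgroups meet in the
(0, β, 0). -/
theorem normalCore_fourI_le (hζ : IsPrimitiveRoot ζ 3) :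
    SylLy.fourI.normalCore ≤ SylLy.threeATZ ζ := by
  intro s hs
  obtain ⟨x, rfl⟩ := (el_bijective hζ).2 s
  have h1 := hs 1
  have h2 := hs SylLy.elemA
  have hinv : (SylLy.elemA)⁻¹ = SylLy.elemA := by
    refine inv_eq_of_mul_eq_one_left ?_
    rw [← el_cA (ζ := ζ), sq_iff hζ]
    rfl
  rw [one_mul, inv_one, mul_one, fourI_eq hζ, el_mem_subgroup] at h1
  rw [hinv, ← el_cA (ζ := ζ), ← el_mul hζ, ← el_mul hζ, fourI_eq hζ, el_mem_subgroup] at h2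
  rw [threeATZ_eq hζ, el_mem_subgroup]
  clear hs
  revert h1 h2
  revert x
  decide +kernel

theorem elemT_not_mem_conj_agz (hζ : IsPrimitiveRoot ζ 3) (s : SylLy) :
    SylLy.elemT ζ ∉ conjSubgroup s (agz hζ) := by
  rw [mem_conjSubgroup]
  have h := conj_elemT hζ s⁻¹
  rw [inv_inv] at h
  rcases h with h1 | h1 <;> rw [h1, ← el_cT]
  · rw [agz, el_mem_subgroup]; decide
  · rw [← el_cZ (ζ := ζ), ← el_mul hζ, agz, el_mem_subgroup]; decide

theorem elemT_not_mem_conj_xgz (hζ : IsPrimitiveRoot ζ 3) (s : SylLy) :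
    SylLy.elemT ζ ∉ conjSubgroup s (xgz hζ) := by
  rw [mem_conjSubgroup]
  have h := conj_elemT hζ s⁻¹
  rw [inv_inv] at h
  rcases h with h1 | h1 <;> rw [h1, ← el_cT]
  · rw [xgz, el_mem_subgroup]; decide
  · rw [← el_cZ (ζ := ζ), ← el_mul hζ, xgz, el_mem_subgroup]; decide

/-! ### Involutions outside UT_3(4) and the four types of elementary abelian subgroup -/

theorem exists_mul_cA_eq (x : SylCoord) (hx : mul x x = one) (hi : x.2.2.2.1 = false)
    (hj : x.2.2.2.2 = true) : ∃ u, mul u cA = mul x u := by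
  -- An involution in this coset is (α, β, α)A, and for u = (a, 0, c) one finds u A u⁻¹ = (a + c,
  -- a², a + c)A. So a is the square root of β, namely β² since β⁴ = β, and c = α + a.
  refine ⟨(FourCoord.mul x.2.1 x.2.1, (false, false),
    FourCoord.add x.1 (FourCoord.mul x.2.1 x.2.1), false, false), ?_⟩
  revert hx hi hj
  revert x
  decide +kernel

theorem exists_mul_cG_eq (x : SylCoord) (hx : mul x x = one) (hi : x.2.2.2.1 = true)
    (hj : x.2.2.2.2 = false) : ∃ u, mul u cG = mul x u := by
  -- An involution (α, β, γ)g has α, γ in F_2 and β + β² = αγ. Since ζ + ζ² = 1, multiplication by ζ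
  -- solves a + a² = α for α in F_2; the middle entry is corrected by αγ.
  refine ⟨((false, x.1.1), (false, xor x.2.1.1 (x.1.1 && x.2.2.1.1)), (false, x.2.2.1.1),
    false, false), ?_⟩
  revert hx hi hj
  revert x
  decide +kernel

/-- The element `g * A`. -/
def cGA : SylCoord := ((false, false), (false, false), (false, false), true, true)

theorem exists_mul_cGA_eq (x : SylCoord) (hx : mul x x = one) (hi : x.2.2.2.1 = true)
    (hj : x.2.2.2.2 = true) : ∃ u, mul u cGA = mul x u := by
  -- For u = (α, bζ, 0) with b in F_2 one finds u gA u⁻¹ = (α, b + α³, α²)gA, and the norm α³ is 1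
  -- exactly when α ≠ 0.
  refine ⟨(x.1, (false, xor x.2.1.1 (x.1.1 || x.1.2)), (false, false), false, false), ?_⟩
  revert hx hi hj
  revert x
  decide +kernel

theorem mem_conjSubgroup_of_mul_eq (hζ : IsPrimitiveRoot ζ 3) {E : Subgroup SylLy}
    {u x y : SylCoord} (h : mul u y = mul x u) (hx : el ζ x ∈ E) :
    el ζ y ∈ conjSubgroup (el ζ u)⁻¹ E := by
  rw [mem_conjSubgroup, inv_inv, ← el_mul hζ, h, el_mul hζ, mul_inv_cancel_right]
  exact hx

theorem le_subgroup_of_forall (hζ : IsPrimitiveRoot ζ 3) {E : Subgroup SylLy}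
    {P : SylCoord → Bool} {hP : IsElemPred P} (h : ∀ x, el ζ x ∈ E → P x) :
    E ≤ subgroup hζ P hP := by
  intro s hs
  obtain ⟨x, rfl⟩ := (el_bijective hζ).2 s
  exact (el_mem_subgroup hζ).2 (h x hs)

theorem conj_elemA_le_subgroup (hζ : IsPrimitiveRoot ζ 3) {E : Subgroup SylLy}
    {P : SylCoord → Bool} {hP : IsElemPred P} (h : ∀ x, el ζ x ∈ E → P (mul cA (mul x cA))) :
    conjSubgroup (el ζ cA) E ≤ subgroup hζ P hP := by
  rintro _ ⟨s, hs, rfl⟩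
  obtain ⟨x, rfl⟩ := (el_bijective hζ).2 s
  have hinv : (el ζ cA)⁻¹ = el ζ cA := inv_eq_of_mul_eq_one_left ((sq_iff hζ).2 rfl)
  change el ζ cA * el ζ x * (el ζ cA)⁻¹ ∈ _
  rw [hinv, mul_assoc, ← el_mul hζ, ← el_mul hζ]
  exact (el_mem_subgroup hζ).2 (h x hs)

/-- Every elementary abelian 2-subgroup is conjugate into one of four. -/
theorem exists_conj_le (hζ : IsPrimitiveRoot ζ 3) {E : Subgroup SylLy} (hE : IsElemAbTwo E) :
    ∃ s, conjSubgroup s E ≤ SylLy.fourI ∨ conjSubgroup s E ≤ SylLy.threeATZ ζ ∨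
      conjSubgroup s E ≤ agz hζ ∨ conjSubgroup s E ≤ xgz hζ := by
  have sq : ∀ s x, el ζ x ∈ conjSubgroup s E → mul x x = one := fun s x hx =>
    (sq_iff hζ).1 (isElemAbTwo_iff.1 (hE.conj s) _ hx)
  have comm : ∀ s x y, el ζ x ∈ conjSubgroup s E → el ζ y ∈ conjSubgroup s E →
      mul x y = mul y x := fun s x y hx hy => (comm_iff hζ).1 ((hE.conj s).1 _ hx _ hy)
  -- If `E` meets the coset of `A`, it may be assumed to contain `A`, whose centralizer consists of
  -- the (0, β, 0)gⁱAʲ. A further involution involving g forces β into F_2, giving ⟨A, g, Z⟩;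
  -- otherwise `E` lies in ⟨A, T, Z⟩.
  by_cases hA : ∃ s x, el ζ x ∈ conjSubgroup s E ∧ x.2.2.2.1 = false ∧ x.2.2.2.2 = true
  · obtain ⟨s, x, hx, hi, hj⟩ := hA
    obtain ⟨u, hu⟩ := exists_mul_cA_eq x (sq s x hx) hi hj
    have hm := mem_conjSubgroup_of_mul_eq hζ hu hx
    rw [conjSubgroup_conjSubgroup] at hm
    refine ⟨(el ζ u)⁻¹ * s, ?_⟩
    generalize (el ζ u)⁻¹ * s = t at hm ⊢
    by_cases hy : ∃ y, el ζ y ∈ conjSubgroup t E ∧ y.2.2.2.1 = true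
    · obtain ⟨y, hy, hyi⟩ := hy
      have hd : ∀ y, mul y cA = mul cA y → y.2.2.2.1 = true → mul y y = one →
          ∀ x, mul x cA = mul cA x → mul x y = mul y x → inAGZ x := by decide +kernel
      exact Or.inr <| Or.inr <| Or.inl <| le_subgroup_of_forall hζ fun z hz =>
        hd y (comm t _ _ hy hm) hyi (sq t y hy) z (comm t _ _ hz hm) (comm t _ _ hz hy)
    · push Not at hy
      have hd : ∀ x, mul x cA = mul cA x → x.2.2.2.1 = false → inATZ x := by decide +kernel
      rw [threeATZ_eq hζ]
      exact Or.inr <| Or.inl <| le_subgroup_of_forall hζ fun z hz =>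
        hd z (comm t _ _ hz hm) (by simpa using hy z hz)
  push Not at hA
  by_cases hG : ∃ s x, el ζ x ∈ conjSubgroup s E ∧ x.2.2.2.1 = true ∧ x.2.2.2.2 = false
  · obtain ⟨s, x, hx, hi, hj⟩ := hG
    obtain ⟨u, hu⟩ := exists_mul_cG_eq x (sq s x hx) hi hj
    have hm := mem_conjSubgroup_of_mul_eq hζ hu hx
    rw [conjSubgroup_conjSubgroup] at hm
    generalize (el ζ u)⁻¹ * s = t at hm
    -- An element over gA multiplied by g would lie over A, a case already excluded.
    have hj : ∀ x, el ζ x ∈ conjSubgroup t E → x.2.2.2.2 = false := by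
      intro x hx
      by_contra hxj
      rw [Bool.not_eq_false] at hxj
      have hxi : x.2.2.2.1 = true := by
        by_contra h
        exact hA t x hx (by simpa using h) hxj
      have h1 := hA t (mul x cG) (by rw [el_mul hζ]; exact mul_mem hx hm)
      simp [mul, cG, hxi, hxj] at h1
    -- Commuting with g puts the entries in F_2. If some γ is nonzero, commuting involutions have α
    -- = 0 throughout, and conjugation by `A` exchanges the roles of α and γ.
    by_cases hy : ∃ y, el ζ y ∈ conjSubgroup t E ∧ y.2.2.1 ≠ (false, false)
    · obtain ⟨y, hy, hyc⟩ := hy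
      have hd : ∀ y, mul y cG = mul cG y → mul y y = one → y.2.2.2.2 = false →
          y.2.2.1 ≠ (false, false) → ∀ x, mul x cG = mul cG x → mul x y = mul y x →
          x.2.2.2.2 = false → mul x x = one → inXGZ (mul cA (mul x cA)) := by decide +kernel
      refine ⟨el ζ cA * t, Or.inr <| Or.inr <| Or.inr ?_⟩
      rw [← conjSubgroup_conjSubgroup]
      exact conj_elemA_le_subgroup hζ fun z hz => hd y (comm t _ _ hy hm) (sq t y hy) (hj y hy) hyc z
        (comm t _ _ hz hm) (comm t _ _ hz hy) (hj z hz) (sq t z hz)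
    · push Not at hy
      have hd : ∀ x, mul x cG = mul cG x → x.2.2.1 = (false, false) → x.2.2.2.2 = false →
          mul x x = one → inXGZ x := by decide +kernel
      exact ⟨t, Or.inr <| Or.inr <| Or.inr <| le_subgroup_of_forall hζ fun z hz =>
        hd z (comm t _ _ hz hm) (hy z hz) (hj z hz) (sq t z hz)⟩
  push Not at hG
  by_cases hGA : ∃ s x, el ζ x ∈ conjSubgroup s E ∧ x.2.2.2.1 = true ∧ x.2.2.2.2 = true
  · obtain ⟨s, x, hx, hi, hj⟩ := hGA
    obtain ⟨u, hu⟩ := exists_mul_cGA_eq x (sq s x hx) hi hj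
    have hm := mem_conjSubgroup_of_mul_eq hζ hu hx
    rw [conjSubgroup_conjSubgroup] at hm
    generalize (el ζ u)⁻¹ * s = t at hm
    have hd : ∀ x, mul x cGA = mul cGA x → mul x x = one → x.2.2.2.1 = x.2.2.2.2 → inAGZ x := by
      decide +kernel
    refine ⟨t, Or.inr <| Or.inr <| Or.inl <| le_subgroup_of_forall hζ fun z hz =>
      hd z (comm t _ _ hz hm) (sq t z hz) ?_⟩
    have h1 := hA t z hz
    have h2 := hG t z hz
    revert h1 h2
    cases z.2.2.2.1 <;> cases z.2.2.2.2 <;> simp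
  push Not at hGA
  have hij : ∀ x, el ζ x ∈ conjSubgroup 1 E → x.2.2.2.1 = false ∧ x.2.2.2.2 = false := by
    intro x hx
    have h1 := hA 1 x hx
    have h2 := hG 1 x hx
    have h3 := hGA 1 x hx
    revert h1 h2 h3
    cases x.2.2.2.1 <;> cases x.2.2.2.2 <;> simp
  rw [fourI_eq hζ]
  -- Now `E` lies in UT_3(4), whose involutions satisfy αγ = 0; one with γ ≠ 0 forces α = 0 on
  -- everything commuting with it in `E`.
  by_cases hy : ∃ y, el ζ y ∈ conjSubgroup 1 E ∧ y.2.2.1 ≠ (false, false)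
  · obtain ⟨y, hy, hyc⟩ := hy
    have hd : ∀ y, y.2.2.2.1 = false → y.2.2.2.2 = false → mul y y = one →
        y.2.2.1 ≠ (false, false) → ∀ x, x.2.2.2.1 = false → x.2.2.2.2 = false → mul x x = one →
        mul x y = mul y x → inFour (mul cA (mul x cA)) := by decide +kernel
    refine ⟨el ζ cA * 1, Or.inl ?_⟩
    rw [← conjSubgroup_conjSubgroup]
    exact conj_elemA_le_subgroup hζ fun z hz => hd y (hij y hy).1 (hij y hy).2 (sq 1 y hy) hyc z
      (hij z hz).1 (hij z hz).2 (sq 1 z hz) (comm 1 _ _ hz hy)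
  · push Not at hy
    have hd : ∀ x, x.2.2.2.1 = false → x.2.2.2.2 = false → x.2.2.1 = (false, false) →
        inFour x := by decide +kernel
    exact ⟨1, Or.inl <| le_subgroup_of_forall hζ fun z hz =>
      hd z (hij z hz).1 (hij z hz).2 (hy z hz)⟩

end SylCoord

end SylSubgroups

/-! ### The embedding of `UT_3(4) : ⟨g, A⟩` in `Spin(10)` -/

section SylSpin

/-- Words in the letters `(i, j)`, standing for the roots `e_i - e_j` of `ℝ^10`. -/
abbrev Word : Type := List (Fin 10 × Fin 10)

namespace SylWord

/-- A word for `(α, 0, 0)`. -/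
def wordA (p : FourCoord) : Word :=
  (if p.1 then [(1, 3), (0, 2), (4, 6), (5, 7)] else []) ++
    if p.2 then [(0, 4), (1, 5), (2, 6), (3, 7)] else []

/-- A word for `(0, β, 0)`. -/
def wordB (p : FourCoord) : Word :=
  (if p.1 then [(0, 1), (2, 3), (0, 1), (2, 3)] else []) ++
    if p.2 then [(2, 3), (0, 1), (4, 5), (6, 7)] else []

/-- A word for `(0, 0, γ)`. -/
def wordC (p : FourCoord) : Word :=
  (if p.1 then [(0, 2), (1, 3), (4, 7), (5, 6)] else []) ++
    if p.2 then [(0, 6), (1, 7), (2, 5), (3, 4)] else []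

/-- A word for `g ^ i`. -/
def wordG (i : Bool) : Word := if i then [(0, 3), (1, 2), (4, 5), (6, 7)] else []

/-- A word for `A ^ j`. -/
def wordH (j : Bool) : Word := if j then [(0, 2), (1, 3), (4, 5), (8, 9)] else []

/-- A word for the element with given coordinates. -/
def word (x : SylCoord) : Word :=
  wordB x.2.1 ++ (wordC x.2.2.1 ++ (wordA x.1 ++ (wordG x.2.2.2.1 ++ wordH x.2.2.2.2)))

/-- Equality of the normal forms of two words. -/
abbrev Equiv (w w' : Word) : Prop :=
  (∀ y ∈ w, y.1 < y.2) ∧ (∀ y ∈ w', y.1 < y.2) ∧ normalForm w = normalForm w'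

theorem wordVal_eq_of_equiv {w w' : Word} (h : Equiv w w') : wordVal w = wordVal w' :=
  wordVal_eq_of_normalForm h

theorem wordA_mul (p q : FourCoord) :
    wordVal (wordA p) * wordVal (wordA q) = wordVal (wordA (p.add q)) := by
  have h : ∀ p q, Equiv (wordA p ++ wordA q) (wordA (p.add q)) := by decide +kernel
  rw [← wordVal_append, wordVal_eq_of_equiv (h p q)]

theorem wordB_mul (p q : FourCoord) :
    wordVal (wordB p) * wordVal (wordB q) = wordVal (wordB (p.add q)) := by
  have h : ∀ p q, Equiv (wordB p ++ wordB q) (wordB (p.add q)) := by decide +kernel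
  rw [← wordVal_append, wordVal_eq_of_equiv (h p q)]

theorem wordC_mul (p q : FourCoord) :
    wordVal (wordC p) * wordVal (wordC q) = wordVal (wordC (p.add q)) := by
  have h : ∀ p q, Equiv (wordC p ++ wordC q) (wordC (p.add q)) := by decide +kernel
  rw [← wordVal_append, wordVal_eq_of_equiv (h p q)]

theorem wordA_mul_wordB (p q : FourCoord) :
    wordVal (wordA p) * wordVal (wordB q) = wordVal (wordB q) * wordVal (wordA p) := by
  have h : ∀ p q, Equiv (wordA p ++ wordB q) (wordB q ++ wordA p) := by decide +kernel
  rw [← wordVal_append, wordVal_eq_of_equiv (h p q), wordVal_append]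

theorem wordC_mul_wordB (p q : FourCoord) :
    wordVal (wordC p) * wordVal (wordB q) = wordVal (wordB q) * wordVal (wordC p) := by
  have h : ∀ p q, Equiv (wordC p ++ wordB q) (wordB q ++ wordC p) := by decide +kernel
  rw [← wordVal_append, wordVal_eq_of_equiv (h p q), wordVal_append]

/-- The commutator relation of UT_3(4): the only relation among the three families of words that
creates a central factor. -/
theorem wordA_mul_wordC (p q : FourCoord) :
    wordVal (wordA p) * wordVal (wordC q) =
      wordVal (wordB (p.mul q)) * (wordVal (wordC q) * wordVal (wordA p)) := by
  have h : ∀ p q, Equiv (wordA p ++ wordC q) (wordB (p.mul q) ++ (wordC q ++ wordA p)) := by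
    decide +kernel
  rw [← wordVal_append, wordVal_eq_of_equiv (h p q), wordVal_append, wordVal_append]

theorem wordG_mul_wordA (i : Bool) (p : FourCoord) :
    wordVal (wordG i) * wordVal (wordA p) =
      wordVal (wordA (if i then p.mul p else p)) * wordVal (wordG i) := by
  have h : ∀ i p, Equiv (wordG i ++ wordA p) (wordA (if i then p.mul p else p) ++ wordG i) := by
    decide +kernel
  rw [← wordVal_append, wordVal_eq_of_equiv (h i p), wordVal_append]

theorem wordG_mul_wordB (i : Bool) (p : FourCoord) :
    wordVal (wordG i) * wordVal (wordB p) =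
      wordVal (wordB (if i then p.mul p else p)) * wordVal (wordG i) := by
  have h : ∀ i p, Equiv (wordG i ++ wordB p) (wordB (if i then p.mul p else p) ++ wordG i) := by
    decide +kernel
  rw [← wordVal_append, wordVal_eq_of_equiv (h i p), wordVal_append]

theorem wordG_mul_wordC (i : Bool) (p : FourCoord) :
    wordVal (wordG i) * wordVal (wordC p) =
      wordVal (wordC (if i then p.mul p else p)) * wordVal (wordG i) := by
  have h : ∀ i p, Equiv (wordG i ++ wordC p) (wordC (if i then p.mul p else p) ++ wordG i) := by
    decide +kernel
  rw [← wordVal_append, wordVal_eq_of_equiv (h i p), wordVal_append]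

theorem wordH_mul_wordA (p : FourCoord) :
    wordVal (wordH true) * wordVal (wordA p) = wordVal (wordC p) * wordVal (wordH true) := by
  have h : ∀ p, Equiv (wordH true ++ wordA p) (wordC p ++ wordH true) := by decide +kernel
  rw [← wordVal_append, wordVal_eq_of_equiv (h p), wordVal_append]

theorem wordH_mul_wordB (p : FourCoord) :
    wordVal (wordH true) * wordVal (wordB p) = wordVal (wordB p) * wordVal (wordH true) := by
  have h : ∀ p, Equiv (wordH true ++ wordB p) (wordB p ++ wordH true) := by decide +kernel
  rw [← wordVal_append, wordVal_eq_of_equiv (h p), wordVal_append]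

theorem wordH_mul_wordC (p : FourCoord) :
    wordVal (wordH true) * wordVal (wordC p) = wordVal (wordA p) * wordVal (wordH true) := by
  have h : ∀ p, Equiv (wordH true ++ wordC p) (wordA p ++ wordH true) := by decide +kernel
  rw [← wordVal_append, wordVal_eq_of_equiv (h p), wordVal_append]

theorem wordGH_mul (i j i' j' : Bool) :
    wordVal (wordG i) * wordVal (wordH j) * (wordVal (wordG i') * wordVal (wordH j')) =
      wordVal (wordG (xor i i')) * wordVal (wordH (xor j j')) := by
  have h : ∀ i j i' j', Equiv ((wordG i ++ wordH j) ++ (wordG i' ++ wordH j'))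
      (wordG (xor i i') ++ wordH (xor j j')) := by decide +kernel
  rw [← wordVal_append, ← wordVal_append, ← wordVal_append, ← wordVal_append,
    wordVal_eq_of_equiv (h i j i' j')]

/-- The value of a word for `(α, β, γ)`. -/
def unipVal (u : FourCoord × FourCoord × FourCoord) : CliffordAlgebra (euclForm 10) :=
  wordVal (wordB u.2.1) * (wordVal (wordC u.2.2) * wordVal (wordA u.1))

/-- The order of the factors reflects (0, β, 0)(0, 0, γ)(α, 0, 0) = (α, β, γ). When two such
products are collected, only α passing γ' contributes, adding αγ' to the middle entry. -/
theorem unipVal_mul (u v : FourCoord × FourCoord × FourCoord) :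
    unipVal u * unipVal v = unipVal (FourCoord.add u.1 v.1,
      FourCoord.add (FourCoord.add u.2.1 v.2.1) (FourCoord.mul u.1 v.2.2),
      FourCoord.add u.2.2 v.2.2) := by
  simp only [unipVal, ← wordA_mul, ← wordB_mul, ← wordC_mul]
  obtain ⟨α, β, γ⟩ := u
  obtain ⟨α', β', γ'⟩ := v
  simp only
  generalize hA : wordVal (wordA α) = A
  generalize hB' : wordVal (wordB β') = B'
  have h1 : A * B' = B' * A := by rw [← hA, ← hB', wordA_mul_wordB]
  have h2 : wordVal (wordC γ) * B' = B' * wordVal (wordC γ) := by rw [← hB', wordC_mul_wordB]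
  have h3 := wordC_mul_wordB γ (α.mul γ')
  have h4 := wordA_mul_wordC α γ'
  rw [hA] at h4
  generalize wordVal (wordC γ) = C at *
  generalize wordVal (wordB (α.mul γ')) = D at *
  generalize wordVal (wordC γ') = C' at *
  generalize wordVal (wordA α') = A' at *
  simp only [mul_assoc]
  congr 1
  rw [← mul_assoc A, h1, mul_assoc, ← mul_assoc C, h2, mul_assoc]
  congr 1
  rw [← mul_assoc A, h4]
  simp only [mul_assoc]
  rw [← mul_assoc C, h3, mul_assoc]

theorem wordG_mul_unipVal (i : Bool) (u : FourCoord × FourCoord × FourCoord) :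
    wordVal (wordG i) * unipVal u = unipVal (SylCoord.act i false u) * wordVal (wordG i) := by
  have h : SylCoord.act i false u = (if i then FourCoord.mul u.1 u.1 else u.1,
      if i then FourCoord.mul u.2.1 u.2.1 else u.2.1,
      if i then FourCoord.mul u.2.2 u.2.2 else u.2.2) := by
    cases i <;> simp [SylCoord.act]
  rw [h, unipVal, unipVal, ← mul_assoc, wordG_mul_wordB, mul_assoc, ← mul_assoc (wordVal (wordG i)),
    wordG_mul_wordC, mul_assoc _ (wordVal (wordG i)), wordG_mul_wordA]
  simp only [mul_assoc]

theorem wordH_mul_unipVal (j : Bool) (u : FourCoord × FourCoord × FourCoord) :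
    wordVal (wordH j) * unipVal u = unipVal (SylCoord.act false j u) * wordVal (wordH j) := by
  cases j
  · simp [SylCoord.act, wordH, wordVal_nil]
  · have hc : ∀ p q, FourCoord.mul p q = FourCoord.mul q p := by decide
    have h : SylCoord.act false true u =
      (u.2.2, FourCoord.add u.2.1 (FourCoord.mul u.2.2 u.1), u.1) := by simp [SylCoord.act, hc]
    rw [h, unipVal, unipVal, ← mul_assoc, wordH_mul_wordB, mul_assoc,
      ← mul_assoc (wordVal (wordH true)), wordH_mul_wordC, mul_assoc _ (wordVal (wordH true)),
      wordH_mul_wordA, ← wordB_mul, ← mul_assoc (wordVal (wordA _)), wordA_mul_wordC]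
    simp only [mul_assoc]

theorem wordVal_word (x : SylCoord) : wordVal (word x) =
    unipVal (x.1, x.2.1, x.2.2.1) * (wordVal (wordG x.2.2.2.1) * wordVal (wordH x.2.2.2.2)) := by
  simp only [word, wordVal_append, unipVal, mul_assoc]

/-- Multiplicativity is deduced from the relations between the five families of words, so that no
check over all pairs of group elements is needed. -/
theorem wordVal_word_mul (x y : SylCoord) :
    wordVal (word (SylCoord.mul x y)) = wordVal (word x) * wordVal (word y) := by
  have h : SylCoord.act x.2.2.2.1 x.2.2.2.2 (y.1, y.2.1, y.2.2.1) =
      SylCoord.act x.2.2.2.1 false (SylCoord.act false x.2.2.2.2 (y.1, y.2.1, y.2.2.1)) := by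
    simp [SylCoord.act]
  rw [wordVal_word, wordVal_word x, wordVal_word y, mul_assoc (unipVal _),
    ← mul_assoc _ (unipVal (y.1, y.2.1, y.2.2.1)), mul_assoc (wordVal (wordG _)) _ (unipVal _),
    wordH_mul_unipVal, ← mul_assoc (wordVal (wordG x.2.2.2.1)) (unipVal _), wordG_mul_unipVal, ← h,
    mul_assoc (unipVal _) (wordVal (wordG _)), mul_assoc (unipVal _), wordGH_mul,
    ← mul_assoc (unipVal (x.1, x.2.1, x.2.2.1)), unipVal_mul]
  rfl

theorem word_valid (x : SylCoord) : (∀ y ∈ word x, y.1 < y.2) ∧ Even (word x).length ∧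
    ∀ y ∈ word x, y.2 < 8 ∨ y = (8, 9) := by
  revert x
  decide +kernel

end SylWord

/-- The element of `Spin(10)` with given coordinates. -/
def sylSpinVal (x : SylCoord) : Spin 10 :=
  ⟨wordVal (SylWord.word x), wordVal_mem_spinGroup (fun y hy => ((SylWord.word_valid x).1 y hy).ne)
    (SylWord.word_valid x).2.1⟩

theorem sylSpinVal_mul (x y : SylCoord) :
    sylSpinVal (SylCoord.mul x y) = sylSpinVal x * sylSpinVal y :=
  Subtype.ext (SylWord.wordVal_word_mul x y)

theorem liesOver_sylSpinVal (x : SylCoord) :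
    LiesOver (sylSpinVal x) (wordPerm (SylWord.word x)) :=
  liesOver_wordPerm rfl (fun y hy => ((SylWord.word_valid x).1 y hy).ne) (SylWord.word_valid x).2.1

/-! ### Permutations of even words: membership in S_8 and in A_n -/

/-- The group `S_8`, embedded in `A_10`, contains every even product of transpositions of the
first eight letters and the transposition of the last two. -/
theorem swap_mul_mem_symEight (j : ℕ) : ∀ (i : ℕ) (hij : i < j) (hj : j < 8),
    Equiv.swap (⟨i, by omega⟩ : Fin 10) ⟨j, by omega⟩ * Equiv.swap 8 9 ∈ symEight := by
  induction j with
  | zero => intro i hij; omega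
  | succ j ih =>
    intro i hij hj
    have hgen : Equiv.swap (⟨j, by omega⟩ : Fin 10) ⟨j + 1, by omega⟩ * Equiv.swap 8 9 ∈ symEight := by
      refine Subgroup.subset_closure ⟨⟨j, by omega⟩, by change j < 7; omega, ?_⟩
      congr 2
      apply Fin.ext
      rw [Fin.val_add]
      simp only [Fin.val_one]
      omega
    rcases Nat.lt_succ_iff_lt_or_eq.1 hij with h | rfl
    · have h1 := ih i h (by omega)
      have hδ : ∀ (a b : ℕ) (ha : a < 8) (hb : b < 8),
          Equiv.swap (8 : Fin 10) 9 * Equiv.swap (⟨a, by omega⟩ : Fin 10) ⟨b, by omega⟩ =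
            Equiv.swap (⟨a, by omega⟩ : Fin 10) ⟨b, by omega⟩ * Equiv.swap 8 9 := by
        intro a b ha hb
        apply (Equiv.Perm.Disjoint.commute _).eq
        intro k
        by_cases hk : k = 8 ∨ k = 9
        · right
          refine Equiv.swap_apply_of_ne_of_ne ?_ ?_ <;> intro h <;> rw [h] at hk <;>
            simp only [Fin.ext_iff] at hk <;> omega
        · left
          exact Equiv.swap_apply_of_ne_of_ne (fun h => hk (Or.inl h)) (fun h => hk (Or.inr h))
      -- Conjugating (i j)(8 9) by (j j+1)(8 9) yields (i j+1)(8 9), the factor (8 9) commuting with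
      -- the rest and having square 1.
      have h2 := mul_mem (mul_mem hgen h1) hgen
      have h3 := hδ i j (by omega) (by omega)
      have h4 := hδ j (j + 1) (by omega) (by omega)
      have h5 : Equiv.swap (8 : Fin 10) 9 * Equiv.swap 8 9 = 1 := Equiv.swap_mul_self 8 9
      have h6 := Equiv.swap_mul_swap_mul_swap (x := (⟨i, by omega⟩ : Fin 10)) (y := ⟨j, by omega⟩)
        (z := ⟨j + 1, by omega⟩) (by simp; omega) (by simp; omega)
      rw [Equiv.swap_comm, ← h6]
      convert h2 using 1
      generalize Equiv.swap (8 : Fin 10) 9 = δ at *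
      generalize Equiv.swap (⟨i, by omega⟩ : Fin 10) ⟨j, by omega⟩ = t at *
      generalize Equiv.swap (⟨j, by omega⟩ : Fin 10) ⟨j + 1, by omega⟩ = s at *
      rw [mul_assoc s δ, ← mul_assoc δ t, h3, mul_assoc t δ, h5, mul_one, mul_assoc (s * t)]
    · exact hgen

theorem swap_mul_mem_symEight' {x : Fin 10 × Fin 10} (h : x.1 < x.2)
    (h' : x.2 < 8 ∨ x = (8, 9)) : Equiv.swap x.1 x.2 * Equiv.swap 8 9 ∈ symEight := by
  rcases h' with h' | rfl
  · exact swap_mul_mem_symEight x.2 x.1 h h'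
  · rw [Equiv.swap_mul_self]
    exact one_mem _

/-- The letters are taken in pairs, and the square of (8 9) is inserted between the two members of a
pair. -/
theorem wordPerm_mem_symEight : ∀ {w : Word}, (∀ y ∈ w, y.1 < y.2) → Even w.length →
    (∀ y ∈ w, y.2 < 8 ∨ y = (8, 9)) → wordPerm w ∈ symEight
  | [], _, _, _ => one_mem _
  | [_], _, h, _ => by simp at h
  | x :: y :: w, h, hl, h' => by
    have hw : wordPerm (x :: y :: w) = (Equiv.swap x.1 x.2 * Equiv.swap 8 9) *
        (Equiv.swap 8 9 * Equiv.swap y.1 y.2) * wordPerm w := by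
      rw [mul_assoc (Equiv.swap x.1 x.2), ← mul_assoc (Equiv.swap (8 : Fin 10) 9),
        Equiv.swap_mul_self, one_mul]
      simp [wordPerm, mul_assoc]
    have hy := inv_mem (swap_mul_mem_symEight' (h y (by simp)) (h' y (by simp)))
    rw [mul_inv_rev, Equiv.swap_inv, Equiv.swap_inv] at hy
    rw [hw]
    exact mul_mem (mul_mem (swap_mul_mem_symEight' (h x (by simp)) (h' x (by simp))) hy)
      (wordPerm_mem_symEight (fun z hz => h z (by simp [hz]))
        (by simpa [Nat.even_add_one] using hl) (fun z hz => h' z (by simp [hz])))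

/-- Each generator exchanges 8 and 9. Invariance of this pair is what keeps an element of order 3
out of the Weyl group in 2S_8. -/
theorem symEight_apply {σ : Equiv.Perm (Fin 10)} (h : σ ∈ symEight) :
    (σ 8 = 8 ∧ σ 9 = 9) ∨ (σ 8 = 9 ∧ σ 9 = 8) := by
  induction h using Subgroup.closure_induction with
  | mem σ h =>
    obtain ⟨i, hi, rfl⟩ := h
    right
    revert hi
    revert i
    decide
  | one => simp
  | mul σ τ _ _ h h' =>
    rcases h with ⟨h1, h2⟩ | ⟨h1, h2⟩ <;> rcases h' with ⟨h3, h4⟩ | ⟨h3, h4⟩ <;>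
      simp [Equiv.Perm.mul_apply, h1, h2, h3, h4]
  | inv σ _ h =>
    simp only [Equiv.Perm.inv_eq_iff_eq]
    rcases h with ⟨h1, h2⟩ | ⟨h1, h2⟩ <;> simp [h1, h2]

theorem sign_wordPerm {n : ℕ} {w : List (Fin n × Fin n)} (h : ∀ y ∈ w, y.1 ≠ y.2) :
    Equiv.Perm.sign (wordPerm w) = (-1) ^ w.length := by
  induction w with
  | nil => simp [wordPerm]
  | cons x w ih =>
    have hw : wordPerm (x :: w) = Equiv.swap x.1 x.2 * wordPerm w := by simp [wordPerm]
    rw [hw, Equiv.Perm.sign_mul, Equiv.Perm.sign_swap (h x (by simp)),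
      ih fun y hy => h y (by simp [hy]), List.length_cons, pow_succ, mul_comm]

theorem wordPerm_mem_alternatingGroup {n : ℕ} {w : List (Fin n × Fin n)}
    (h : ∀ y ∈ w, y.1 ≠ y.2) (hl : Even w.length) : wordPerm w ∈ alternatingGroup (Fin n) := by
  rw [Equiv.Perm.mem_alternatingGroup, sign_wordPerm h, hl.neg_one_pow]

/-! ### The projection to permutations -/

section SpinPerm

variable {n : ℕ} {Γ : Subgroup (Equiv.Perm (Fin n))}

/-- The projection from the preimage of a permutation group in `Spin(n)`. -/
def spinPerm (Γ : Subgroup (Equiv.Perm (Fin n))) : spinPreimage Γ →* Equiv.Perm (Fin n) :=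
  MonoidHom.mk' (fun x => x.2.choose) fun x y =>
    (x * y).2.choose_spec.2.unique (x.2.choose_spec.2.mul y.2.choose_spec.2)

theorem spinPerm_mem (x : spinPreimage Γ) : spinPerm Γ x ∈ Γ := x.2.choose_spec.1

theorem liesOver_spinPerm (x : spinPreimage Γ) : LiesOver (x : Spin n) (spinPerm Γ x) :=
  x.2.choose_spec.2

theorem spinPerm_eq {x : spinPreimage Γ} {σ : Equiv.Perm (Fin n)} (h : LiesOver (x : Spin n) σ) :
    spinPerm Γ x = σ := (liesOver_spinPerm x).unique h

/-- The element `-1` of a spin preimage. -/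
def preimageNegOne (Γ : Subgroup (Equiv.Perm (Fin n))) [NeZero n] : spinPreimage Γ :=
  ⟨spinNegOne n, 1, one_mem _, liesOver_spinNegOne⟩

theorem spinPerm_eq_one_iff [NeZero n] {x : spinPreimage Γ} :
    spinPerm Γ x = 1 ↔ x = 1 ∨ x = preimageNegOne Γ := by
  constructor
  · intro h
    have h1 := liesOver_spinPerm x
    rw [h] at h1
    rcases h1.eq_one_or with h2 | h2
    · exact Or.inl (Subtype.ext h2)
    · exact Or.inr (Subtype.ext h2)
  · rintro (rfl | rfl)
    · exact map_one _
    · exact spinPerm_eq liesOver_spinNegOne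

theorem exists_word (σ : Equiv.Perm (Fin n)) :
    ∃ w : List (Fin n × Fin n), (∀ y ∈ w, y.1 ≠ y.2) ∧ wordPerm w = σ := by
  induction σ using Equiv.Perm.swap_induction_on with
  | one => exact ⟨[], by simp, rfl⟩
  | swap_mul σ i j hij h =>
    obtain ⟨w, hw, rfl⟩ := h
    exact ⟨(i, j) :: w, by simpa [hij] using hw, by simp [wordPerm]⟩

theorem exists_even_word {σ : Equiv.Perm (Fin n)} (h : σ ∈ alternatingGroup (Fin n)) :
    ∃ w : List (Fin n × Fin n), (∀ y ∈ w, y.1 ≠ y.2) ∧ Even w.length ∧ wordPerm w = σ := by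
  obtain ⟨w, hw, rfl⟩ := exists_word σ
  refine ⟨w, hw, ?_, rfl⟩
  rw [Equiv.Perm.mem_alternatingGroup, sign_wordPerm hw] at h
  by_contra hn
  rw [Nat.not_even_iff_odd] at hn
  rw [hn.neg_one_pow] at h
  exact absurd h (by decide)

/-- The element of `2A_n` given by a word of even length. -/
def wordAlt (w : List (Fin n × Fin n)) (hw : ∀ y ∈ w, y.1 ≠ y.2) (hl : Even w.length) :
    TwoAlt n :=
  ⟨⟨wordVal w, wordVal_mem_spinGroup hw hl⟩, _, wordPerm_mem_alternatingGroup hw hl,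
    liesOver_wordPerm rfl hw hl⟩

theorem spinPerm_wordAlt {w : List (Fin n × Fin n)} (hw : ∀ y ∈ w, y.1 ≠ y.2)
    (hl : Even w.length) : spinPerm _ (wordAlt w hw hl) = wordPerm w :=
  spinPerm_eq (liesOver_wordPerm rfl hw hl)

theorem exists_spinPerm_eq {σ : Equiv.Perm (Fin n)} (h : σ ∈ alternatingGroup (Fin n)) :
    ∃ x : TwoAlt n, spinPerm _ x = σ := by
  obtain ⟨w, hw, hl, rfl⟩ := exists_even_word h
  exact ⟨_, spinPerm_wordAlt hw hl⟩

theorem card_twoAlt [NeZero n] [Nontrivial (Fin n)] : Nat.card (TwoAlt n) = n.factorial := by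
  have h1 := Subgroup.card_eq_card_quotient_mul_card_subgroup
    (spinPerm (alternatingGroup (Fin n))).ker
  rw [Nat.card_congr (QuotientGroup.quotientKerEquivRange _).toEquiv] at h1
  have h2 : (spinPerm (alternatingGroup (Fin n))).range = alternatingGroup (Fin n) := by
    apply le_antisymm
    · rintro _ ⟨x, rfl⟩
      exact spinPerm_mem x
    · exact fun σ hσ => exists_spinPerm_eq hσ
  have h3 : Nat.card (spinPerm (alternatingGroup (Fin n))).ker = 2 := by
    have hs : ((spinPerm (alternatingGroup (Fin n))).ker : Set (TwoAlt n)) =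
        {1, preimageNegOne _} := by
      ext x
      rw [SetLike.mem_coe, MonoidHom.mem_ker, spinPerm_eq_one_iff]
      rfl
    have := Set.ncard_pair (a := (1 : TwoAlt n)) (b := preimageNegOne _)
      (fun h => spinNegOne_ne_one (congrArg Subtype.val h).symm)
    rw [← hs] at this
    exact this
  rw [h2, h3, mul_comm, Nat.card_eq_fintype_card (α := alternatingGroup (Fin n)),
    two_mul_card_alternatingGroup, Fintype.card_perm, Fintype.card_fin] at h1
  exact h1

end SpinPerm

/-! ### The embedding -/

/-- The element of `2S_8` with given coordinates. -/
def sylVal (x : SylCoord) : twoSymEight :=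
  ⟨⟨sylSpinVal x, _, wordPerm_mem_alternatingGroup
      (fun y hy => ((SylWord.word_valid x).1 y hy).ne) (SylWord.word_valid x).2.1,
      liesOver_sylSpinVal x⟩, Subgroup.mem_subgroupOf.2 ⟨_, wordPerm_mem_symEight
      (SylWord.word_valid x).1 (SylWord.word_valid x).2.1 (SylWord.word_valid x).2.2,
      liesOver_sylSpinVal x⟩⟩

/-- The embedding of `UT_3(4) : ⟨g, A⟩` in `2S_8`. -/
def sylHom {ζ : F4} (hζ : IsPrimitiveRoot ζ 3) : SylLy →* twoSymEight :=
  MonoidHom.mk' (fun s => sylVal ((Equiv.ofBijective _ (SylCoord.el_bijective hζ)).symm s)) <| by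
    intro s t
    obtain ⟨x, rfl⟩ := (SylCoord.el_bijective hζ).2 s
    obtain ⟨y, rfl⟩ := (SylCoord.el_bijective hζ).2 t
    rw [← SylCoord.el_mul hζ, Equiv.ofBijective_symm_apply_apply,
      Equiv.ofBijective_symm_apply_apply, Equiv.ofBijective_symm_apply_apply]
    exact Subtype.ext (Subtype.ext (sylSpinVal_mul x y))

theorem sylHom_el {ζ : F4} (hζ : IsPrimitiveRoot ζ 3) (x : SylCoord) :
    sylHom hζ (SylCoord.el ζ x) = sylVal x :=
  congrArg sylVal (Equiv.ofBijective_symm_apply_apply _ _ x)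

/-- The permutation of an element of `2S_8`. -/
def symPerm : twoSymEight →* Equiv.Perm (Fin 10) := (spinPerm _).comp twoSymEight.subtype

theorem symPerm_sylVal (x : SylCoord) : symPerm (sylVal x) = wordPerm (SylWord.word x) :=
  spinPerm_eq (liesOver_sylSpinVal x)

end SylSpin

/-! ### Fusion in `2S_8` and `2A_10` -/

section Fusion

open SylCoord

variable {ζ : F4}

/-- The permutation with given coordinates. -/
def sylPerm (x : SylCoord) : Equiv.Perm (Fin 10) := wordPerm (SylWord.word x)

theorem sylPerm_eq_one {x : SylCoord} (h : sylPerm x = 1) : x = one ∨ x = cZ := by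
  have hd : ∀ x, (sylPerm x 0 = 0 ∧ sylPerm x 1 = 1 ∧ sylPerm x 2 = 2 ∧ sylPerm x 4 = 4 ∧
    sylPerm x 6 = 6) → x = one ∨ x = cZ := by decide +kernel
  exact hd x (by simp [h])

/-- The central involution of `2S_8`. -/
def symNegOne : twoSymEight :=
  ⟨preimageNegOne _, Subgroup.mem_subgroupOf.2 ⟨1, one_mem _, liesOver_spinNegOne⟩⟩

/-- The word of Z has the form abab for orthogonal unit vectors a and b, which anticommute; its
value is therefore -1. -/
theorem sylVal_cZ : sylVal cZ = symNegOne := by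
  refine Subtype.ext (Subtype.ext (Subtype.ext ?_))
  change wordVal (SylWord.word cZ) = -1
  have h : signedVal (normalForm (SylWord.word cZ)) = wordVal (SylWord.word cZ) :=
    (normalForm_spec _ (SylWord.word_valid cZ).1).1
  have h' : normalForm (SylWord.word cZ) = (true, []) := by decide +kernel
  rw [← h, h']
  simp [signedVal, wordVal]

theorem sylHom_injective (hζ : IsPrimitiveRoot ζ 3) : Function.Injective (sylHom hζ) := by
  rw [injective_iff_map_eq_one]
  intro s hs
  obtain ⟨x, rfl⟩ := (el_bijective hζ).2 s
  rw [sylHom_el] at hs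
  have h1 : sylPerm x = 1 := by
    have := symPerm_sylVal x
    rw [hs, map_one] at this
    exact this.symm
  rcases sylPerm_eq_one h1 with rfl | rfl
  · exact el_one
  · rw [sylVal_cZ] at hs
    exact absurd (congrArg (fun t : twoSymEight => (t : TwoAlt 10).1) hs) spinNegOne_ne_one

/-- A group over a permutation group of ten letters containing the image of `UT_3(4) : ⟨g, A⟩`,
such that the kernel of the projection is the image of `⟨Z⟩`. -/
structure SylOver (hζ : IsPrimitiveRoot ζ 3) {G : Type*} [Group G] (f : SylLy →* G)
    (ψ : G →* Equiv.Perm (Fin 10)) : Prop where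
  injective : Function.Injective f
  map_el : ∀ x, ψ (f (el ζ x)) = sylPerm x
  ker : ∀ x, ψ x = 1 → x = 1 ∨ x = f SylLy.elemZ

theorem sylOver_sym (hζ : IsPrimitiveRoot ζ 3) : SylOver hζ (sylHom hζ) symPerm where
  injective := sylHom_injective hζ
  map_el x := by rw [sylHom_el, symPerm_sylVal, sylPerm]
  ker x hx := by
    rw [← el_cZ (ζ := ζ), sylHom_el, sylVal_cZ]
    rcases spinPerm_eq_one_iff.1 hx with h | h
    · exact Or.inl (Subtype.ext h)
    · exact Or.inr (Subtype.ext h)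

theorem sylOver_alt (hζ : IsPrimitiveRoot ζ 3) :
    SylOver hζ (twoSymEight.subtype.comp (sylHom hζ)) (spinPerm (alternatingGroup (Fin 10))) where
  injective := (Subgroup.subtype_injective _).comp (sylHom_injective hζ)
  map_el x := (sylOver_sym hζ).map_el x
  ker x hx := by
    rw [← el_cZ (ζ := ζ), MonoidHom.comp_apply, sylHom_el, sylVal_cZ]
    exact spinPerm_eq_one_iff.1 hx

namespace SylOver

variable {hζ : IsPrimitiveRoot ζ 3} {G : Type*} [Group G] {f : SylLy →* G}
  {ψ : G →* Equiv.Perm (Fin 10)}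

theorem eq_or (h : SylOver hζ f ψ) {x : G} {y : SylCoord} (hx : ψ x = sylPerm y) :
    x = f (el ζ y) ∨ x = f (el ζ (SylCoord.mul cZ y)) := by
  have h1 : ψ (x * (f (el ζ y))⁻¹) = 1 := by
    rw [map_mul, map_inv, h.map_el, hx, mul_inv_cancel]
  rcases h.ker _ h1 with h2 | h2
  · exact Or.inl (mul_inv_eq_one.1 h2)
  · right
    rw [el_mul hζ, map_mul, el_cZ, ← h2, inv_mul_cancel_right]

/-- A subgroup containing Z is the full preimage of its permutations, so conjugation of such
subgroups can be checked on ten letters without tracking signs. -/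
theorem mem_map_iff (h : SylOver hζ f ψ) {P : SylCoord → Bool} {hP : IsElemPred P} (hZ : P cZ)
    {x : G} : x ∈ (subgroup hζ P hP).map f ↔ ∃ y, P y ∧ ψ x = sylPerm y := by
  constructor
  · rintro ⟨_, ⟨y, hy, rfl⟩, rfl⟩
    exact ⟨y, hy, h.map_el y⟩
  · rintro ⟨y, hy, hxy⟩
    rcases h.eq_or hxy with rfl | rfl
    · exact ⟨_, ⟨y, hy, rfl⟩, rfl⟩
    · exact ⟨_, ⟨_, hP.2.1 _ hZ y hy, rfl⟩, rfl⟩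

theorem conjSubgroup_map_le (h : SylOver hζ f ψ) {P P' : SylCoord → Bool} {hP : IsElemPred P}
    {hP' : IsElemPred P'} (hZ : P' cZ) {x : G} (τ : SylCoord → SylCoord)
    (hτ : ∀ y, P y → P' (τ y) ∧ ψ x * sylPerm y = sylPerm (τ y) * ψ x) :
    conjSubgroup x ((subgroup hζ P hP).map f) ≤ (subgroup hζ P' hP').map f := by
  rintro _ ⟨_, ⟨_, ⟨y, hy, rfl⟩, rfl⟩, rfl⟩
  rw [h.mem_map_iff hZ]
  refine ⟨τ y, (hτ y hy).1, ?_⟩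
  change ψ (x * f (el ζ y) * x⁻¹) = _
  rw [map_mul, map_mul, map_inv, h.map_el, (hτ y hy).2, mul_inv_cancel_right]

/-- The elements commuting with `A` and `T` are those of `⟨A, T, Z⟩`. -/
theorem mem_of_commute (h : SylOver hζ f ψ) (hψ : ∀ x, ψ x ∈ alternatingGroup (Fin 10)) {x : G}
    (hA : x * f SylLy.elemA = f SylLy.elemA * x)
    (hT : x * f (SylLy.elemT ζ) = f (SylLy.elemT ζ) * x) :
    x ∈ (SylLy.threeATZ ζ).map f := by
  have hA' : ∀ k, ψ x (sylPerm cA k) = sylPerm cA (ψ x k) := by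
    intro k
    have := congrArg ψ hA
    rw [← el_cA (ζ := ζ), map_mul, map_mul, h.map_el] at this
    exact Equiv.congr_fun this k
  have hT' : ∀ k, ψ x (sylPerm cT k) = sylPerm cT (ψ x k) := by
    intro k
    have := congrArg ψ hT
    rw [← el_cT, map_mul, map_mul, h.map_el] at this
    exact Equiv.congr_fun this k
  -- The permutations a and t of A and T make {0, 1, 2, 3} a regular orbit, while {4, 5}, {6, 7},
  -- {8, 9} are the fixed points of at, a, t. A permutation commuting with both preserves these four
  -- sets and is determined by the images of 0, 4, 6, up to (8 9), which parity excludes.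
  have fix : ∀ ρ : Equiv.Perm (Fin 10), (∀ k, ρ (sylPerm cA k) = sylPerm cA (ρ k)) →
      (∀ k, ρ (sylPerm cT k) = sylPerm cT (ρ k)) → ρ 0 = 0 → ρ 4 = 4 → ρ 6 = 6 →
      ρ ∈ alternatingGroup (Fin 10) → ρ = 1 := by
    intro ρ h1 h2 h0 h4 h6 hρ
    have e1 := h2 0
    have e2 := h1 0
    have e3 := h2 2
    have e5 := h1 4
    have e7 := h2 6
    have d1 : sylPerm cT 0 = 1 := by decide +kernel
    have d2 : sylPerm cA 0 = 2 := by decide +kernel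
    have d3 : sylPerm cT 2 = 3 := by decide +kernel
    have d5 : sylPerm cA 4 = 5 := by decide +kernel
    have d7 : sylPerm cT 6 = 7 := by decide +kernel
    rw [h0, d1] at e1
    rw [h0, d2] at e2
    rw [e2, d3] at e3
    rw [h4, d5] at e5
    rw [h6, d7] at e7
    have h89 : ρ = 1 ∨ ρ = Equiv.swap 8 9 := by
      have hinj := ρ.injective
      have hne : ∀ k l : Fin 10, ρ k = k → l ≠ k → ρ l ≠ k := fun k l hk hl h' =>
        hl (hinj (h'.trans hk.symm))
      have key : ∀ m l : Fin 10, (l = 8 ∨ l = 9) → ρ l = m → m = 8 ∨ m = 9 := by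
        intro m l hl hm
        subst hm
        have hl8 : ∀ k : Fin 10, k < 8 → l ≠ k := by
          rintro k hk rfl
          rcases hl with rfl | rfl <;> exact absurd hk (by decide)
        have q0 := hne 0 l h0 (hl8 0 (by decide))
        have q1 := hne 1 l e1 (hl8 1 (by decide))
        have q2 := hne 2 l e2 (hl8 2 (by decide))
        have q3 := hne 3 l e3 (hl8 3 (by decide))
        have q4 := hne 4 l h4 (hl8 4 (by decide))
        have q5 := hne 5 l e5 (hl8 5 (by decide))
        have q6 := hne 6 l h6 (hl8 6 (by decide))
        have q7 := hne 7 l e7 (hl8 7 (by decide))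
        generalize ρ l = m at *
        revert m
        decide
      have ext10 : ∀ τ : Equiv.Perm (Fin 10), τ 0 = 0 → τ 1 = 1 → τ 2 = 2 → τ 3 = 3 → τ 4 = 4 →
          τ 5 = 5 → τ 6 = 6 → τ 7 = 7 → ρ 8 = τ 8 → ρ 9 = τ 9 → ρ = τ := by
        intro τ t0 t1 t2 t3 t4 t5 t6 t7 t8 t9
        ext k
        congr 1
        fin_cases k
        · exact h0.trans t0.symm
        · exact e1.trans t1.symm
        · exact e2.trans t2.symm
        · exact e3.trans t3.symm
        · exact h4.trans t4.symm
        · exact e5.trans t5.symm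
        · exact h6.trans t6.symm
        · exact e7.trans t7.symm
        · exact t8
        · exact t9
      rcases key _ 8 (Or.inl rfl) rfl with h8 | h8 <;> rcases key _ 9 (Or.inr rfl) rfl with h9 | h9
      · exact absurd (hinj (h8.trans h9.symm)) (by decide)
      · left; apply ext10 <;> first | rfl | assumption
      · right; apply ext10 <;> first | decide | assumption
      · exact absurd (hinj (h8.trans h9.symm)) (by decide)
    rcases h89 with rfl | rfl
    · rfl
    · rw [Equiv.Perm.mem_alternatingGroup, Equiv.Perm.sign_swap (by decide)] at hρ
      exact absurd hρ (by decide)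
  have h0 : ∀ k, sylPerm cA k ≠ k → sylPerm cT k ≠ k → sylPerm cA (sylPerm cT k) ≠ k →
      k = 0 ∨ k = 1 ∨ k = 2 ∨ k = 3 := by decide +kernel
  have h4 : ∀ k, sylPerm cA (sylPerm cT k) = k → k = 4 ∨ k = 5 := by decide +kernel
  have h6 : ∀ k, sylPerm cA k = k → k = 6 ∨ k = 7 := by decide +kernel
  have k0 := h0 (ψ x 0) (by rw [← hA', (ψ x).injective.ne_iff]; decide +kernel)
    (by rw [← hT', (ψ x).injective.ne_iff]; decide +kernel)
    (by rw [← hT', ← hA', (ψ x).injective.ne_iff]; decide +kernel)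
  have k4 := h4 (ψ x 4) (by rw [← hT', ← hA', (ψ x).injective.eq_iff]; decide +kernel)
  have k6 := h6 (ψ x 6) (by rw [← hA', (ψ x).injective.eq_iff]; decide +kernel)
  -- All 4 · 2 · 2 possible images are attained by elements of S, so the element lies in the image
  -- of S and the centralizer computed there suffices.
  have hex : ∀ a b c : Fin 10, (a = 0 ∨ a = 1 ∨ a = 2 ∨ a = 3) → (b = 4 ∨ b = 5) →
      (c = 6 ∨ c = 7) → ∃ p q i j : Bool,
      sylPerm ((p, false), (false, q), (p, false), i, j) 0 = a ∧
      sylPerm ((p, false), (false, q), (p, false), i, j) 4 = b ∧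
      sylPerm ((p, false), (false, q), (p, false), i, j) 6 = c := by decide +kernel
  have hcA : ∀ p q i j k, sylPerm ((p, false), (false, q), (p, false), i, j) (sylPerm cA k) =
    sylPerm cA (sylPerm ((p, false), (false, q), (p, false), i, j) k) := by decide +kernel
  have hcT : ∀ p q i j k, sylPerm ((p, false), (false, q), (p, false), i, j) (sylPerm cT k) =
    sylPerm cT (sylPerm ((p, false), (false, q), (p, false), i, j) k) := by decide +kernel
  obtain ⟨p, q, i, j, e0, e4, e6⟩ := hex _ _ _ k0 k4 k6
  specialize hcA p q i j
  specialize hcT p q i j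
  generalize hy : (((p, false), (false, q), (p, false), i, j) : SylCoord) = y at *
  have hρ : (sylPerm y)⁻¹ * ψ x = 1 := by
    apply fix
    · intro k
      rw [Equiv.Perm.mul_apply, Equiv.Perm.mul_apply, hA', Equiv.Perm.inv_eq_iff_eq, hcA]
      exact congrArg _ ((sylPerm y).apply_symm_apply _).symm
    · intro k
      rw [Equiv.Perm.mul_apply, Equiv.Perm.mul_apply, hT', Equiv.Perm.inv_eq_iff_eq, hcT]
      exact congrArg _ ((sylPerm y).apply_symm_apply _).symm
    · rw [Equiv.Perm.mul_apply, Equiv.Perm.inv_eq_iff_eq, e0]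
    · rw [Equiv.Perm.mul_apply, Equiv.Perm.inv_eq_iff_eq, e4]
    · rw [Equiv.Perm.mul_apply, Equiv.Perm.inv_eq_iff_eq, e6]
    · exact mul_mem (inv_mem (by rw [← h.map_el]; exact hψ _)) (hψ x)
  have hxr : x ∈ f.range := by
    rcases h.eq_or (inv_mul_eq_one.1 hρ).symm with h1 | h1 <;> exact ⟨_, h1.symm⟩
  obtain ⟨s, rfl⟩ := hxr
  rw [← map_mul, ← map_mul] at hA hT
  exact ⟨s, centralizer_threeATZ hζ (h.injective hA) (h.injective hT), rfl⟩

end SylOver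

theorem spinPerm_mem_alt (x : TwoAlt 10) :
    spinPerm (alternatingGroup (Fin 10)) x ∈ alternatingGroup (Fin 10) := spinPerm_mem x

theorem symPerm_mem_alt (x : twoSymEight) : symPerm x ∈ alternatingGroup (Fin 10) :=
  spinPerm_mem (x : TwoAlt 10)

theorem symPerm_mem (x : twoSymEight) : symPerm x ∈ symEight := by
  obtain ⟨σ, hσ, h⟩ := Subgroup.mem_subgroupOf.1 x.2
  rwa [show symPerm x = σ from spinPerm_eq h]

/-- An element of `2S_8` lying over the product of the transpositions `(1, 3)` and `(8, 9)`. -/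
def fuseElem : twoSymEight :=
  ⟨⟨⟨wordVal [(1, 3), (8, 9)], wordVal_mem_spinGroup (by decide) (by decide)⟩, _,
    wordPerm_mem_alternatingGroup (w := [(1, 3), (8, 9)]) (by decide) (by decide),
    liesOver_wordPerm rfl (by decide) (by decide)⟩, Subgroup.mem_subgroupOf.2 ⟨_,
    wordPerm_mem_symEight (w := [(1, 3), (8, 9)]) (by decide) (by decide) (by decide),
    liesOver_wordPerm rfl (by decide) (by decide)⟩⟩

theorem symPerm_fuseElem : symPerm fuseElem = wordPerm [(1, 3), (8, 9)] :=
  spinPerm_eq (liesOver_wordPerm rfl (by decide) (by decide))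

/-- The transposition (1 3) carries (0 3)(1 2)(4 5)(6 7), under g, to (0 1)(2 3)(4 5)(6 7), under T,
and commutes with the permutation (0 2)(1 3)(4 5)(8 9) of A; (8 9) only corrects the parity. -/
theorem conj_agz_le (hζ : IsPrimitiveRoot ζ 3) :
    conjSubgroup fuseElem ((agz hζ).map (sylHom hζ)) ≤ (SylLy.threeATZ ζ).map (sylHom hζ) := by
  rw [threeATZ_eq hζ]
  refine (sylOver_sym hζ).conjSubgroup_map_le rfl (fun y => ((false, false),
    (y.2.1.1, y.2.2.2.1), (false, false), false, y.2.2.2.2)) ?_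
  rw [symPerm_fuseElem]
  decide +kernel

/-- The same element works because (1 3) also commutes with (0 2)(1 3)(4 6)(5 7), the permutation of
(1, 0, 0). The image is the proper subgroup ⟨(1, 0, 0), T, Z⟩ of 2^4. -/
theorem conj_xgz_le (hζ : IsPrimitiveRoot ζ 3) :
    conjSubgroup fuseElem ((xgz hζ).map (sylHom hζ)) ≤ SylLy.fourI.map (sylHom hζ) := by
  rw [fourI_eq hζ]
  refine (sylOver_sym hζ).conjSubgroup_map_le rfl (fun y => ((y.1.1, false),
    (y.2.1.1, y.2.2.2.1), (false, false), false, false)) ?_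
  rw [symPerm_fuseElem]
  decide +kernel

end Fusion

/-! ### Maximal elementary abelian subgroups of groups with this Sylow 2-subgroup -/

section Classification

open SylCoord

variable {ζ : F4}

theorem finite_sylLy (hζ : IsPrimitiveRoot ζ 3) : Finite SylLy :=
  Nat.finite_of_card_ne_zero (by rw [card_sylLy hζ]; norm_num)

theorem isElemAbTwo_fourI (hζ : IsPrimitiveRoot ζ 3) : IsElemAbTwo SylLy.fourI := by
  rw [fourI_eq hζ]; exact isElemAbTwo_subgroup hζ _

theorem isElemAbTwo_threeATZ (hζ : IsPrimitiveRoot ζ 3) : IsElemAbTwo (SylLy.threeATZ ζ) := by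
  rw [threeATZ_eq hζ]; exact isElemAbTwo_subgroup hζ _

theorem elemA_mem (ζ : F4) : SylLy.elemA ∈ SylLy.threeATZ ζ := Subgroup.subset_closure (by simp)

theorem elemT_mem (ζ : F4) : SylLy.elemT ζ ∈ SylLy.threeATZ ζ := Subgroup.subset_closure (by simp)

theorem eq_of_le_of_card_le {G : Type*} [Group G] [Finite G] {H K : Subgroup G} (h : H ≤ K)
    (hc : Nat.card K ≤ Nat.card H) : H = K := Subgroup.eq_of_le_of_card_ge h hc

/-- Elementary abelian 2-subgroups have order at most 16. -/
theorem card_le_of_isElemAbTwo (hζ : IsPrimitiveRoot ζ 3) {E : Subgroup SylLy}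
    (hE : IsElemAbTwo E) : Nat.card E ≤ 2 ^ 4 := by
  have := finite_sylLy hζ
  obtain ⟨s, hs⟩ := exists_conj_le hζ hE
  rw [← card_conjSubgroup s E]
  rcases hs with h | h | h | h <;> refine (Subgroup.card_le_of_le h).trans ?_
  · rw [card_fourI hζ]
  · rw [card_threeATZ hζ]; norm_num
  · rw [card_agz hζ]; norm_num
  · rw [card_xgz hζ]; norm_num

/-- Elementary abelian 2-subgroups of order 16 are conjugate to `2^4`. -/
theorem areConj_fourI_of_card (hζ : IsPrimitiveRoot ζ 3) {E : Subgroup SylLy}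
    (hE : IsElemAbTwo E) (hc : Nat.card E = 2 ^ 4) : AreConj SylLy.fourI E := by
  have := finite_sylLy hζ
  obtain ⟨s, hs⟩ := exists_conj_le hζ hE
  rw [← card_conjSubgroup s E] at hc
  rcases hs with h | h | h | h
  · exact AreConj.symm ⟨s, eq_of_le_of_card_le h (by rw [card_fourI hζ, hc])⟩
  · have := Subgroup.card_le_of_le h
    rw [hc, card_threeATZ hζ] at this
    norm_num at this
  · have := Subgroup.card_le_of_le h
    rw [hc, card_agz hζ] at this
    norm_num at this
  · have := Subgroup.card_le_of_le h
    rw [hc, card_xgz hζ] at this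
    norm_num at this

theorem isMaxElemAbTwo_threeATZ (hζ : IsPrimitiveRoot ζ 3) :
    IsMaxElemAbTwo (SylLy.threeATZ ζ) := by
  have h := isElemAbTwo_threeATZ hζ
  refine isMaxElemAbTwo_of_centralizer h (le_antisymm ?_ ?_)
  · intro s hs
    rw [Subgroup.mem_centralizer_iff] at hs
    exact centralizer_threeATZ hζ (hs _ (elemA_mem ζ)).symm (hs _ (elemT_mem ζ)).symm
  · intro s hs
    rw [Subgroup.mem_centralizer_iff]
    exact fun t ht => h.1 t ht s hs

theorem areConj_map_fourI (hζ : IsPrimitiveRoot ζ 3) (φ : SylLy ≃* SylLy) :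
    AreConj SylLy.fourI (SylLy.fourI.map φ.toMonoidHom) := by
  refine areConj_fourI_of_card hζ ((isElemAbTwo_fourI hζ).map _) ?_
  rw [← card_fourI hζ]
  exact Nat.card_congr (SylLy.fourI.equivMapOfInjective _ φ.injective).symm.toEquiv

/-- The image is maximal of order 8, hence conjugate to ⟨A, T, Z⟩, ⟨A, g, Z⟩ or ⟨(1, 0, 0), g, Z⟩.
It contains T because φ preserves the class, and so the normal core, of 2^4; no conjugate of the
last two contains T, whose only conjugates are T and TZ. -/
theorem areConj_map_threeATZ (hζ : IsPrimitiveRoot ζ 3) (φ : SylLy ≃* SylLy) :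
    AreConj (SylLy.threeATZ ζ) ((SylLy.threeATZ ζ).map φ.toMonoidHom) := by
  have := finite_sylLy hζ
  have hc : Nat.card ((SylLy.threeATZ ζ).map φ.toMonoidHom) = 2 ^ 3 := by
    rw [← card_threeATZ hζ]
    exact Nat.card_congr ((SylLy.threeATZ ζ).equivMapOfInjective _ φ.injective).symm.toEquiv
  have hmax : IsMaxElemAbTwo ((SylLy.threeATZ ζ).map φ.toMonoidHom) := by
    refine IsMaxElemAbTwo.of_map (f := φ.symm.toMonoidHom) φ.symm.injective ?_
    have h1 : ((SylLy.threeATZ ζ).map φ.toMonoidHom).map φ.symm.toMonoidHom =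
        SylLy.threeATZ ζ := by
      rw [Subgroup.map_map]
      convert Subgroup.map_id _
      ext s <;> simp
    rw [h1]
    exact isMaxElemAbTwo_threeATZ hζ
  have hT : SylLy.elemT ζ ∈ (SylLy.threeATZ ζ).map φ.toMonoidHom := by
    refine ⟨φ.symm (SylLy.elemT ζ), normalCore_fourI_le hζ ?_, by simp⟩
    intro t
    obtain ⟨s, hs⟩ := areConj_map_fourI hζ φ
    have h1 : φ t * SylLy.elemT ζ * (φ t)⁻¹ ∈ conjSubgroup s SylLy.fourI := by
      rw [mem_conjSubgroup]
      have := elemT_mem_normalCore_fourI hζ (s⁻¹ * φ t)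
      simpa [mul_assoc] using this
    rw [hs] at h1
    obtain ⟨y, hy, hy'⟩ := h1
    have h2 : y = t * φ.symm (SylLy.elemT ζ) * t⁻¹ := by
      apply φ.injective
      simpa using hy'
    rwa [← h2]
  obtain ⟨s, hs⟩ := exists_conj_le hζ hmax.1
  have hm := hmax.of_areConj ⟨s, rfl⟩
  have hT' : ∀ X, conjSubgroup s ((SylLy.threeATZ ζ).map φ.toMonoidHom) = X →
      SylLy.elemT ζ ∈ conjSubgroup s⁻¹ X := by
    rintro _ rfl
    rwa [conjSubgroup_conjSubgroup, inv_mul_cancel, conjSubgroup_one]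
  rcases hs with h | h | h | h
  · have h1 := hm.eq_of_le (isElemAbTwo_fourI hζ) h
    have h2 := card_conjSubgroup s ((SylLy.threeATZ ζ).map φ.toMonoidHom)
    rw [h1, hc, card_fourI hζ] at h2
    norm_num at h2
  · exact AreConj.symm ⟨s, hm.eq_of_le (isElemAbTwo_threeATZ hζ) h⟩
  · exact absurd (hT' _ (hm.eq_of_le (isElemAbTwo_subgroup hζ _) h)) (elemT_not_mem_conj_agz hζ _)
  · exact absurd (hT' _ (hm.eq_of_le (isElemAbTwo_subgroup hζ _) h)) (elemT_not_mem_conj_xgz hζ _)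

theorem card_map {G H : Type*} [Group G] [Group H] {f : G →* H} (hf : Function.Injective f)
    (K : Subgroup G) : Nat.card (K.map f) = Nat.card K :=
  Nat.card_congr (K.equivMapOfInjective f hf).symm.toEquiv

variable {G : Type*} [Group G] [Finite G]

theorem areConj_map_of_isSylow (hζ : IsPrimitiveRoot ζ 3) {f₀ f : SylLy →* G}
    (h₀ : IsSylowTwoEmbedding f₀) (h : IsSylowTwoEmbedding f) :
    AreConj (SylLy.fourI.map f) (SylLy.fourI.map f₀) ∧
      AreConj ((SylLy.threeATZ ζ).map f) ((SylLy.threeATZ ζ).map f₀) := by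
  obtain ⟨g, φ, hφ⟩ := h₀.exists_conj h
  rw [map_eq_conjSubgroup_map hφ, map_eq_conjSubgroup_map hφ]
  exact ⟨AreConj.symm (((areConj_map_fourI hζ φ).map f₀).trans ⟨g, rfl⟩),
    AreConj.symm (((areConj_map_threeATZ hζ φ).map f₀).trans ⟨g, rfl⟩)⟩

/-- An elementary abelian 2-subgroup is conjugate to the image of one of the Sylow subgroup. -/
theorem IsSylowTwoEmbedding.exists_map_eq {S : Type*} [Group S] {f : S →* G}
    (h : IsSylowTwoEmbedding f) {E : Subgroup G} (hE : IsElemAbTwo E) :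
    ∃ N : Subgroup S, IsElemAbTwo N ∧ AreConj E (N.map f) := by
  obtain ⟨hi, P, hP⟩ := h
  obtain ⟨g, hg⟩ := exists_conjSubgroup_le hE.isPGroup P
  rw [hP] at hg
  have h1 := Subgroup.map_comap_eq_self hg
  exact ⟨_, (hE.conj g).comap hi, g, h1.symm⟩

theorem IsSylowTwoEmbedding.isMaxElemAbTwo_fourI (hζ : IsPrimitiveRoot ζ 3) {f : SylLy →* G}
    (h : IsSylowTwoEmbedding f) : IsMaxElemAbTwo (SylLy.fourI.map f) := by
  refine ⟨(isElemAbTwo_fourI hζ).map f, fun L hL hle => ?_⟩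
  obtain ⟨N, hN, hc⟩ := h.exists_map_eq hL
  have h1 : Nat.card L ≤ Nat.card (SylLy.fourI.map f) := by
    rw [hc.card_eq, card_map h.1, card_map h.1, card_fourI hζ]
    exact card_le_of_isElemAbTwo hζ hN
  exact (eq_of_le_of_card_le hle h1).ge

/-- In a group containing `2S_8` with odd index, every maximal elementary abelian 2-subgroup is
conjugate to `2^4` or to `⟨A, T, Z⟩`. -/
theorem areConj_or_of_isMaxElemAbTwo (hζ : IsPrimitiveRoot ζ 3) {F : twoSymEight →* G}
    (h₀ : IsSylowTwoEmbedding (F.comp (sylHom hζ))) {f : SylLy →* G}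
    (h : IsSylowTwoEmbedding f) {M : Subgroup G} (hM : IsMaxElemAbTwo M) :
    AreConj (SylLy.fourI.map f) M ∨ AreConj ((SylLy.threeATZ ζ).map f) M := by
  have := finite_sylLy hζ
  obtain ⟨hc4, hc3⟩ := areConj_map_of_isSylow hζ h₀ h
  obtain ⟨N, hN, hMN⟩ := h₀.exists_map_eq hM.1
  have hNmax : IsMaxElemAbTwo N := (hM.of_areConj hMN).of_map h₀.1
  obtain ⟨s, hs⟩ := exists_conj_le hζ hN
  have hm := hNmax.of_areConj ⟨s, rfl⟩
  have hconj : ∀ X, IsElemAbTwo X → conjSubgroup s N ≤ X →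
      AreConj M (X.map (F.comp (sylHom hζ))) := fun X hX hle =>
    hMN.trans (AreConj.map _ ⟨s, hm.eq_of_le hX hle⟩)
  -- Fusion in 2S_8 places a conjugate of `M` inside the image of `Y`, and maximality turns the
  -- inclusion into equality.
  have hfuse : ∀ X Y : Subgroup SylLy, IsElemAbTwo Y →
      conjSubgroup fuseElem (X.map (sylHom hζ)) ≤ Y.map (sylHom hζ) →
      AreConj M (X.map (F.comp (sylHom hζ))) → AreConj M (Y.map (F.comp (sylHom hζ))) := by
    intro X Y hY hle hX
    have h1 : conjSubgroup (F fuseElem) (X.map (F.comp (sylHom hζ))) ≤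
        Y.map (F.comp (sylHom hζ)) := by
      rw [← Subgroup.map_map, ← Subgroup.map_map, ← map_conjSubgroup]
      exact Subgroup.map_mono hle
    have h2 : AreConj M (conjSubgroup (F fuseElem) (X.map (F.comp (sylHom hζ)))) :=
      hX.trans ⟨_, rfl⟩
    rwa [(hM.of_areConj h2).eq_of_le (hY.map _) h1] at h2
  rcases hs with h | h | h | h
  · exact Or.inl (hc4.trans (hconj _ (isElemAbTwo_fourI hζ) h).symm)
  · exact Or.inr (hc3.trans (hconj _ (isElemAbTwo_threeATZ hζ) h).symm)
  · exact Or.inr (hc3.trans (hfuse _ _ (isElemAbTwo_threeATZ hζ) (conj_agz_le hζ)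
      (hconj _ (isElemAbTwo_subgroup hζ _) h)).symm)
  · exact Or.inl (hc4.trans (hfuse _ _ (isElemAbTwo_fourI hζ) (conj_xgz_le hζ)
      (hconj _ (isElemAbTwo_subgroup hζ _) h)).symm)

theorem twoClasses (hζ : IsPrimitiveRoot ζ 3) {F : twoSymEight →* G}
    (h₀ : IsSylowTwoEmbedding (F.comp (sylHom hζ))) {f : SylLy →* G}
    (h : IsSylowTwoEmbedding f) (hV : IsMaxElemAbTwo ((SylLy.threeATZ ζ).map f)) :
    TwoClassesOfMaxElemAbTwo (SylLy.fourI.map f) ((SylLy.threeATZ ζ).map f) := by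
  refine ⟨h.isMaxElemAbTwo_fourI hζ, hV, fun hc => ?_, fun M hM =>
    areConj_or_of_isMaxElemAbTwo hζ h₀ h hM⟩
  have := hc.card_eq
  rw [card_map h.1, card_map h.1, card_fourI hζ, card_threeATZ hζ] at this
  norm_num at this

end Classification

/-! ### The Weyl group of an elementary abelian subgroup of order 8 -/

section Weyl

/-- The elementary abelian group of order 8. -/
abbrev CubeTwo : Type := ℤˣ × ℤˣ × ℤˣ

/-- The characters of the elementary abelian group of order 8 that are nontrivial on the first
factor. -/
abbrev OddChar : Type := {χ : CubeTwo →* ℤˣ // χ (-1, 1, 1) = -1}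

/-- The four characters nontrivial on the first factor. -/
def oddChar (p : ℤˣ × ℤˣ) : OddChar :=
  ⟨MonoidHom.mk' (fun x => x.1 * (if p.1 = 1 then 1 else x.2.1) * if p.2 = 1 then 1 else x.2.2) (by
    revert p; decide), by revert p; decide⟩

theorem oddChar_bijective : Function.Bijective oddChar := by
  constructor
  · intro p q h
    have h1 := congrArg (fun χ : OddChar => χ.1 (1, -1, 1)) h
    have h2 := congrArg (fun χ : OddChar => χ.1 (1, 1, -1)) h
    simp only [oddChar, MonoidHom.mk'_apply] at h1 h2
    revert h1 h2
    clear h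
    revert p q
    decide
  · rintro ⟨χ, hχ⟩
    refine ⟨(χ (1, -1, 1), χ (1, 1, -1)), Subtype.ext (MonoidHom.ext fun x => ?_)⟩
    have hx : ∀ x : CubeTwo, x = (if x.1 = 1 then 1 else (-1, 1, 1)) *
        (if x.2.1 = 1 then 1 else (1, -1, 1)) * if x.2.2 = 1 then 1 else (1, 1, -1) := by decide
    have h2 : χ x = (if x.1 = 1 then 1 else -1) * (if x.2.1 = 1 then 1 else χ (1, -1, 1)) *
        if x.2.2 = 1 then 1 else χ (1, 1, -1) := by
      conv_lhs => rw [hx x]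
      rw [map_mul, map_mul, apply_ite χ, apply_ite χ, apply_ite χ, map_one, hχ]
    rw [h2]
    generalize χ (1, -1, 1) = p
    generalize χ (1, 1, -1) = q
    simp only [oddChar, MonoidHom.mk'_apply]
    clear h2 hχ
    revert x p q
    decide

/-- The automorphisms fixing the generator of the first factor. -/
def cubeStab : Subgroup (MulAut CubeTwo) where
  carrier := {φ | φ (-1, 1, 1) = (-1, 1, 1)}
  mul_mem' := by
    intro φ ψ hφ hψ
    change φ (ψ _) = _
    rw [hψ, hφ]
  one_mem' := rfl
  inv_mem' := by
    intro φ hφ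
    exact (MulEquiv.symm_apply_eq φ).2 hφ.symm

/-- The action of `cubeStab` on the four characters. -/
def cubePerm : cubeStab →* Equiv.Perm OddChar :=
  MonoidHom.mk' (fun φ =>
    { toFun := fun χ => ⟨χ.1.comp (φ⁻¹ : cubeStab).1.toMonoidHom, by
        change χ.1 ((φ⁻¹ : cubeStab).1 _) = _
        rw [(φ⁻¹ : cubeStab).2, χ.2]⟩
      invFun := fun χ => ⟨χ.1.comp φ.1.toMonoidHom, by
        change χ.1 (φ.1 _) = _
        rw [φ.2, χ.2]⟩
      left_inv := fun χ => Subtype.ext (MonoidHom.ext fun x => by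
        change χ.1 (φ.1.symm (φ.1 x)) = _
        rw [MulEquiv.symm_apply_apply])
      right_inv := fun χ => Subtype.ext (MonoidHom.ext fun x => by
        change χ.1 (φ.1 (φ.1.symm x)) = _
        rw [MulEquiv.apply_symm_apply]) }) (by
    intro φ ψ
    refine Equiv.ext fun χ => Subtype.ext (MonoidHom.ext fun x => ?_)
    rfl)

/-- The four characters nontrivial on the first factor separate points, so an automorphism fixing
all of them is the identity. -/
theorem cubePerm_injective : Function.Injective cubePerm := by
  rw [injective_iff_map_eq_one]
  intro φ hφ
  have hd : ∀ x y : CubeTwo, (∀ p, (oddChar p).1 x = (oddChar p).1 y) → x = y := by decide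
  rw [← inv_eq_one]
  refine Subtype.ext (MulEquiv.ext fun x => hd _ _ fun p => ?_)
  have h1 := congrArg (fun χ : OddChar => χ.1 x) (Equiv.congr_fun hφ (oddChar p))
  exact h1

variable {G : Type*} [Group G]

/-- The Weyl group of a self-centralizing elementary abelian subgroup of order 8 containing a
central involution embeds in `S_4`. -/
theorem exists_weylGroup_hom {V : Subgroup G} {j : CubeTwo →* G} (hj : Function.Injective j)
    (hV : j.range = V) (hz : ∀ x, x * j (-1, 1, 1) = j (-1, 1, 1) * x)
    (hC : Subgroup.centralizer (V : Set G) = V) :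
    ∃ θ : WeylGroup V →* Equiv.Perm (Fin 4), Function.Injective θ := by
  subst hV
  let e : CubeTwo ≃* j.range := MonoidHom.ofInjective hj
  let c : Subgroup.normalizer (j.range : Set G) →* MulAut CubeTwo :=
    (MulAut.congr e.symm).toMonoidHom.comp j.range.normalizerMonoidHom
  have hc : ∀ n x, j (c n x) = n * j x * (n : G)⁻¹ := by
    intro n x
    have h1 : e (c n x) = j.range.normalizerMonoidHom n (e x) := e.apply_symm_apply _
    exact congrArg Subtype.val h1
  let c' : Subgroup.normalizer (j.range : Set G) →* cubeStab := c.codRestrict _ (by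
    intro n
    apply hj
    rw [hc, hz, mul_inv_cancel_right])
  let x4 : OddChar ≃ Fin 4 := (Equiv.ofBijective _ oddChar_bijective).symm.trans
    (Fintype.equivFinOfCardEq (by decide))
  let θ := (x4.permCongrHom.toMonoidHom.comp cubePerm).comp c'
  -- The action on characters is faithful, so the kernel is the centralizer of V in its normalizer,
  -- which is V by hypothesis.
  have hθ : θ.ker = j.range.subgroupOf (Subgroup.normalizer (j.range : Set G)) := by
    ext n
    rw [MonoidHom.mem_ker, Subgroup.mem_subgroupOf]
    have h1 : θ n = 1 ↔ c n = 1 := by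
      change x4.permCongrHom (cubePerm (c' n)) = 1 ↔ _
      rw [map_eq_one_iff _ (MulEquiv.injective _), map_eq_one_iff _ cubePerm_injective]
      exact Subtype.ext_iff
    have hm : ∀ y : G, y ∈ j.range ↔ ∀ h ∈ (j.range : Set G), h * y = y * h := by
      intro y
      conv_lhs => rw [← hC]
      exact Subgroup.mem_centralizer_iff
    rw [h1, hm]
    constructor
    · rintro h2 _ ⟨x, rfl⟩
      have h3 := hc n x
      rw [h2, MulAut.one_apply, eq_mul_inv_iff_mul_eq] at h3
      exact h3
    · intro h2
      refine MulEquiv.ext fun x => hj ?_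
      rw [hc, ← h2 _ ⟨x, rfl⟩, mul_inv_cancel_right]
      rfl
  refine ⟨(QuotientGroup.kerLift θ).comp
    (QuotientGroup.quotientMulEquivOfEq hθ.symm).toMonoidHom, ?_⟩
  exact (QuotientGroup.kerLift_injective θ).comp (MulEquiv.injective _)

theorem card_weylGroup_mul (V : Subgroup G) :
    Nat.card (WeylGroup V) * Nat.card V = Nat.card (Subgroup.normalizer (V : Set G)) := by
  rw [Subgroup.card_eq_card_quotient_mul_card_subgroup
    (V.subgroupOf (Subgroup.normalizer (V : Set G)))]
  congr 1
  exact (Nat.card_congr (Subgroup.subgroupOfEquivOfLe Subgroup.le_normalizer).toEquiv).symm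

/-! ### Recognition of D_8 and S_4 inside S_4 -/

/-- The symmetries of the square as permutations of its corners. -/
def dihedralPerm : DihedralGroup 4 →* Equiv.Perm (ZMod 4) :=
  MonoidHom.mk' (fun
    | .r i => Equiv.addRight i
    | .sr i => (Equiv.addRight i).trans (Equiv.neg _)) (by
    rintro (i | i) (j | j) <;> refine Equiv.ext fun x => ?_ <;> revert i j x <;> decide)

theorem dihedralPerm_injective : Function.Injective dihedralPerm := by
  rw [injective_iff_map_eq_one]
  intro x hx
  have h0 := Equiv.congr_fun hx 0
  have h1 := Equiv.congr_fun hx 1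
  revert h0 h1
  clear hx
  rcases x with i | i <;> revert i <;> decide

/-- A subgroup of order 8 of `S_4` is dihedral. -/
theorem nonempty_mulEquiv_dihedral {Q : Type*} [Group Q] {θ : Q →* Equiv.Perm (Fin 4)}
    (hθ : Function.Injective θ) (hQ : Nat.card Q = 8) : Nonempty (Q ≃* DihedralGroup 4) := by
  have hG : Nat.card (Equiv.Perm (Fin 4)) = 2 ^ 3 * 3 := by
    rw [Nat.card_perm, Nat.card_eq_fintype_card, Fintype.card_fin]; rfl
  obtain ⟨h1, P, hP⟩ := isSylowTwoEmbedding_of_card hθ (k := 3) hQ hG (by norm_num)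
  -- Both groups of order 8 are Sylow 2-subgroups of S_4; `ZMod 4` unfolds to `Fin 4`.
  obtain ⟨h2, P', hP'⟩ := isSylowTwoEmbedding_of_card (G := Equiv.Perm (Fin 4))
    (f := dihedralPerm) dihedralPerm_injective (k := 3) DihedralGroup.nat_card hG (by norm_num)
  have e1 : Q ≃* (P : Subgroup (Equiv.Perm (Fin 4))) :=
    (MonoidHom.ofInjective h1).trans (MulEquiv.subgroupCongr hP.symm)
  have e2 : DihedralGroup 4 ≃* (P' : Subgroup (Equiv.Perm (Fin 4))) :=
    (MonoidHom.ofInjective h2).trans (MulEquiv.subgroupCongr hP'.symm)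
  exact ⟨(e1.trans (Sylow.equiv P P')).trans e2.symm⟩

theorem nonempty_mulEquiv_perm {Q : Type*} [Group Q] {θ : Q →* Equiv.Perm (Fin 4)}
    (hθ : Function.Injective θ) (hQ : Nat.card Q = 24) :
    Nonempty (Q ≃* Equiv.Perm (Fin 4)) := by
  have hG : Nat.card (Equiv.Perm (Fin 4)) = 24 := by
    rw [Nat.card_perm, Nat.card_eq_fintype_card, Fintype.card_fin]; rfl
  have : Finite Q := Finite.of_injective θ hθ
  exact ⟨MulEquiv.ofBijective θ
    ((Nat.bijective_iff_injective_and_card _).2 ⟨hθ, hQ.trans hG.symm⟩)⟩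

theorem mem_normalizer_of_conjSubgroup_le [Finite G] {V : Subgroup G} {x : G}
    (h : conjSubgroup x V ≤ V) : x ∈ Subgroup.normalizer (V : Set G) := by
  have h1 : conjSubgroup x V = V := Subgroup.eq_of_le_of_card_ge h (card_conjSubgroup x V).ge
  rw [Subgroup.mem_normalizer_iff]
  intro y
  constructor
  · intro hy
    exact h ⟨y, hy, rfl⟩
  · intro hy
    rw [← h1, mem_conjSubgroup] at hy
    simpa [mul_assoc] using hy

theorem AreConj.nonempty_weylGroup {V V' : Subgroup G} (h : AreConj V V') {Q : Type*} [Group Q]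
    (hQ : Nonempty (WeylGroup V ≃* Q)) : Nonempty (WeylGroup V' ≃* Q) := by
  obtain ⟨e⟩ := hQ
  obtain ⟨g, rfl⟩ := h
  let φ : Subgroup.normalizer (V : Set G) ≃*
      (Subgroup.normalizer (V : Set G)).map (MulAut.conj g).toMonoidHom :=
    Subgroup.equivMapOfInjective _ _ (MulAut.conj g).injective
  have hN : (Subgroup.normalizer (V : Set G)).map (MulAut.conj g).toMonoidHom =
      Subgroup.normalizer (conjSubgroup g V : Set G) :=
    Subgroup.map_equiv_normalizer_eq V (MulAut.conj g)
  refine ⟨(QuotientGroup.congr _ _ (φ.trans (MulEquiv.subgroupCongr hN)) ?_).symm.trans e⟩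
  ext ⟨x, hx⟩
  rw [Subgroup.mem_subgroupOf]
  constructor
  · rintro ⟨y, hy, hyx⟩
    exact ⟨y, hy, congrArg Subtype.val hyx⟩
  · rintro ⟨y, hy, hyx⟩
    exact ⟨⟨y, Subgroup.le_normalizer hy⟩, hy, Subtype.ext hyx⟩

theorem AreConj.centralizer_eq {V V' : Subgroup G} (h : AreConj V V')
    (hC : Subgroup.centralizer (V : Set G) = V) : Subgroup.centralizer (V' : Set G) = V' := by
  obtain ⟨g, rfl⟩ := h
  ext x
  have hm : ∀ y : G, y ∈ V ↔ ∀ h ∈ (V : Set G), h * y = y * h := by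
    intro y
    conv_lhs => rw [← hC]
    exact Subgroup.mem_centralizer_iff
  rw [mem_conjSubgroup, hm, Subgroup.mem_centralizer_iff]
  constructor
  · intro h y hy
    have h1 := h (g * y * g⁻¹) ⟨y, hy, rfl⟩
    calc y * (g⁻¹ * x * g) = g⁻¹ * (g * y * g⁻¹ * x) * g := by group
      _ = g⁻¹ * x * g * y := by rw [h1]; group
  · rintro h _ ⟨y, hy, rfl⟩
    have h1 := h y hy
    change g * y * g⁻¹ * x = x * (g * y * g⁻¹)
    calc g * y * g⁻¹ * x = g * (y * (g⁻¹ * x * g)) * g⁻¹ := by group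
      _ = x * (g * y * g⁻¹) := by rw [h1]; group

end Weyl

/-! ### The Weyl group of `⟨A, T, Z⟩` in `2S_8` and `2A_10` -/

section WeylGroups

open SylCoord

variable {ζ : F4}

/-- The standard parametrization of `⟨A, T, Z⟩`. -/
def cubeCoord (x : CubeTwo) : SylCoord :=
  ((false, false), (decide (x.1 = -1), decide (x.2.1 = -1)), (false, false), false,
    decide (x.2.2 = -1))

/-- The standard parametrization of `⟨A, T, Z⟩`. -/
def cubeHom (hζ : IsPrimitiveRoot ζ 3) : CubeTwo →* SylLy :=
  MonoidHom.mk' (fun x => el ζ (cubeCoord x)) (by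
    have hd : ∀ x y, cubeCoord (x * y) = SylCoord.mul (cubeCoord x) (cubeCoord y) := by
      decide +kernel
    intro x y
    rw [hd, el_mul hζ])

theorem cubeHom_injective (hζ : IsPrimitiveRoot ζ 3) : Function.Injective (cubeHom hζ) := by
  have hd : ∀ x y, cubeCoord x = cubeCoord y → x = y := by decide +kernel
  exact fun x y h => hd x y ((el_bijective hζ).1 h)

theorem range_cubeHom (hζ : IsPrimitiveRoot ζ 3) : (cubeHom hζ).range = SylLy.threeATZ ζ := by
  have h1 : ∀ x, inATZ (cubeCoord x) := by decide +kernel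
  have h2 : ∀ y, inATZ y → ∃ x, cubeCoord x = y := by decide +kernel
  rw [threeATZ_eq hζ]
  ext s
  constructor
  · rintro ⟨x, rfl⟩
    exact (el_mem_subgroup hζ).2 (h1 x)
  · rintro ⟨y, hy, rfl⟩
    obtain ⟨x, rfl⟩ := h2 y hy
    exact ⟨x, rfl⟩

/-- Coordinates of some elements normalizing `⟨A, T, Z⟩`. -/
def normCoord (p : FourCoord × FourCoord × Bool × Bool) : SylCoord :=
  (p.1, p.2.1, p.1, p.2.2.1, p.2.2.2)

/-- For u = (α, β, α) one has A(u) = u · (0, α², 0), so u moves A only by an element of ⟨T, Z⟩. -/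
theorem conj_normCoord_le (hζ : IsPrimitiveRoot ζ 3) (p : FourCoord × FourCoord × Bool × Bool) :
    conjSubgroup (el ζ (normCoord p)) (SylLy.threeATZ ζ) ≤ SylLy.threeATZ ζ := by
  have hd : ∀ p, ∀ x, ∃ z, SylCoord.mul (normCoord p) (cubeCoord x) =
      SylCoord.mul (cubeCoord z) (normCoord p) := by decide +kernel
  rw [← range_cubeHom hζ]
  rintro _ ⟨_, ⟨x, rfl⟩, rfl⟩
  obtain ⟨z, hz⟩ := hd p x
  refine ⟨z, ?_⟩
  change el ζ (cubeCoord z) = el ζ (normCoord p) * el ζ (cubeCoord x) * (el ζ (normCoord p))⁻¹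
  rw [eq_mul_inv_iff_mul_eq, ← el_mul hζ, ← el_mul hζ, hz]

theorem card_weylGroup_dvd {G : Type*} [Group G] [Finite G] {V : Subgroup G}
    {θ : WeylGroup V →* Equiv.Perm (Fin 4)} (hθ : Function.Injective θ) :
    Nat.card (WeylGroup V) ∣ 24 := by
  have h := Subgroup.card_subgroup_dvd_card θ.range
  rwa [← Nat.card_congr (MonoidHom.ofInjective hθ).toEquiv, Nat.card_perm,
    Nat.card_eq_fintype_card (α := Fin 4), Fintype.card_fin] at h

namespace SylOver

variable {hζ : IsPrimitiveRoot ζ 3} {G : Type*} [Group G] {f : SylLy →* G}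
  {ψ : G →* Equiv.Perm (Fin 10)}

theorem elemZ_comm (h : SylOver hζ f ψ) (x : G) :
    x * f SylLy.elemZ = f SylLy.elemZ * x := by
  have h1 : ψ (f SylLy.elemZ) = 1 := by
    rw [← el_cZ (ζ := ζ), h.map_el]
    decide +kernel
  rcases h.ker (x * f SylLy.elemZ * x⁻¹) (by simp [h1]) with h2 | h2
  · rw [mul_inv_eq_one, mul_eq_left] at h2
    rw [h2, mul_one, one_mul]
  · exact mul_inv_eq_iff_eq_mul.1 h2

theorem centralizer_eq (h : SylOver hζ f ψ) (hψ : ∀ x, ψ x ∈ alternatingGroup (Fin 10)) :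
    Subgroup.centralizer (((SylLy.threeATZ ζ).map f : Subgroup G) : Set G) =
      (SylLy.threeATZ ζ).map f := by
  apply le_antisymm
  · intro x hx
    rw [Subgroup.mem_centralizer_iff] at hx
    exact h.mem_of_commute hψ (hx _ ⟨_, elemA_mem ζ, rfl⟩).symm
      (hx _ ⟨_, elemT_mem ζ, rfl⟩).symm
  · intro x hx
    rw [Subgroup.mem_centralizer_iff]
    exact fun y hy => ((isElemAbTwo_threeATZ hζ).map f).1 y hy x hx

theorem exists_weylGroup_hom (h : SylOver hζ f ψ) (hψ : ∀ x, ψ x ∈ alternatingGroup (Fin 10)) :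
    ∃ θ : WeylGroup ((SylLy.threeATZ ζ).map f) →* Equiv.Perm (Fin 4), Function.Injective θ := by
  refine _root_.exists_weylGroup_hom (j := f.comp (cubeHom hζ))
    (h.injective.comp (cubeHom_injective hζ)) ?_ ?_ (h.centralizer_eq hψ)
  · rw [MonoidHom.range_comp, range_cubeHom]
  · intro x
    change x * f (el ζ cZ) = f (el ζ cZ) * x
    rw [el_cZ]
    exact h.elemZ_comm x

theorem eight_dvd_card_weylGroup [Finite G] (h : SylOver hζ f ψ) :
    8 ∣ Nat.card (WeylGroup ((SylLy.threeATZ ζ).map f)) := by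
  have := finite_sylLy hζ
  let N := Subgroup.normalizer (((SylLy.threeATZ ζ).map f : Subgroup G) : Set G)
  have h1 : ∀ p, el ζ (normCoord p) ∈ N.comap f := by
    intro p
    refine mem_normalizer_of_conjSubgroup_le ?_
    rw [← map_conjSubgroup]
    exact Subgroup.map_mono (conj_normCoord_le hζ p)
  -- The 64 elements (α, β, α)gⁱAʲ normalize V. The normalizer in S is a 2-group, so this lower
  -- bound upgrades to divisibility by 64, and dividing by the order 8 of V leaves 8.
  have h2 : 2 ^ 6 ≤ Nat.card (N.comap f) := by
    have hd : ∀ p q, normCoord p = normCoord q → p = q := by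
      rintro ⟨a, b, i, j⟩ ⟨a', b', i', j'⟩ h
      simp only [normCoord, Prod.mk.injEq] at h ⊢
      tauto
    have := Nat.card_le_card_of_injective (fun p => (⟨_, h1 p⟩ : N.comap f))
      (fun p q hpq => hd p q ((el_bijective hζ).1 (congrArg Subtype.val hpq)))
    rwa [Nat.card_eq_fintype_card, show Fintype.card (FourCoord × FourCoord × Bool × Bool) = 2 ^ 6
      from by simp] at this
  have h3 := Subgroup.card_subgroup_dvd_card (N.comap f)
  rw [card_sylLy hζ, Nat.dvd_prime_pow Nat.prime_two] at h3
  obtain ⟨k, -, hk⟩ := h3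
  have h4 : 2 ^ 6 ∣ Nat.card (N.comap f) := by
    rw [hk] at h2 ⊢
    exact pow_dvd_pow _ ((Nat.pow_le_pow_iff_right (by norm_num)).1 h2)
  have h5 : Nat.card (N.comap f) ∣ Nat.card N := by
    rw [← card_map h.injective]
    exact Subgroup.card_dvd_of_le (Subgroup.map_comap_le f N)
  have h6 := card_weylGroup_mul ((SylLy.threeATZ ζ).map f)
  rw [card_map h.injective, card_threeATZ hζ] at h6
  have h7 := h4.trans h5
  change Nat.card (WeylGroup _) * 2 ^ 3 = Nat.card N at h6
  omega

end SylOver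

/-! ### The double cover of `A_10` -/

theorem finite_twoAlt {n : ℕ} [NeZero n] [Nontrivial (Fin n)] : Finite (TwoAlt n) :=
  Nat.finite_of_card_ne_zero (by rw [card_twoAlt]; positivity)

instance : Finite (TwoAlt 10) := finite_twoAlt

theorem isSylowTwoEmbedding_alt (hζ : IsPrimitiveRoot ζ 3) {f : SylLy →* TwoAlt 10}
    (hf : Function.Injective f) : IsSylowTwoEmbedding f :=
  isSylowTwoEmbedding_of_card hf (card_sylLy hζ) (m := 14175)
    (by rw [card_twoAlt]; decide +kernel) (by norm_num)

/-- The order of 2S_8 lies between 2^8 and 10! = 2^8 · 14175 for divisibility, which determines its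
2-part without computing it. -/
theorem isSylowTwoEmbedding_sym (hζ : IsPrimitiveRoot ζ 3) :
    IsSylowTwoEmbedding (sylHom hζ) := by
  have h1 : Nat.card twoSymEight ∣ 2 ^ 8 * 14175 := by
    have := Subgroup.card_subgroup_dvd_card twoSymEight
    rwa [card_twoAlt, show Nat.factorial 10 = 2 ^ 8 * 14175 from by decide +kernel] at this
  have h2 : 2 ^ 8 ∣ Nat.card twoSymEight := by
    rw [← card_sylLy hζ, Nat.card_congr (MonoidHom.ofInjective (sylHom_injective hζ)).toEquiv]
    exact Subgroup.card_subgroup_dvd_card _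
  obtain ⟨m, hm⟩ := h2
  refine isSylowTwoEmbedding_of_card (sylHom_injective hζ) (card_sylLy hζ) hm ?_
  intro h2m
  rw [hm] at h1
  have h3 := h2m.trans (Nat.dvd_of_mul_dvd_mul_left (by norm_num) h1)
  norm_num at h3

/-- An element of `2A_10` over the product of three-cycles `(1 2 3)(8 6 4)(9 7 5)`. -/
theorem exists_fuseThree : ∃ x : TwoAlt 10, spinPerm _ x =
    wordPerm [(1, 2), (2, 3), (8, 6), (6, 4), (9, 7), (7, 5)] :=
  exists_spinPerm_eq (wordPerm_mem_alternatingGroup (by decide) (by decide))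

/-- The three 3-cycles permute the pairs {4, 5}, {6, 7}, {8, 9} cyclically and rotate 1, 2, 3;
modulo Z this sends T to A and A to AT. -/
theorem three_dvd_card_weylGroup (hζ : IsPrimitiveRoot ζ 3) :
    3 ∣ Nat.card (WeylGroup ((SylLy.threeATZ ζ).map (twoSymEight.subtype.comp (sylHom hζ)))) := by
  have h := sylOver_alt hζ
  obtain ⟨x, hx⟩ := exists_fuseThree
  have h1 : x ∈ Subgroup.normalizer
      (((SylLy.threeATZ ζ).map (twoSymEight.subtype.comp (sylHom hζ)) : Subgroup (TwoAlt 10)) :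
        Set (TwoAlt 10)) := by
    refine mem_normalizer_of_conjSubgroup_le ?_
    rw [threeATZ_eq hζ]
    refine h.conjSubgroup_map_le rfl (fun y => ((false, false),
      (y.2.1.1, y.2.2.2.2), (false, false), false, xor y.2.1.2 y.2.2.2.2)) ?_
    rw [hx]
    decide +kernel
  have h2 : 3 ∣ orderOf x := by
    refine dvd_trans ?_ (orderOf_map_dvd (spinPerm (alternatingGroup (Fin 10))) x)
    rw [hx, orderOf_eq_prime (p := 3) (by decide +kernel) (by decide +kernel)]
  have h3 := card_weylGroup_mul ((SylLy.threeATZ ζ).map (twoSymEight.subtype.comp (sylHom hζ)))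
  rw [card_map h.injective, card_threeATZ hζ] at h3
  have h4 := h2.trans (Subgroup.orderOf_dvd_natCard _ h1)
  rw [← h3] at h4
  exact (Nat.Coprime.dvd_of_dvd_mul_right (by norm_num) h4)

/-- Two conjugations by `x` multiply `a` by `v * v = 1`, so `x ^ 2` commutes with `a`, and `x` is a
power of `x ^ 2`. -/
theorem mul_comm_of_pow_three {G : Type*} [Group G] {x a v : G} (hx : x ^ 3 = 1)
    (ha : x * a = a * v * x) (hv : x * v = v * x) (h2 : v * v = 1) : x * a = a * x := by
  have h3 : Commute (x ^ 2) a := by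
    rw [Commute, SemiconjBy, pow_two]
    calc x * x * a = x * (a * v * x) := by rw [mul_assoc, ha]
      _ = x * a * (v * x) := by simp only [mul_assoc]
      _ = a * (v * (x * v)) * x := by rw [ha]; simp only [mul_assoc]
      _ = a * (v * v) * (x * x) := by rw [hv]; simp only [mul_assoc]
      _ = a * (x * x) := by rw [h2, mul_one]
  have h4 : (x ^ 2) ^ 2 = x := by rw [← pow_mul, pow_succ, hx, one_mul]
  have h5 := h3.pow_left 2
  rwa [h4] at h5

/-- In 2S_8 the letters 8 and 9 single out ⟨T, Z⟩ as the elements of V fixing 8. An element of order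
3 normalizing V thus stabilizes the chain ⟨Z⟩ < ⟨T, Z⟩ < V with trivial action on the quotients of
order 2, so it centralizes V. -/
theorem not_three_dvd_card_weylGroup (hζ : IsPrimitiveRoot ζ 3) :
    ¬ 3 ∣ Nat.card (WeylGroup ((SylLy.threeATZ ζ).map (sylHom hζ))) := by
  intro h3
  have h := sylOver_sym hζ
  have h4 := card_weylGroup_mul ((SylLy.threeATZ ζ).map (sylHom hζ))
  have h5 : 3 ∣ Nat.card (Subgroup.normalizer
      (((SylLy.threeATZ ζ).map (sylHom hζ) : Subgroup twoSymEight) : Set twoSymEight)) := by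
    rw [← h4]; exact h3.mul_right _
  have : Fact (Nat.Prime 3) := ⟨Nat.prime_three⟩
  obtain ⟨⟨x, hxN⟩, hx⟩ := exists_prime_orderOf_dvd_card' 3 h5
  rw [Subgroup.orderOf_mk] at hx
  have hx3 : x ^ 3 = 1 := by rw [← hx, pow_orderOf_eq_one]
  have hconj : ∀ s ∈ SylLy.threeATZ ζ, ∃ y, inATZ y ∧
      x * sylHom hζ s = sylHom hζ (el ζ y) * x := by
    intro s hs
    obtain ⟨_, ht, hy⟩ := (Subgroup.mem_normalizer_iff.1 hxN _).1 ⟨s, hs, rfl⟩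
    rw [threeATZ_eq hζ] at ht
    obtain ⟨y, hy', rfl⟩ := ht
    exact ⟨y, hy', mul_inv_eq_iff_eq_mul.1 hy.symm⟩
  have hfix : ∀ c y : SylCoord, x * sylHom hζ (el ζ c) = sylHom hζ (el ζ y) * x →
      ∀ k, symPerm x (sylPerm c k) = sylPerm y (symPerm x k) := by
    intro c y hcy k
    have := congrArg symPerm hcy
    rw [map_mul, map_mul, h.map_el, h.map_el] at this
    exact Equiv.congr_fun this k
  have h89 := symEight_apply (symPerm_mem x)
  have hZ : ∀ b, x * sylHom hζ (el ζ ((false, false), (b, false), (false, false), false, false)) =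
      sylHom hζ (el ζ ((false, false), (b, false), (false, false), false, false)) * x := by
    rintro (_ | _)
    · change x * sylHom hζ (el ζ SylCoord.one) = sylHom hζ (el ζ SylCoord.one) * x
      rw [el_one, map_one, mul_one, one_mul]
    · change x * sylHom hζ (el ζ cZ) = sylHom hζ (el ζ cZ) * x
      rw [el_cZ]
      exact h.elemZ_comm x
  have hT : x * sylHom hζ (SylLy.elemT ζ) = sylHom hζ (SylLy.elemT ζ) * x := by
    obtain ⟨y, hy, hxy⟩ := hconj _ (elemT_mem ζ)
    rw [← el_cT] at hxy
    have hd : ∀ y, inATZ y → sylPerm y ≠ 1 → sylPerm y 8 = 8 → ∃ b, y = SylCoord.mul cT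
        ((false, false), (b, false), (false, false), false, false) := by decide +kernel
    have h8 : sylPerm y 8 = 8 := by
      have hc8 : sylPerm cT 8 = 8 := by decide +kernel
      have hc9 : sylPerm cT 9 = 9 := by decide +kernel
      have e8 := hfix _ _ hxy 8
      have e9 := hfix _ _ hxy 9
      rw [hc8] at e8
      rw [hc9] at e9
      rcases h89 with ⟨p, q⟩ | ⟨p, q⟩
      · rw [p] at e8; exact e8.symm
      · rw [q] at e9; exact e9.symm
    have h1 : sylPerm y ≠ 1 := by
      intro h1
      have e0 := hfix _ _ hxy 0
      rw [h1, Equiv.Perm.one_apply, (symPerm x).injective.eq_iff] at e0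
      revert e0
      decide +kernel
    obtain ⟨b, rfl⟩ := hd y hy h1 h8
    rw [el_mul hζ, map_mul] at hxy
    rw [← el_cT]
    refine mul_comm_of_pow_three hx3 hxy (hZ b) ?_
    rw [← map_mul, (sq_iff hζ).2 (by clear h1 h8 hxy hy; revert b; decide), map_one]
  have hA : x * sylHom hζ SylLy.elemA = sylHom hζ SylLy.elemA * x := by
    obtain ⟨y, hy, hxy⟩ := hconj _ (elemA_mem ζ)
    rw [← el_cA (ζ := ζ)] at hxy
    have hd : ∀ y, inATZ y → sylPerm y 8 ≠ 8 → ∃ b c, y = SylCoord.mul cA (SylCoord.mul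
        ((false, false), (b, false), (false, false), false, false)
        ((false, false), (false, c), (false, false), false, false)) := by decide +kernel
    have h8 : sylPerm y 8 ≠ 8 := by
      have hc8 : sylPerm cA 8 = 9 := by decide +kernel
      have hc9 : sylPerm cA 9 = 8 := by decide +kernel
      have e8 := hfix _ _ hxy 8
      have e9 := hfix _ _ hxy 9
      rw [hc8] at e8
      rw [hc9] at e9
      rcases h89 with ⟨p, q⟩ | ⟨p, q⟩
      · rw [p, q] at e8; rw [← e8]; decide
      · rw [p, q] at e9; rw [← e9]; decide
    obtain ⟨b, c, rfl⟩ := hd y hy h8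
    rw [el_mul hζ, map_mul] at hxy
    rw [← el_cA (ζ := ζ)]
    refine mul_comm_of_pow_three hx3 hxy ?_ ?_
    · rw [el_mul hζ, map_mul, ← mul_assoc, hZ, mul_assoc, mul_assoc]
      congr 1
      cases c
      · change x * sylHom hζ (el ζ SylCoord.one) = sylHom hζ (el ζ SylCoord.one) * x
        rw [el_one, map_one, mul_one, one_mul]
      · change x * sylHom hζ (el ζ cT) = sylHom hζ (el ζ cT) * x
        rw [el_cT, hT]
    · rw [← map_mul, (sq_iff hζ).2 (by clear h8 hxy hy; revert b c; decide), map_one]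
  -- Being self-centralizing, V contains `x`, whose square is then 1, against order 3.
  have hx2 := ((isElemAbTwo_threeATZ hζ).map (sylHom hζ)).2 _ (h.mem_of_commute symPerm_mem_alt hA hT)
  have := orderOf_dvd_of_pow_eq_one hx2
  rw [hx] at this
  norm_num at this

/-- The Weyl group of `⟨A, T, Z⟩` in `2A_10`. -/
theorem nonempty_weylGroup_alt (hζ : IsPrimitiveRoot ζ 3) :
    Nonempty (WeylGroup ((SylLy.threeATZ ζ).map (twoSymEight.subtype.comp (sylHom hζ))) ≃*
      Equiv.Perm (Fin 4)) := by
  have h := sylOver_alt hζ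
  obtain ⟨θ, hθ⟩ := h.exists_weylGroup_hom spinPerm_mem_alt
  refine nonempty_mulEquiv_perm hθ (Nat.dvd_antisymm (card_weylGroup_dvd hθ) ?_)
  exact Nat.Coprime.mul_dvd_of_dvd_of_dvd (m := 8) (n := 3) (by norm_num)
    h.eight_dvd_card_weylGroup (three_dvd_card_weylGroup hζ)

/-- The Weyl group of `⟨A, T, Z⟩` in `2S_8`. -/
theorem nonempty_weylGroup_sym (hζ : IsPrimitiveRoot ζ 3) :
    Nonempty (WeylGroup ((SylLy.threeATZ ζ).map (sylHom hζ)) ≃* DihedralGroup 4) := by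
  have h := sylOver_sym hζ
  obtain ⟨θ, hθ⟩ := h.exists_weylGroup_hom symPerm_mem_alt
  refine nonempty_mulEquiv_dihedral hθ (Nat.dvd_antisymm ?_ h.eight_dvd_card_weylGroup)
  exact (((Nat.prime_three.coprime_iff_not_dvd).2 (not_three_dvd_card_weylGroup hζ)).symm
    ).dvd_of_dvd_mul_right (card_weylGroup_dvd hθ : _ ∣ 8 * 3)

/-! ### Weak closure -/

theorem isWeaklyClosed_fourI {G : Type*} [Group G] [Finite G] (hζ : IsPrimitiveRoot ζ 3)
    {f : SylLy →* G} (hf : Function.Injective f) :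
    IsWeaklyClosed (SylLy.fourI.map f) f.range := by
  refine ⟨Subgroup.map_le_range f _, fun L hL hc => ?_⟩
  have h1 := Subgroup.map_comap_eq_self hL
  obtain ⟨g, hg⟩ := hc
  have hE : IsElemAbTwo L := hg ▸ ((isElemAbTwo_fourI hζ).map f).conj g
  have hcard : Nat.card (L.comap f) = 2 ^ 4 := by
    rw [← card_map hf, h1, ← hg, card_conjSubgroup, card_map hf, card_fourI hζ]
  obtain ⟨s, hs⟩ := areConj_fourI_of_card hζ (hE.comap hf) hcard
  refine ⟨f s, ⟨s, rfl⟩, ?_⟩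
  rw [← map_conjSubgroup, hs, h1]

/-- A conjugate inside 2S_8 is still maximal there and has order 8, so the classification in 2S_8
leaves only the class of V. -/
theorem isWeaklyClosed_threeATZ (hζ : IsPrimitiveRoot ζ 3) {f : SylLy →* twoSymEight}
    (h : IsSylowTwoEmbedding f)
    (hV : IsMaxElemAbTwo ((SylLy.threeATZ ζ).map (twoSymEight.subtype.comp f))) :
    IsWeaklyClosed ((SylLy.threeATZ ζ).map (twoSymEight.subtype.comp f)) twoSymEight := by
  have hi := Subgroup.subtype_injective twoSymEight
  rw [← Subgroup.map_map] at hV ⊢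
  refine ⟨Subgroup.map_subtype_le _, fun L hL hc => ?_⟩
  have h1 : (L.comap twoSymEight.subtype).map twoSymEight.subtype = L :=
    Subgroup.map_comap_eq_self (by rwa [Subgroup.range_subtype])
  have h2 : IsMaxElemAbTwo (L.comap twoSymEight.subtype) :=
    IsMaxElemAbTwo.of_map hi (by rw [h1]; exact hV.of_areConj hc)
  have h3 : Nat.card (L.comap twoSymEight.subtype) = 2 ^ 3 := by
    rw [← card_map hi, h1, ← hc.card_eq, card_map hi, card_map h.1, card_threeATZ hζ]
  rcases areConj_or_of_isMaxElemAbTwo hζ (F := MonoidHom.id _) (isSylowTwoEmbedding_sym hζ) h h2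
    with h4 | ⟨g, hg⟩
  · have := h4.card_eq
    rw [h3, card_map h.1, card_fourI hζ] at this
    norm_num at this
  · refine ⟨g, g.2, ?_⟩
    rw [← h1, ← hg, map_conjSubgroup]
    rfl

end WeylGroups

/-! ### The embedding of `2A_n` in `2A_{n+1}` -/

section Extension

open CliffordAlgebra

variable {n : ℕ}

/-- Extension of vectors by zero, as an isometry. -/
def extendIsometry (n : ℕ) : euclForm n →qᵢ euclForm (n + 1) where
  toFun v := Fin.snoc (α := fun _ => ℝ) v 0
  map_add' v w := by
    ext k
    refine Fin.lastCases ?_ (fun i => ?_) k <;> simp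
  map_smul' c v := by
    ext k
    refine Fin.lastCases ?_ (fun i => ?_) k <;> simp
  map_app' v := by
    simp [euclForm, QuadraticMap.weightedSumSquares_apply, Fin.sum_univ_castSucc]

theorem map_extendIsometry_cliffE (i : Fin n) :
    CliffordAlgebra.map (extendIsometry n) (cliffE i) = cliffE i.castSucc := by
  rw [cliffE, map_apply_ι, cliffE]
  congr 1
  change Fin.snoc (α := fun _ => ℝ) (Pi.single i 1) 0 = _
  ext k
  refine Fin.lastCases ?_ (fun j => ?_) k
  · simp [(Fin.castSucc_lt_last i).ne']
  · simp [Pi.single_apply]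

/-- A word on `n` letters as a word on `n + 1` letters. -/
def extendWord (w : List (Fin n × Fin n)) : List (Fin (n + 1) × Fin (n + 1)) :=
  w.map fun x => (x.1.castSucc, x.2.castSucc)

theorem extendWord_valid {w : List (Fin n × Fin n)} (h : ∀ x ∈ w, x.1 ≠ x.2) :
    ∀ x ∈ extendWord w, x.1 ≠ x.2 := by
  intro x hx
  obtain ⟨y, hy, rfl⟩ := List.mem_map.1 hx
  exact fun h' => h y hy (Fin.castSucc_injective n h')

theorem extendWord_even {w : List (Fin n × Fin n)} (h : Even w.length) :
    Even (extendWord w).length := by rwa [extendWord, List.length_map]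

theorem map_extendIsometry_wordVal (w : List (Fin n × Fin n)) :
    CliffordAlgebra.map (extendIsometry n) (wordVal w) = wordVal (extendWord w) := by
  rw [wordVal, map_list_prod, List.map_map, wordVal, extendWord, List.map_map]
  congr 2
  ext x
  simp [letterVal, map_extendIsometry_cliffE]

theorem wordPerm_extendWord (w : List (Fin n × Fin n)) (k : Fin n) :
    wordPerm (extendWord w) k.castSucc = (wordPerm w k).castSucc := by
  induction w with
  | nil => rfl
  | cons x w ih =>
    change Equiv.swap x.1.castSucc x.2.castSucc (wordPerm (extendWord w) k.castSucc) =
      (Equiv.swap x.1 x.2 (wordPerm w k)).castSucc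
    rw [ih]
    exact (Fin.castSucc_injective n).swap_apply _ _ _

variable [NeZero n]

/-- Every element of `2A_n` is given by a word. -/
theorem exists_wordAlt_eq [Nontrivial (Fin n)] (x : TwoAlt n) :
    ∃ w hw hl, x = wordAlt w hw hl := by
  obtain ⟨w, hw, hl, h⟩ := exists_even_word (spinPerm_mem x)
  have h1 : spinPerm _ (x * (wordAlt w hw hl)⁻¹) = 1 := by
    rw [map_mul, map_inv, spinPerm_wordAlt, h, mul_inv_cancel]
  rcases spinPerm_eq_one_iff.1 h1 with h2 | h2
  · exact ⟨w, hw, hl, mul_inv_eq_one.1 h2⟩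
  · obtain ⟨i, j, hij⟩ := exists_pair_ne (Fin n)
    -- Reversing a letter negates its value, so these two extra letters contribute -1 while their
    -- transpositions cancel.
    refine ⟨(i, j) :: (j, i) :: w, ?_, ?_, ?_⟩
    · intro y hy
      rcases List.mem_cons.1 hy with rfl | hy
      · exact hij
      · rcases List.mem_cons.1 hy with rfl | hy
        · exact hij.symm
        · exact hw y hy
    · simpa [Nat.even_add_one] using hl
    · rw [mul_inv_eq_iff_eq_mul] at h2
      rw [h2]
      refine Subtype.ext (Subtype.ext ?_)
      change -1 * wordVal w = wordVal (_ :: _ :: w)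
      rw [wordVal_cons, wordVal_cons, letterVal_swap i j, ← mul_assoc, mul_neg,
        letterVal_sq (x := (i, j)) hij]

theorem exists_map_extendIsometry [Nontrivial (Fin n)] (x : TwoAlt n) :
    ∃ y : TwoAlt (n + 1), CliffordAlgebra.map (extendIsometry n) (x : Spin n) = (y : Spin (n + 1)) := by
  obtain ⟨w, hw, hl, rfl⟩ := exists_wordAlt_eq x
  exact ⟨wordAlt _ (extendWord_valid hw) (extendWord_even hl), map_extendIsometry_wordVal w⟩

/-- The embedding of `2A_n` in `2A_{n+1}`. -/
def extendAlt (n : ℕ) [NeZero n] [Nontrivial (Fin n)] : TwoAlt n →* TwoAlt (n + 1) :=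
  MonoidHom.mk' (fun x => (exists_map_extendIsometry x).choose) (by
    intro x y
    refine Subtype.ext (Subtype.ext ?_)
    rw [← (exists_map_extendIsometry (x * y)).choose_spec]
    change CliffordAlgebra.map (extendIsometry n)
        (((x : Spin n) : CliffordAlgebra _) * ((y : Spin n) : CliffordAlgebra _)) =
      ((exists_map_extendIsometry x).choose : Spin (n + 1)).1 *
      ((exists_map_extendIsometry y).choose : Spin (n + 1)).1
    rw [map_mul]
    exact congrArg₂ (· * ·) (exists_map_extendIsometry x).choose_spec
      (exists_map_extendIsometry y).choose_spec)

theorem coe_extendAlt [Nontrivial (Fin n)] (x : TwoAlt n) :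
    ((extendAlt n x : Spin (n + 1)) : CliffordAlgebra _) =
      CliffordAlgebra.map (extendIsometry n) (x : Spin n) :=
  (exists_map_extendIsometry x).choose_spec.symm

theorem extendAlt_preimageNegOne [Nontrivial (Fin n)] :
    extendAlt n (preimageNegOne _) = preimageNegOne _ := by
  refine Subtype.ext (Subtype.ext ?_)
  rw [coe_extendAlt]
  change CliffordAlgebra.map _ (-1) = -1
  rw [map_neg, map_one]

theorem preimageNegOne_ne_one {Γ : Subgroup (Equiv.Perm (Fin n))} : preimageNegOne Γ ≠ 1 :=
  fun h => spinNegOne_ne_one (congrArg Subtype.val h)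

/-- Permutations extend faithfully, so the kernel lies in {1, -1}, and -1 is sent to -1. -/
theorem extendAlt_injective [Nontrivial (Fin n)] : Function.Injective (extendAlt n) := by
  rw [injective_iff_map_eq_one]
  intro x hx
  have h1 : spinPerm _ x = 1 := by
    obtain ⟨w, hw, hl, rfl⟩ := exists_wordAlt_eq x
    have h2 : extendAlt n (wordAlt w hw hl) =
        wordAlt _ (extendWord_valid hw) (extendWord_even hl) :=
      Subtype.ext (Subtype.ext ((coe_extendAlt _).trans (map_extendIsometry_wordVal w)))
    rw [hx] at h2
    have h3 := congrArg (spinPerm _) h2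
    rw [map_one, spinPerm_wordAlt] at h3
    rw [spinPerm_wordAlt]
    ext k
    have h4 := wordPerm_extendWord w k
    rw [← h3] at h4
    exact congrArg Fin.val (Fin.castSucc_injective n h4).symm
  rcases spinPerm_eq_one_iff.1 h1 with h | h
  · exact h
  · rw [h, extendAlt_preimageNegOne] at hx
    exact absurd hx preimageNegOne_ne_one

/-- The centre of `2A_n` has order two. -/
theorem eq_one_or_of_central_twoAlt (hn : 4 ≤ n) {x : TwoAlt n} (hx : ∀ y, x * y = y * x) :
    x = 1 ∨ x = preimageNegOne _ := by
  rw [← spinPerm_eq_one_iff]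
  have h1 : (⟨spinPerm _ x, spinPerm_mem x⟩ : alternatingGroup (Fin n)) ∈
      Subgroup.center (alternatingGroup (Fin n)) := by
    rw [Subgroup.mem_center_iff]
    rintro ⟨σ, hσ⟩
    obtain ⟨y, rfl⟩ := exists_spinPerm_eq hσ
    refine Subtype.ext ?_
    change spinPerm _ y * spinPerm _ x = spinPerm _ x * spinPerm _ y
    rw [← map_mul, ← map_mul, hx]
  rw [alternatingGroup.center_eq_bot (by simpa using hn), Subgroup.mem_bot] at h1
  exact congrArg Subtype.val h1

end Extension

/-! ### The Lyons group -/

section Lyons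

/-- A 2-subgroup whose centre is generated by an element `c` and which is a Sylow subgroup of the
centralizer of `c` is a Sylow subgroup. -/
theorem isSylowTwoEmbedding_of_card_centralizer {S G : Type*} [Group S] [Group G] [Finite G]
    {f : S →* G} (hf : Function.Injective f) {c : S} (hc : ∀ s, c * s = s * c)
    (hcenter : ∀ s, (∀ t, s * t = t * s) → s = 1 ∨ s = c) {k m : ℕ} (hS : Nat.card S = 2 ^ k)
    (hC : Nat.card (Subgroup.centralizer ({f c} : Set G)) = 2 ^ k * m) (hm : ¬ 2 ∣ m) :
    IsSylowTwoEmbedding f := by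
  have : Fact (Nat.Prime 2) := ⟨Nat.prime_two⟩
  have hr : Nat.card f.range = 2 ^ k := by
    rw [← hS]
    exact (Nat.card_congr (MonoidHom.ofInjective hf).toEquiv).symm
  obtain ⟨Q, hQ⟩ := (IsPGroup.of_card hr).exists_le_sylow
  refine ⟨hf, Q, le_antisymm ?_ hQ⟩
  by_contra hlt
  -- If the image were proper in a Sylow group `Q`, some `q` in `Q` outside it would normalize it.
  -- Then `q` fixes the generator `f c` of its centre, hence lies in the centralizer, where the
  -- image is already Sylow.
  have hnorm := Group.normalizerCondition_of_isNilpotent (h := Q.isPGroup'.isNilpotent)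
  have h1 := hnorm (f.range.subgroupOf Q) (lt_top_iff_ne_top.2 fun h =>
    hlt (Subgroup.subgroupOf_eq_top.1 h))
  obtain ⟨q, hq, hqr⟩ := SetLike.exists_of_lt h1
  rw [Subgroup.mem_normalizer_iff] at hq
  have hq' : ∀ s, ∃ t, f t = q * f s * (q : G)⁻¹ := fun s =>
    (hq ⟨f s, hQ ⟨s, rfl⟩⟩).1 ⟨s, rfl⟩
  have hq'' : ∀ t, ∃ s, f t = q * f s * (q : G)⁻¹ := by
    intro t
    obtain ⟨s, hs⟩ := (hq (q⁻¹ * ⟨f t, hQ ⟨t, rfl⟩⟩ * q)).2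
      (by
        rw [Subgroup.mem_subgroupOf]
        exact ⟨t, by simp [mul_assoc]⟩)
    refine ⟨s, ?_⟩
    rw [hs]
    simp [mul_assoc]
  have hqc : (q : G) * f c = f c * q := by
    obtain ⟨s, hs⟩ := hq' c
    have hs1 : s = 1 ∨ s = c := by
      refine hcenter s fun t => hf ?_
      obtain ⟨t', ht'⟩ := hq'' t
      rw [map_mul, map_mul, hs, ht']
      calc q * f c * (q : G)⁻¹ * (q * f t' * (q : G)⁻¹) = q * (f c * f t') * (q : G)⁻¹ := by group
        _ = q * (f t' * f c) * (q : G)⁻¹ := by rw [← map_mul, hc, map_mul]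
        _ = q * f t' * (q : G)⁻¹ * (q * f c * (q : G)⁻¹) := by group
    rcases hs1 with rfl | rfl
    · rw [map_one, eq_comm, mul_inv_eq_one, mul_eq_left] at hs
      rw [hs, mul_one, one_mul]
    · exact mul_inv_eq_iff_eq_mul.1 hs.symm
  let C := Subgroup.centralizer ({f c} : Set G)
  have hle : f.range ≤ (Q : Subgroup G) ⊓ C := by
    refine le_inf hQ ?_
    rintro _ ⟨s, rfl⟩
    rw [Subgroup.mem_centralizer_singleton_iff, ← map_mul, ← map_mul, hc]
  have hcard : Nat.card ((Q : Subgroup G) ⊓ C : Subgroup G) ≤ 2 ^ k := by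
    obtain ⟨l, hl⟩ := IsPGroup.iff_card.1 (Q.isPGroup'.to_le
      (inf_le_left : (Q : Subgroup G) ⊓ C ≤ Q))
    have hd := Subgroup.card_dvd_of_le (inf_le_right : (Q : Subgroup G) ⊓ C ≤ C)
    rw [hC] at hd
    refine Nat.le_of_dvd (by positivity) (Nat.Coprime.dvd_of_dvd_mul_right ?_ hd)
    rw [hl]
    exact Nat.Coprime.pow_left _ ((Nat.prime_two.coprime_iff_not_dvd).2 hm)
  have heq := Subgroup.eq_of_le_of_card_ge hle (hcard.trans hr.ge)
  apply hqr
  rw [Subgroup.mem_subgroupOf, heq]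
  exact ⟨q.2, Subgroup.mem_centralizer_singleton_iff.2 hqc⟩

/-- `2S_8` embeds in the Lyons group with odd index. -/
theorem IsLyonsGroup.exists_embedding {ζ : F4} (hζ : IsPrimitiveRoot ζ 3) {G : Type*} [Group G]
    (hG : IsLyonsGroup G) :
    ∃ F : twoSymEight →* G, IsSylowTwoEmbedding (F.comp (sylHom hζ)) := by
  have := hG.finite
  obtain ⟨z, hz, ⟨e⟩⟩ := hG.exists_involution
  let F : twoSymEight →* G := (Subgroup.centralizer ({z} : Set G)).subtype.comp
    (e.symm.toMonoidHom.comp ((extendAlt 10).comp twoSymEight.subtype))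
  have hF : Function.Injective F := (Subgroup.subtype_injective _).comp
    (e.symm.injective.comp (extendAlt_injective.comp (Subgroup.subtype_injective _)))
  have hzC : z ∈ Subgroup.centralizer ({z} : Set G) :=
    Subgroup.mem_centralizer_singleton_iff.2 rfl
  -- The involution `z` is central in its centralizer, and the centre of 2A_11 is {1, -1}.
  have hez : e ⟨z, hzC⟩ = preimageNegOne _ := by
    refine (eq_one_or_of_central_twoAlt (by norm_num) fun y => ?_).resolve_left fun h => ?_
    · obtain ⟨⟨y, hy⟩, rfl⟩ := e.surjective y
      rw [← map_mul, ← map_mul]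
      exact congrArg e (Subtype.ext (Subgroup.mem_centralizer_singleton_iff.1 hy).symm)
    · rw [map_eq_one_iff e e.injective] at h
      rw [show z = 1 from congrArg Subtype.val h, orderOf_one] at hz
      norm_num at hz
  have hfZ : F.comp (sylHom hζ) SylLy.elemZ = z := by
    have h1 : extendAlt 10 (sylHom hζ SylLy.elemZ : TwoAlt 10) = e ⟨z, hzC⟩ := by
      rw [hez, ← SylCoord.el_cZ (ζ := ζ), sylHom_el, sylVal_cZ]
      exact extendAlt_preimageNegOne
    change ((e.symm (extendAlt 10 (sylHom hζ SylLy.elemZ : TwoAlt 10)) :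
      Subgroup.centralizer ({z} : Set G)) : G) = z
    rw [h1, MulEquiv.symm_apply_apply]
  -- The centre of S is ⟨Z⟩ and Z goes to `z`, whose centralizer has order 11! = 2^8 · 155925.
  refine ⟨F, isSylowTwoEmbedding_of_card_centralizer (hF.comp (sylHom_injective hζ))
    (SylCoord.elemZ_central hζ) (fun s hs => SylCoord.eq_one_or_of_central hζ hs) (SylCoord.card_sylLy hζ)
    (m := 155925) ?_ (by norm_num)⟩
  rw [hfZ, Nat.card_congr e.toEquiv, card_twoAlt]
  decide +kernel

end Lyons

end

theorem lemma5p1 (ζ : F4) (hζ : IsPrimitiveRoot ζ 3) :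
    -- `UT_3(4) : ⟨g, A⟩` is a Sylow 2-subgroup of `2S_8` (and then of `2A_10`)
    (∃ f : SylLy →* twoSymEight, IsSylowTwoEmbedding f) ∧
    (∀ f : SylLy →* twoSymEight, IsSylowTwoEmbedding f →
      IsSylowTwoEmbedding (twoSymEight.subtype.comp f) ∧
      -- ranks
      Nat.card (SylLy.fourI.map f) = 2 ^ 4 ∧
      Nat.card ((SylLy.threeATZ ζ).map f) = 2 ^ 3 ∧
      -- the conjugacy classes in `2S_8` and in `2A_10`
      TwoClassesOfMaxElemAbTwo (SylLy.fourI.map f) ((SylLy.threeATZ ζ).map f) ∧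
      TwoClassesOfMaxElemAbTwo (SylLy.fourI.map (twoSymEight.subtype.comp f))
        ((SylLy.threeATZ ζ).map (twoSymEight.subtype.comp f)) ∧
      -- `2^4` is weakly closed in `Syl_2(2S_8) ⊆ 2S_8`
      IsWeaklyClosed (SylLy.fourI.map f) f.range ∧
      -- `⟨A, T, Z⟩` is weakly closed in `2S_8 ⊆ 2A_10`
      IsWeaklyClosed ((SylLy.threeATZ ζ).map (twoSymEight.subtype.comp f)) twoSymEight ∧
      -- `⟨A, T, Z⟩` is its own centralizer, and its Weyl groups are `D_8` and `S_4`
      Subgroup.centralizer (((SylLy.threeATZ ζ).map f : Subgroup twoSymEight) :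
        Set twoSymEight) = (SylLy.threeATZ ζ).map f ∧
      Nonempty (WeylGroup ((SylLy.threeATZ ζ).map f) ≃* DihedralGroup 4) ∧
      Subgroup.centralizer (((SylLy.threeATZ ζ).map (twoSymEight.subtype.comp f) :
        Subgroup (TwoAlt 10)) : Set (TwoAlt 10)) =
          (SylLy.threeATZ ζ).map (twoSymEight.subtype.comp f) ∧
      Nonempty (WeylGroup ((SylLy.threeATZ ζ).map (twoSymEight.subtype.comp f)) ≃*
        Equiv.Perm (Fin 4))) ∧
    -- the Lyons group
    (∀ (G : Type*) [Group G], IsLyonsGroup G →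
      (∃ f : SylLy →* G, IsSylowTwoEmbedding f) ∧
      ∀ f : SylLy →* G, IsSylowTwoEmbedding f →
        ∀ M : Subgroup G, IsMaxElemAbTwo M →
          AreConj (SylLy.fourI.map f) M ∨ AreConj ((SylLy.threeATZ ζ).map f) M) := by
  refine ⟨⟨_, isSylowTwoEmbedding_sym hζ⟩, fun f hf => ?_, fun G _ hG => ?_⟩
  · have hf' := isSylowTwoEmbedding_alt hζ (f := twoSymEight.subtype.comp f)
      ((Subgroup.subtype_injective twoSymEight).comp hf.1)
    have h₀ := isSylowTwoEmbedding_alt hζ (sylOver_alt hζ).injective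
    -- The image of V under an arbitrary identification is conjugate to its image under the explicit
    -- one, which transports centralizers and Weyl groups.
    have hc := (areConj_map_of_isSylow hζ (isSylowTwoEmbedding_sym hζ) hf).2.symm
    have hc' := (areConj_map_of_isSylow hζ h₀ hf').2.symm
    have hC := hc.centralizer_eq ((sylOver_sym hζ).centralizer_eq symPerm_mem_alt)
    have hC' := hc'.centralizer_eq ((sylOver_alt hζ).centralizer_eq spinPerm_mem_alt)
    have hV := isMaxElemAbTwo_of_centralizer ((isElemAbTwo_threeATZ hζ).map f) hC
    have hV' := isMaxElemAbTwo_of_centralizer ((isElemAbTwo_threeATZ hζ).map _) hC'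
    exact ⟨hf', (card_map hf.1 _).trans (SylCoord.card_fourI hζ),
      (card_map hf.1 _).trans (SylCoord.card_threeATZ hζ),
      twoClasses hζ (F := MonoidHom.id _) (isSylowTwoEmbedding_sym hζ) hf hV,
      twoClasses hζ h₀ hf' hV', isWeaklyClosed_fourI hζ hf.1, isWeaklyClosed_threeATZ hζ hf hV',
      hC, hc.nonempty_weylGroup (nonempty_weylGroup_sym hζ),
      hC', hc'.nonempty_weylGroup (nonempty_weylGroup_alt hζ)⟩
  · have := hG.finite
    obtain ⟨F, hF⟩ := hG.exists_embedding hζ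
    exact ⟨⟨_, hF⟩, fun f hf M hM => areConj_or_of_isMaxElemAbTwo hζ hF hf hM⟩
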